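/- **Setting.** Consider the spatial Stark problem $\ddot q=-\dfrac{q}{|q|^3}+(0,0,1)$, $q=(x,y,z)\in\mathbb R^3\setminus\{0\}$. An orbit is a solution on its maximal interval of existence; it is called bounded if its whole trace in $\mathbb R^3$ is bounded, and circular if its trace in $\mathbb R^3$ is a circle. Let $L=x\dot y-y\dot x$ be the angular momentum about the $z$-axis, $h=\frac12|\dot q|^2-\frac1{|q|}-z$ the energy, $\xi=\sqrt{|q|+z}$, $\eta=\sqrt{|q|-z}$, $dt=(\xi^2+\eta^2)\,d\tau$, $'=\frac{d}{d\tau}$, and let the separation constant $c$ be given by $$-c=h\xi^2-\tfrac12\xi'^2+1+\tfrac12\xi^4-\frac{L^2}{2\xi^2}.$$ Fix $L\neq0$ and let $L^{2/3}$ denote $|L|^{2/3}$. Then $L,h,c$ are constant along each orbit with angular momentum $L$, and $\xi'^2=f(\xi^2)/\xi^2$, $\eta'^2=g(\eta^2)/\eta^2$ with $f(u)=u^3+2hu^2+2(c+1)u-L^2$ and $g(v)=-v^3+2hv^2-2(c-1)v-L^2$. For $h\le-\frac32L^{2/3}$ let $u_-\in(0,L^{2/3}]$ and $u_+\in[L^{2/3},\infty)$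 be the solutions of $2u+L^2/u^2=-2h$, let $v_*>0$ be the solution of $2v-L^2/v^2=2h$, and put $$C_{1,\xi}(h)=\tfrac12\Big(u_-^2+\frac{2L^2}{u_-}\Big)-1,\qquad C_{2,\xi}(h)=\tfrac12\Big(u_+^2+\frac{2L^2}{u_+}\Big)-1,\qquad C_\eta(h)=\tfrac12\Big(v_*^2-\frac{2L^2}{v_*}\Big)+1 .$$ **Theorem.** The orbits with angular momentum $L\ne0$ are classified as follows. (a) If $L^2>(16/27)^{3/2}$ or $h>-\frac32L^{2/3}$, all orbits are unbounded. (b) If $L^2=(16/27)^{3/2}$ and $h=-\frac32L^{2/3}$, there is, up to a shift of time, a unique bounded orbit; it has $c=-\frac19$ and is circular. If $L^2=(16/27)^{3/2}$ and $h<-\frac32L^{2/3}$, all orbits are unbounded. (c) If $0<L^2<(16/27)^{3/2}$, there are $h_1<h_2<-\frac32L^{2/3}$ such that, on $(-\infty,-\frac32L^{2/3}]$, $h_1$ is the only solution of $C_{1,\xi}(h)=C_\eta(h)$ and $h_2$ is the only solution of $C_{2,\xi}(h)=C_\eta(h)$. For $h<h_1$ all orbits are unbounded, and: * (c1) If $h_2<h\le-\frac32L^{2/3}$,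 bounded orbits exist exactly for $c\in[C_{1,\xi}(h),C_{2,\xi}(h)]$. Along every bounded orbit $\eta$ is a nonconstant periodic function of $\tau$, and there is no circular orbit. If $C_{1,\xi}(h)<c<C_{2,\xi}(h)$, every bounded orbit is oscillatory: $\xi$ and $\eta$ are both nonconstant periodic functions of $\tau$, and neither $z$ nor $\sqrt{x^2+y^2}$ is constant. * (c2) If $h=h_2$, bounded orbits exist exactly for $c\in[C_{1,\xi}(h_2),C_{2,\xi}(h_2)]$. Those with $c<C_{2,\xi}(h_2)$ are as in (c1): $\eta$ is nonconstant and periodic in $\tau$, and if moreover $c>C_{1,\xi}(h_2)$ they are oscillatory. For $c=C_{2,\xi}(h_2)$ there is a circular orbit, which is unstable, even under perturbations with the same $L$; along it $\eta^2$ is the double positive root $v_2=v_3$ of $g$ (the third root being negative), and $\xi$ is a hyperbolic fixed point, with $\xi^2=u_2=u_3$, where $0<u_1<u_2=u_3$ are the roots of $f$. There is also a non-circular orbit with $c=C_{2,\xi}(h_2)$ that tends (in phase space) to the circular orbit as $t\to\pm\infty$. Every bounded orbit with $h=h_2$ and $c=C_{2,\xi}(h_2)$ is, up to a shift of time, the circular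 orbit, or tends to it as $t\to\pm\infty$. * (c3) If $h_1<h<h_2$, bounded orbits exist exactly for $c\in[C_{1,\xi}(h),C_\eta(h)]$. The energy surface $H=h$ in the variables $(\xi,\eta,\xi',\eta')$, $\xi,\eta>0$, where $$H=\frac12\,\frac{\xi'^2+\eta'^2}{\xi^2+\eta^2}+\frac{L^2}{2\xi^2\eta^2}-\frac2{\xi^2+\eta^2}-\frac{\xi^2-\eta^2}2,$$ has exactly two connected components, exactly one of which is compact, and the bounded orbits are those that lie on the compact one. The compact component is the union of the sets on which $c$ takes a given value in $[C_{1,\xi}(h),C_\eta(h)]$. These sets are invariant; each is homeomorphic to the torus $S^1\times S^1$ for $C_{1,\xi}(h)<c<C_\eta(h)$, and to the circle $S^1$ for $c=C_{1,\xi}(h)$ and for $c=C_\eta(h)$. * (c4) If $h=h_1$, there is, up to a shift of time, exactly one bounded orbit. It has $c=C_{1,\xi}(h_1)$, is circular, and is orbitally (Lyapunov) stable. Along it $\eta^2$ is the double positive root $v_2=v_3$ of $g$ (the third root being negative), and $\xi$ is an elliptic fixed point, with $\xi^2=u_1=u_2$, where $0<u_1=u_2<u_3$ are the roots of $f$. 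-/

import Mathlib

open Set Filter Topology

/-- Physical space, with coordinates `x = q 0`, `y = q 1`, `z = q 2`. -/
abbrev E3 := EuclideanSpace ℝ (Fin 3)

/-- Right-hand side of the spatial Stark problem `q'' = -q / |q|^3 + (0, 0, 1)`. -/
noncomputable def starkForce (q : E3) : E3 :=
  -(1 / ‖q‖ ^ 3) • q + EuclideanSpace.single 2 1

/-- `q` solves the spatial Stark problem, with velocity `v`, on the nonempty open interval `I`. -/
structure IsStarkSolution (I : Set ℝ) (q v : ℝ → E3) : Prop where
  isOpen : IsOpen I
  ordConnected : I.OrdConnected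
  nonempty : I.Nonempty
  ne_zero : ∀ t ∈ I, q t ≠ 0
  hasDerivAt_pos : ∀ t ∈ I, HasDerivAt q (v t) t
  hasDerivAt_vel : ∀ t ∈ I, HasDerivAt v (starkForce (q t)) t

/-- An orbit is a solution on its maximal interval of existence. -/
structure IsStarkOrbit (I : Set ℝ) (q v : ℝ → E3) : Prop extends IsStarkSolution I q v where
  maximal : ∀ (J : Set ℝ) (q' v' : ℝ → E3),
    IsStarkSolution J q' v' → I ⊆ J → EqOn q' q I → J = I

/-- The component along the `z`-axis of the angular momentum. -/
noncomputable def angMom (q v : E3) : ℝ := q 0 * v 1 - q 1 * v 0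

/-- The Hamiltonian. -/
noncomputable def energy (q v : E3) : ℝ := ‖v‖ ^ 2 / 2 - 1 / ‖q‖ - q 2

/-- The parabolic coordinate `ξ ≥ 0`, with `ξ ^ 2 = |q| + z`. -/
noncomputable def xi (q : E3) : ℝ := √(‖q‖ + q 2)

/-- The parabolic coordinate `η ≥ 0`, with `η ^ 2 = |q| - z`. -/
noncomputable def eta (q : E3) : ℝ := √(‖q‖ - q 2)

/-- `ξ' = dξ/dτ`, where `dt = (ξ ^ 2 + η ^ 2) dτ = 2 |q| dτ`. -/
noncomputable def xiPrime (q v : E3) : ℝ := (inner ℝ q v + ‖q‖ * v 2) / xi q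

/-- `η' = dη/dτ`, where `dt = (ξ ^ 2 + η ^ 2) dτ = 2 |q| dτ`. -/
noncomputable def etaPrime (q v : E3) : ℝ := (inner ℝ q v - ‖q‖ * v 2) / eta q

/-- The reduced state `(ξ, η, ξ', η')`. -/
noncomputable def parabolicState (q v : E3) : ℝ × ℝ × ℝ × ℝ :=
  (xi q, eta q, xiPrime q v, etaPrime q v)

/-- The Hamiltonian with angular momentum `L` in the variables `(ξ, η, ξ', η')`. -/
noncomputable def redEnergy (L : ℝ) : ℝ × ℝ × ℝ × ℝ → ℝ := fun (ξ, η, ξ', η') =>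
  (ξ' ^ 2 + η' ^ 2) / (2 * (ξ ^ 2 + η ^ 2)) + L ^ 2 / (2 * (ξ ^ 2 * η ^ 2))
    - 2 / (ξ ^ 2 + η ^ 2) - (ξ ^ 2 - η ^ 2) / 2

/-- The separation constant `c`:
`-c = H ξ ^ 2 - ξ' ^ 2 / 2 + 1 + ξ ^ 4 / 2 - L ^ 2 / (2 ξ ^ 2)`. -/
noncomputable def redSep (L : ℝ) : ℝ × ℝ × ℝ × ℝ → ℝ := fun (ξ, η, ξ', η') =>
  -(redEnergy L (ξ, η, ξ', η') * ξ ^ 2 - ξ' ^ 2 / 2 + 1 + ξ ^ 4 / 2 - L ^ 2 / (2 * ξ ^ 2))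

/-- The separation constant `c` of a point of phase space. -/
noncomputable def sepConst (q v : E3) : ℝ := redSep (angMom q v) (parabolicState q v)

/-- Angular momentum, energy and separation constant have the values `L`, `h`, `c` along `I`. -/
def HasConstants (I : Set ℝ) (q v : ℝ → E3) (L h c : ℝ) : Prop :=
  ∀ t ∈ I, angMom (q t) (v t) = L ∧ energy (q t) (v t) = h ∧ sepConst (q t) (v t) = c

/-- An orbit with constants `L`, `h`, `c`. -/
def IsOrbitWith (L h c : ℝ) (I : Set ℝ) (q v : ℝ → E3) : Prop :=
  IsStarkOrbit I q v ∧ HasConstants I q v L h c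

/-- The orbit stays in a bounded region of space, in both directions of time. -/
def IsBoundedOrbit (I : Set ℝ) (q : ℝ → E3) : Prop := Bornology.IsBounded (q '' I)

/-- There is a bounded orbit with constants `L`, `h`, `c`. -/
def ExistsBoundedOrbit (L h c : ℝ) : Prop :=
  ∃ (I : Set ℝ) (q v : ℝ → E3), IsOrbitWith L h c I q v ∧ IsBoundedOrbit I q

/-- The trace of the orbit is a circle: centre `a`, radius `R`, in the plane normal to `n`. -/
def IsCircular (I : Set ℝ) (q : ℝ → E3) : Prop :=
  ∃ (a n : E3) (R : ℝ), n ≠ 0 ∧ 0 < R ∧ q '' I = {p | ‖p - a‖ = R ∧ inner ℝ n (p - a) = 0}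

/-- `(I, q, v)` is defined for all times and agrees with `(q₀, v₀)` up to a shift of time. -/
def IsTimeShiftOf (I : Set ℝ) (q v q₀ v₀ : ℝ → E3) : Prop :=
  I = univ ∧ ∃ s : ℝ, ∀ t, q t = q₀ (t + s) ∧ v t = v₀ (t + s)

/-- The trace in phase space of a motion defined for all times. -/
def phaseTrace (q v : ℝ → E3) : Set (E3 × E3) := range fun t => (q t, v t)

/-- The motion `(q, v)` tends, along `l`, to the orbit of `(q₀, v₀)` in phase space. -/
def TendsToOrbit (l : Filter ℝ) (q v q₀ v₀ : ℝ → E3) : Prop :=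
  Tendsto (fun t => Metric.infDist (q t, v t) (phaseTrace q₀ v₀)) l (𝓝 0)

/-- Orbital (Lyapunov) stability of the orbit of `(q₀, v₀)` under perturbations of the initial
state that lie in `S`. -/
def IsOrbitallyStable (S : Set (E3 × E3)) (q₀ v₀ : ℝ → E3) : Prop :=
  ∀ ε > 0, ∃ δ > 0, ∀ (I : Set ℝ) (q v : ℝ → E3), IsStarkSolution I q v → 0 ∈ I →
    (q 0, v 0) ∈ S → Metric.infDist (q 0, v 0) (phaseTrace q₀ v₀) < δ →
      ∀ t ∈ I, 0 ≤ t → Metric.infDist (q t, v t) (phaseTrace q₀ v₀) < ε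

/-- Along the orbit, the coordinate `F` is a nonconstant periodic function of `τ ∈ ℝ`, where
`dt = 2 |q| dτ`. -/
def IsTauPeriodic (F : E3 → ℝ) (I : Set ℝ) (q : ℝ → E3) : Prop :=
  ∃ (τ N : ℝ → ℝ) (P : ℝ), (∀ t ∈ I, HasDerivAt τ (1 / (2 * ‖q t‖)) t) ∧ τ '' I = univ ∧
    0 < P ∧ Function.Periodic N P ∧ (∃ a b, N a ≠ N b) ∧ ∀ t ∈ I, F (q t) = N (τ t)

/-- Oscillatory orbit: `ξ` and `η` are both nonconstant and periodic in `τ`, and the motion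
changes both its height `z` and its distance `√(x ^ 2 + y ^ 2)` to the `z`-axis. -/
def IsOscillatory (I : Set ℝ) (q : ℝ → E3) : Prop :=
  IsTauPeriodic xi I q ∧ IsTauPeriodic eta I q ∧
    (∃ s ∈ I, ∃ t ∈ I, q s 2 ≠ q t 2) ∧
    (∃ s ∈ I, ∃ t ∈ I, √(q s 0 ^ 2 + q s 1 ^ 2) ≠ √(q t 0 ^ 2 + q t 1 ^ 2))

/-- The critical value `(16/27)^(3/2)` of `L ^ 2`. -/
noncomputable def critL2 : ℝ := (16 / 27 : ℝ) ^ (3 / 2 : ℝ)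

/-- The energy `-(3/2) L^(2/3)`, where `L^(2/3)` is the positive cube root of `L ^ 2`. -/
noncomputable def hTop (L : ℝ) : ℝ := -(3 / 2) * |L| ^ (2 / 3 : ℝ)

/-- The cubic `f`, for which `ξ' ^ 2 = f (ξ ^ 2) / ξ ^ 2`. -/
def xiCubic (L h c u : ℝ) : ℝ := u ^ 3 + 2 * h * u ^ 2 + 2 * (c + 1) * u - L ^ 2

/-- The cubic `g`, for which `η' ^ 2 = g (η ^ 2) / η ^ 2`. -/
def etaCubic (L h c v : ℝ) : ℝ := -v ^ 3 + 2 * h * v ^ 2 - 2 * (c - 1) * v - L ^ 2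

/-- The only solution of `2 u + L ^ 2 / u ^ 2 = -2 h` in `(0, L^(2/3)]`
(for `L ≠ 0` and `h ≤ -(3/2) L^(2/3)`): the double root of `f` when its two smaller roots agree. -/
noncomputable def uLow (L h : ℝ) : ℝ :=
  sInf {u | 0 < u ∧ u ≤ |L| ^ (2 / 3 : ℝ) ∧ 2 * u + L ^ 2 / u ^ 2 = -2 * h}

/-- The only solution of `2 u + L ^ 2 / u ^ 2 = -2 h` in `[L^(2/3), ∞)`
(for `L ≠ 0` and `h ≤ -(3/2) L^(2/3)`): the double root of `f` when its two larger roots agree. -/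
noncomputable def uHigh (L h : ℝ) : ℝ :=
  sInf {u | |L| ^ (2 / 3 : ℝ) ≤ u ∧ 2 * u + L ^ 2 / u ^ 2 = -2 * h}

/-- The only positive solution of `2 v - L ^ 2 / v ^ 2 = 2 h` (for `L ≠ 0`): the double root of
`g` when its two positive roots agree. -/
noncomputable def vDouble (L h : ℝ) : ℝ :=
  sInf {v | 0 < v ∧ 2 * v - L ^ 2 / v ^ 2 = 2 * h}

/-- `C_{1,ξ}(h)`: the value of `c` for which `f` has the double root `uLow L h`. -/
noncomputable def C1xi (L h : ℝ) : ℝ :=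
  (uLow L h + 2 * L ^ 2 / uLow L h ^ 2) * uLow L h / 2 - 1

/-- `C_{2,ξ}(h)`: the value of `c` for which `f` has the double root `uHigh L h`. -/
noncomputable def C2xi (L h : ℝ) : ℝ :=
  (uHigh L h + 2 * L ^ 2 / uHigh L h ^ 2) * uHigh L h / 2 - 1

/-- `C_η(h)`: the value of `c` for which `g` has the double root `vDouble L h`. -/
noncomputable def Ceta (L h : ℝ) : ℝ :=
  (vDouble L h - 2 * L ^ 2 / vDouble L h ^ 2) * vDouble L h / 2 + 1

/-- The function `F` with `ξ' ^ 2 = F ξ`; so `ξ'' = F' (ξ) / 2`. -/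
noncomputable def xiPot (L h c : ℝ) : ℝ → ℝ := fun ξ =>
  ξ ^ 4 + 2 * h * ξ ^ 2 + 2 * (c + 1) - L ^ 2 / ξ ^ 2

/-- `w ^ 2` is the largest root `u₂ = u₃` of `f`, with `0 < u₁ < u₂`, and `w` is a
hyperbolic fixed point of the `ξ`-equation. -/
def IsXiHyperbolic (L h c w : ℝ) : Prop :=
  (∃ u₁, 0 < u₁ ∧ u₁ < w ^ 2 ∧ ∀ u, xiCubic L h c u = (u - u₁) * (u - w ^ 2) ^ 2) ∧
    xiPot L h c w = 0 ∧ deriv (xiPot L h c) w = 0 ∧ 0 < deriv (deriv (xiPot L h c)) w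

/-- `w ^ 2` is the smallest root `u₁ = u₂` of `f`, with `0 < u₂ < u₃`, and `w` is an
elliptic fixed point of the `ξ`-equation. -/
def IsXiElliptic (L h c w : ℝ) : Prop :=
  (∃ u₃, 0 < w ^ 2 ∧ w ^ 2 < u₃ ∧ ∀ u, xiCubic L h c u = (u - w ^ 2) ^ 2 * (u - u₃)) ∧
    xiPot L h c w = 0 ∧ deriv (xiPot L h c) w = 0 ∧ deriv (deriv (xiPot L h c)) w < 0

/-- `w ^ 2` is the largest root `v₂ = v₃` of `g`, with `v₁ < 0 < v₂`. -/
def IsEtaDouble (L h c w : ℝ) : Prop :=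
  ∃ v₁ < 0, 0 < w ^ 2 ∧ ∀ v, -etaCubic L h c v = (v - v₁) * (v - w ^ 2) ^ 2

/-- The energy surface of the reduced system, in the variables `(ξ, η, ξ', η')`, `ξ, η > 0`. -/
def energySurface (L h : ℝ) : Set (ℝ × ℝ × ℝ × ℝ) :=
  {p | 0 < p.1 ∧ 0 < p.2.1 ∧ redEnergy L p = h}

/-- The set of connected components of a set. -/
def componentsOf {X : Type*} [TopologicalSpace X] (E : Set X) : Set (Set X) :=
  {K | ∃ p ∈ E, K = connectedComponentIn E p}

/-- The part of `K` on which the separation constant is `c`. -/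
def sepLevel (L : ℝ) (K : Set (ℝ × ℝ × ℝ × ℝ)) (c : ℝ) : Set (ℝ × ℝ × ℝ × ℝ) :=
  {p ∈ K | redSep L p = c}

/-! With u = ξ², v = η², p = ξξ' and w = ηη', the problem separates in the time τ: u' = 2p, p' =
f'(u), p² = f(u), and likewise v' = 2w, w' = g'(v), w² = g(v). These relations have no singularity
on the axis when c is written as `lenz`. For L ≠ 0 the angular momentum keeps orbits away from the
origin, so all of them exist for all times (`exists_isStarkSolution_univ`). Since g tends to -∞, η
is always bounded, and boundedness concerns u alone.

Where f(u) ≥ 0 one has u f'(u) ≥ 2u³ + 2hu² + L². For h > `hTop L` this pushes u outwards at all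
times, and for h ≤ `hTop L` it does so beyond `uHigh`; hence a bounded orbit has h ≤ `hTop L` and u
≤ `uHigh` (`le_hTop`, `u_le_uHigh`). Writing f as a cubic with a double root plus 2(c - C)u then
gives c ≥ `C1xi`, and a virial argument gives c ≤ `C2xi` (`le_C2xi`). The same form of g gives c ≤
`Ceta`. Conversely these three inequalities suffice (`existsBoundedOrbit_iff`): below `C2xi` the
value f(`uHigh`) < 0 is a barrier, and for c = `C2xi` the point `uHigh` is an equilibrium.

`C1xi` and `C2xi` strictly decrease in h and `Ceta` strictly increases, so each threshold is the
only solution of its equation. The solutions are the energies of circular orbits. At distance r from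
the origin these have z = r³ and L² = r(1 - r⁴)², a function that rises from 0 to `critL2` at 3r² =
1 and falls back to 0 at r = 1. The orbit with 3r² < 1 has u = `uLow` and gives h₁; the one with 3r²
> 1 has u = `uHigh` and gives h₂.

The motions are explicit: u = m + d cos θ between two simple roots (`IsMotion.exists_periodic`), and
a tanh² profile at a double root (`IsMotion.exists_homoclinic`). The orbit at h₁ is stable because
the first integrals isolate it; the orbit at h₂ is unstable because a homoclinic orbit leaves it.
For h₁ < h < h₂, the energy surface is that of two uncoupled wells in ξ and η: below the barrier its
inner part is an image of the 3-sphere, foliated by products of two closed curves, and its outer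
part is a graph. -/

/-! ### Ordinary differential equations: uniqueness, global existence, change of time. -/

section ODE

variable {E : Type*} [NormedAddCommGroup E] [NormedSpace ℝ E]

/-- Uniqueness for `X' = κ(t) • F(X)`, with `F` locally Lipschitz on a neighbourhood of the values of `X`. -/
theorem eqOn_of_hasDerivAt_smul {F : E → E} {κ : ℝ → ℝ} {I : Set ℝ} {X Y : ℝ → E} {t₀ : ℝ}
    (hI : IsOpen I) (hI' : IsPreconnected I) (hκ : ContinuousOn κ I)
    (hF : ∀ t ∈ I, ContDiffAt ℝ 1 F (X t))
    (hX : ∀ t ∈ I, HasDerivAt X (κ t • F (X t)) t)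
    (hY : ∀ t ∈ I, HasDerivAt Y (κ t • F (Y t)) t)
    (ht₀ : t₀ ∈ I) (h₀ : X t₀ = Y t₀) : EqOn X Y I := by
  have hXc : ContinuousOn X I := fun t ht => (hX t ht).continuousAt.continuousWithinAt
  have hYc : ContinuousOn Y I := fun t ht => (hY t ht).continuousAt.continuousWithinAt
  have key : ∀ t ∈ I, X t = Y t → X =ᶠ[𝓝 t] Y := by
    intro t ht hXY
    obtain ⟨K, s, hs, hK⟩ := (hF t ht).exists_lipschitzOnWith
    have hb : ∀ᶠ x in 𝓝 t, ‖κ x‖₊ ≤ ‖κ t‖₊ + 1 := by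
      have : ContinuousAt (fun x => ‖κ x‖₊) t := ((hκ.continuousAt (hI.mem_nhds ht))).nnnorm
      exact (this.eventually_lt continuousAt_const (lt_add_one _)).mono fun x hx => hx.le
    refine ODE_solution_unique_of_eventually (v := fun x => κ x • F) (s := fun _ => s)
      (K := (‖κ t‖₊ + 1) * K) ?_ ?_ ?_ hXY
    · filter_upwards [hb] with x hx
      have h1 : LipschitzWith ‖κ x‖₊ (fun y : E => κ x • y) := lipschitzWith_smul (κ x)
      exact (h1.comp_lipschitzOnWith hK).weaken (by gcongr)
    · filter_upwards [hI.mem_nhds ht, (hX t ht).continuousAt.preimage_mem_nhds hs] with x hx hx'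
      exact ⟨hX x hx, hx'⟩
    · filter_upwards [hI.mem_nhds ht,
        (hY t ht).continuousAt.preimage_mem_nhds (hXY ▸ hs)] with x hx hx'
      exact ⟨hY x hx, hx'⟩
  -- The times near which X and Y agree form an open set. At a limit point of it X = Y by
  -- continuity, and local uniqueness applies there again.
  have hsub : I ⊆ {t | X =ᶠ[𝓝 t] Y} := by
    refine hI'.subset_of_closure_inter_subset isOpen_setOfPred_eventually_nhds
      ⟨t₀, ht₀, key t₀ ht₀ h₀⟩ ?_
    rintro t ⟨htc, ht⟩
    refine key t ht ?_
    have hfreq : ∃ᶠ x in 𝓝 t, X x = Y x :=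
      (mem_closure_iff_frequently.1 htc).mono fun x hx => hx.self_of_nhds
    by_contra hne
    have h1 : ∀ᶠ x in 𝓝 t, X x ≠ Y x :=
      ((hX t ht).continuousAt.ne_iff_eventually_ne (hY t ht).continuousAt).1 hne
    exact hfreq h1
  exact fun t ht => (hsub ht).self_of_nhds

/-- The Picard–Lindelöf step 1 / (1 + K) does not depend on the starting point: on the ball of
radius ‖F x₀‖ + 1 the field is at most (1 + K)(‖F x₀‖ + 1). Hence n steps can be glued. -/
theorem LipschitzWith.exists_hasDerivWithinAt_Icc [CompleteSpace E] {F : E → E} {K : NNReal}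
    (hF : LipschitzWith K F) (n : ℕ) (x₀ : E) :
    ∃ X : ℝ → E, X 0 = x₀ ∧ ∀ t ∈ Icc (0 : ℝ) (n * (1 / (1 + K))),
      HasDerivWithinAt X (F (X t)) (Icc 0 (n * (1 / (1 + K)))) t := by
  set ε : ℝ := 1 / (1 + K) with hε
  have hε0 : 0 < ε := by positivity
  have step : ∀ x₀ : E, ∃ X : ℝ → E, X 0 = x₀ ∧ ∀ t ∈ Icc (0 : ℝ) ε,
      HasDerivWithinAt X (F (X t)) (Icc 0 ε) t := by
    intro x₀
    have hPL : IsPicardLindelof (fun _ => F) (tmin := 0) (tmax := ε) ⟨0, by simp, hε0.le⟩ x₀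
        (‖F x₀‖₊ + 1) 0 (‖F x₀‖₊ + K * (‖F x₀‖₊ + 1)) K := by
      refine IsPicardLindelof.of_time_independent ?_ hF.lipschitzOnWith ?_
      · intro x hx
        have h1 : ‖F x - F x₀‖ ≤ K * ‖x - x₀‖ := hF.norm_sub_le x x₀
        have h2 : ‖x - x₀‖ ≤ ‖F x₀‖ + 1 := by
          simpa [dist_eq_norm] using hx
        have h3 : ‖F x‖ ≤ ‖F x₀‖ + ‖F x - F x₀‖ := by
          simpa using norm_add_le (F x₀) (F x - F x₀)
        push_cast

        have := mul_le_mul_of_nonneg_left h2 K.2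
        simp only [NNReal.val_eq_coe] at this
        linarith
      · have h0 := norm_nonneg (F x₀)
        have hK : (0 : ℝ) ≤ K := K.2
        have : (‖F x₀‖ + K * (‖F x₀‖ + 1)) * ε ≤ ‖F x₀‖ + 1 := by
          rw [hε, mul_one_div, div_le_iff₀ (by positivity)]
          nlinarith
        simpa [hε0.le] using this
    obtain ⟨X, hX, hX'⟩ := hPL.exists_eq_forall_mem_Icc_hasDerivWithinAt₀
    exact ⟨X, hX, hX'⟩
  induction n with
  | zero =>
    refine ⟨fun _ => x₀, rfl, fun t ht => ?_⟩
    have h1 : Icc (0 : ℝ) ((0 : ℕ) * ε) = {0} := by simp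
    rw [h1]
    have ht' : t = 0 := by simpa [h1] using ht
    subst ht'
    exact HasFDerivWithinAt.of_subsingleton subsingleton_singleton
  | succ n ih =>
    obtain ⟨X, hX, hX'⟩ := ih
    set T : ℝ := n * ε
    have hT : 0 ≤ T := by positivity
    obtain ⟨Y, hY, hY'⟩ := step (X T)
    have hT' : ((n + 1 : ℕ) : ℝ) * ε = T + ε := by push_cast; ring
    rw [hT']
    have hu : Icc (0 : ℝ) (T + ε) = Icc 0 T ∪ Icc T (T + ε) :=
      (Icc_union_Icc_eq_Icc hT (by linarith)).symm
    have hYs : ∀ t ∈ Icc T (T + ε),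
        HasDerivWithinAt (fun s => Y (s - T)) (F (Y (t - T))) (Icc T (T + ε)) t := by
      intro t ht
      have h1 := (hY' (t - T) ⟨by linarith [ht.1], by linarith [ht.2]⟩)
      have h2 : HasDerivWithinAt (fun s : ℝ => s - T) 1 (Icc T (T + ε)) t :=
        ((hasDerivAt_id t).sub_const T).hasDerivWithinAt
      have := h1.scomp t h2 (fun s (hs : s ∈ Icc T (T + ε)) => ⟨by linarith [hs.1], by linarith [hs.2]⟩)
      simpa [Function.comp_def] using this
    set Z : ℝ → E := fun s => if s ≤ T then X s else Y (s - T) with hZ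
    have hZ1 : EqOn Z X (Icc 0 T) := fun s hs => by simp [hZ, hs.2]
    have hZ2 : EqOn Z (fun s => Y (s - T)) (Icc T (T + ε)) := by
      intro s hs
      rcases hs.1.eq_or_lt with h | h
      · subst h; simp [hZ, hY]
      · simp [hZ, not_le.2 h]
    refine ⟨Z, by simp [hZ, hT, hX], fun t ht => ?_⟩
    rw [hu]
    refine HasDerivWithinAt.union ?_ ?_
    · by_cases h : t ∈ Icc 0 T
      · exact hZ1 h ▸ (hX' t h).congr_of_mem hZ1 h
      · exact HasFDerivWithinAt.of_notMem_closure (by rwa [isClosed_Icc.closure_eq])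
    · by_cases h : t ∈ Icc T (T + ε)
      · exact hZ2 h ▸ (hYs t h).congr_of_mem hZ2 h
      · exact HasFDerivWithinAt.of_notMem_closure (by rwa [isClosed_Icc.closure_eq])

/-- Backward solutions are forward solutions for -F. The solutions on growing intervals agree by
uniqueness, so their values patch to one curve on the line. -/
theorem LipschitzWith.exists_forall_hasDerivAt [CompleteSpace E] {F : E → E} {K : NNReal}
    (hF : LipschitzWith K F) (x₀ : E) :
    ∃ X : ℝ → E, X 0 = x₀ ∧ ∀ t, HasDerivAt X (F (X t)) t := by
  set ε : ℝ := 1 / (1 + K) with hε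
  have hε0 : 0 < ε := by positivity
  have main : ∀ n : ℕ, ∃ X : ℝ → E, X 0 = x₀ ∧ ∀ t ∈ Ioo (-(n * ε)) (n * ε),
      HasDerivAt X (F (X t)) t := by
    intro n
    obtain ⟨X, hX, hX'⟩ := hF.exists_hasDerivWithinAt_Icc n x₀
    have hnF : LipschitzWith K (fun x => - F x) := hF.neg
    obtain ⟨Y, hY, hY'⟩ := hnF.exists_hasDerivWithinAt_Icc n x₀
    rw [← hε] at hX' hY'
    set T : ℝ := n * ε
    have hT : 0 ≤ T := by positivity
    have hYs : ∀ t ∈ Icc (-T) 0,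
        HasDerivWithinAt (fun s => Y (-s)) (F (Y (-t))) (Icc (-T) 0) t := by
      intro t ht
      have h1 := (hY' (-t) ⟨by linarith [ht.2], by linarith [ht.1]⟩)
      have h2 : HasDerivWithinAt (fun s : ℝ => -s) (-1) (Icc (-T) 0) t :=
        (hasDerivAt_neg t).hasDerivWithinAt
      have := h1.scomp t h2 (fun s (hs : s ∈ Icc (-T) 0) => ⟨by linarith [hs.2], by linarith [hs.1]⟩)
      simpa [Function.comp_def] using this
    set Z : ℝ → E := fun s => if s ≤ 0 then Y (-s) else X s with hZ
    have hZ1 : EqOn Z (fun s => Y (-s)) (Icc (-T) 0) := fun s hs => by simp [hZ, hs.2]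
    have hZ2 : EqOn Z X (Icc 0 T) := by
      intro s hs
      rcases hs.1.eq_or_lt with h | h
      · subst h; simp [hZ, hY, hX]
      · simp [hZ, not_le.2 h]
    have hu : Icc (-T) T = Icc (-T) 0 ∪ Icc 0 T :=
      (Icc_union_Icc_eq_Icc (by linarith) hT).symm
    refine ⟨Z, by simp [hZ, hY], fun t ht => ?_⟩
    refine HasDerivWithinAt.hasDerivAt (s := Icc (-T) T) ?_ (Icc_mem_nhds ht.1 ht.2)
    rw [hu]
    refine HasDerivWithinAt.union ?_ ?_
    · by_cases h : t ∈ Icc (-T) 0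
      · exact hZ1 h ▸ (hYs t h).congr_of_mem hZ1 h
      · exact HasFDerivWithinAt.of_notMem_closure (by rwa [isClosed_Icc.closure_eq])
    · by_cases h : t ∈ Icc 0 T
      · exact hZ2 h ▸ (hX' t h).congr_of_mem hZ2 h
      · exact HasFDerivWithinAt.of_notMem_closure (by rwa [isClosed_Icc.closure_eq])
  choose X hX hX' using main
  have huniq : ∀ m n : ℕ, m ≤ n → EqOn (X m) (X n) (Ioo (-(m * ε)) (m * ε)) := by
    intro m n hmn t ht
    have hmn' : (m : ℝ) * ε ≤ n * ε := by gcongr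
    have h0 : (0 : ℝ) ∈ Ioo (-(m * ε)) (m * ε) := ⟨by linarith [ht.1, ht.2], by linarith [ht.1, ht.2]⟩
    exact ODE_solution_unique_of_mem_Ioo (v := fun _ => F) (s := fun _ => univ) (K := K)
      (fun _ _ => hF.lipschitzOnWith) h0 (fun s hs => ⟨hX' m s hs, trivial⟩)
      (fun s hs => ⟨hX' n s ⟨by linarith [hs.1], by linarith [hs.2]⟩, trivial⟩)
      ((hX m).trans (hX n).symm) ht
  -- The + 1 makes the inequality strict, so that t is an interior point of the interval on which
  -- the chosen solution is known.
  have hlt : ∀ t : ℝ, |t| < (⌈|t| / ε⌉₊ + 1 : ℕ) * ε := by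
    intro t
    have h1 : |t| / ε < (⌈|t| / ε⌉₊ + 1 : ℕ) := by
      push_cast; exact (Nat.le_ceil _).trans_lt (lt_add_one _)
    rwa [div_lt_iff₀ hε0] at h1
  have hval : ∀ (t : ℝ) (n : ℕ), |t| < n * ε → X (⌈|t| / ε⌉₊ + 1) t = X n t := by
    intro t n hn
    rcases le_total (⌈|t| / ε⌉₊ + 1) n with h | h
    · exact huniq _ _ h (abs_lt.1 (hlt t))
    · exact (huniq _ _ h (abs_lt.1 hn)).symm
  refine ⟨fun t => X (⌈|t| / ε⌉₊ + 1) t, hX _, fun t => ?_⟩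
  set n := ⌈|t| / ε⌉₊ + 1
  refine (hX' n t (abs_lt.1 (hlt t))).congr_of_eventuallyEq ?_
  have : ∀ᶠ s in 𝓝 t, |s| < n * ε := continuous_abs.continuousAt.eventually_lt
    continuousAt_const (hlt t)
  filter_upwards [this] with s hs
  exact hval s n hs

end ODE

/-- The primitive of a continuous function bounded below by a positive constant is a
reparametrization of the line. -/
theorem exists_homeomorph_hasDerivAt {κ : ℝ → ℝ} (hκ : Continuous κ) {m : ℝ} (hm : 0 < m)
    (hmκ : ∀ x, m ≤ κ x) :
    ∃ T : ℝ ≃ₜ ℝ, T 0 = 0 ∧ StrictMono T ∧ (∀ x, HasDerivAt T (κ x) x) ∧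
      (∀ s, HasDerivAt T.symm (κ (T.symm s))⁻¹ s) ∧ ∀ x y, T y - T x = ∫ s in x..y, κ s := by
  set f : ℝ → ℝ := fun x => ∫ s in (0 : ℝ)..x, κ s with hf
  have hd : ∀ x, HasDerivAt f (κ x) x := fun x => hκ.integral_hasStrictDerivAt 0 x |>.hasDerivAt
  have hdiff : ∀ x y, f y - f x = ∫ s in x..y, κ s := fun x y =>
    intervalIntegral.integral_interval_sub_left (hκ.intervalIntegrable _ _)
      (hκ.intervalIntegrable _ _)
  have hmono : StrictMono f := strictMono_of_hasDerivAt_pos hd fun x => hm.trans_le (hmκ x)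
  have hge : ∀ x y, x ≤ y → m * (y - x) ≤ f y - f x := by
    intro x y hxy
    rw [hdiff]
    have := intervalIntegral.integral_mono_on (μ := MeasureTheory.volume) hxy
      (continuous_const (y := m) |>.intervalIntegrable _ _) (hκ.intervalIntegrable _ _) (fun s _ => hmκ s)
    simpa [mul_comm] using this
  have hf0 : f 0 = 0 := by simp [hf]
  have htop : Tendsto f atTop atTop := by
    refine tendsto_atTop_mono' atTop ?_ (tendsto_id.const_mul_atTop hm)
    filter_upwards [eventually_ge_atTop 0] with x hx
    have := hge 0 x hx
    simpa [hf0] using this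
  have hbot : Tendsto f atBot atBot := by
    refine tendsto_atBot_mono' atBot ?_ (tendsto_id.const_mul_atBot hm)
    filter_upwards [eventually_le_atBot 0] with x hx
    have := hge x 0 hx
    simp only [hf0, id] at this ⊢
    linarith
  have hc : Continuous f := continuous_iff_continuousAt.2 fun x => (hd x).continuousAt
  set e := (hmono.orderIsoOfSurjective f (hc.surjective htop hbot)) with he
  have hee : ∀ x, e.toHomeomorph x = f x := fun x => rfl
  refine ⟨e.toHomeomorph, hf0, hmono, hd, fun s => ?_, hdiff⟩
  refine HasDerivAt.of_local_left_inverse (f := f) (e.toHomeomorph.symm.continuous.continuousAt)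
    (hd _) (hm.trans_le (hmκ _)).ne' (Eventually.of_forall fun y => ?_)
  rw [← hee]; exact e.toHomeomorph.apply_symm_apply y

/-! ### Squared parabolic coordinates, their momenta, and the first integrals. -/

/-- `ξ ^ 2`. -/
noncomputable def uCoord (q : E3) : ℝ := ‖q‖ + q 2

/-- `η ^ 2`. -/
noncomputable def vCoord (q : E3) : ℝ := ‖q‖ - q 2

/-- `ξ ξ'`. -/
noncomputable def uMom (q v : E3) : ℝ := inner ℝ q v + ‖q‖ * v 2

/-- `η η'`. -/
noncomputable def vMom (q v : E3) : ℝ := inner ℝ q v - ‖q‖ * v 2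

/-- The separation constant as a function on phase space, free of the singularity of the parabolic
coordinates along the axis. -/
noncomputable def lenz (q v : E3) : ℝ :=
  inner ℝ q v * v 2 - ‖v‖ ^ 2 * q 2 + q 2 / ‖q‖ - (q 0 ^ 2 + q 1 ^ 2) / 2

/-- Derivative of the cubic `f`. -/
def xiCubic' (h c u : ℝ) : ℝ := 3 * u ^ 2 + 4 * h * u + 2 * (c + 1)

/-- Derivative of the cubic `g`. -/
def etaCubic' (h c v : ℝ) : ℝ := -3 * v ^ 2 + 4 * h * v - 2 * (c - 1)

theorem E3.norm_sq (q : E3) : ‖q‖ ^ 2 = q 0 ^ 2 + q 1 ^ 2 + q 2 ^ 2 := by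
  simp [EuclideanSpace.norm_sq_eq, Fin.sum_univ_three]

theorem E3.inner_eq (q v : E3) : inner ℝ q v = q 0 * v 0 + q 1 * v 1 + q 2 * v 2 := by
  simp [PiLp.inner_apply, Fin.sum_univ_three, mul_comm]

/-- The separated relation p² = f(u) as an identity on phase space. With `lenz` in the place of c
nothing is divided by ξ, so it also holds on the axis. -/
theorem uMom_sq {q : E3} (v : E3) (hq : q ≠ 0) :
    uMom q v ^ 2 = xiCubic (angMom q v) (energy q v) (lenz q v) (uCoord q) := by
  have hr : ‖q‖ ≠ 0 := norm_ne_zero_iff.2 hq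
  have h1 := E3.norm_sq q
  have h2 := E3.norm_sq v
  simp only [uMom, xiCubic, angMom, energy, lenz, uCoord, E3.inner_eq, h2]
  generalize ‖q‖ = r at *
  generalize q 0 = x at *
  generalize q 1 = y at *
  generalize q 2 = z at *
  generalize v 0 = a at *
  generalize v 1 = b at *
  generalize v 2 = c at *
  have e : x ^ 2 = r ^ 2 - y ^ 2 - z ^ 2 := by linarith
  field_simp
  grind

theorem vMom_sq {q : E3} (v : E3) (hq : q ≠ 0) :
    vMom q v ^ 2 = etaCubic (angMom q v) (energy q v) (lenz q v) (vCoord q) := by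
  have hr : ‖q‖ ≠ 0 := norm_ne_zero_iff.2 hq
  have h1 := E3.norm_sq q
  have h2 := E3.norm_sq v
  simp only [vMom, etaCubic, angMom, energy, lenz, vCoord, E3.inner_eq, h2]
  generalize ‖q‖ = r at *
  generalize q 0 = x at *
  generalize q 1 = y at *
  generalize q 2 = z at *
  generalize v 0 = a at *
  generalize v 1 = b at *
  generalize v 2 = c at *
  field_simp
  linear_combination (r * (r - z - a ^ 2 - b ^ 2)) * h1

theorem uCoord_mul_vCoord (q : E3) : uCoord q * vCoord q = q 0 ^ 2 + q 1 ^ 2 := by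
  have := E3.norm_sq q
  simp only [uCoord, vCoord]; linarith

theorem uCoord_nonneg (q : E3) : 0 ≤ uCoord q := by
  have h := E3.norm_sq q
  have h2 : |q 2| ≤ ‖q‖ := abs_le_of_sq_le_sq (by nlinarith [sq_nonneg (q 0), sq_nonneg (q 1)]) (norm_nonneg q)
  have := (abs_le.1 h2).1
  simp only [uCoord]; linarith

theorem vCoord_nonneg (q : E3) : 0 ≤ vCoord q := by
  have h := E3.norm_sq q
  have h2 : |q 2| ≤ ‖q‖ := abs_le_of_sq_le_sq (by nlinarith [sq_nonneg (q 0), sq_nonneg (q 1)]) (norm_nonneg q)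
  have := (abs_le.1 h2).2
  simp only [vCoord]; linarith

theorem uCoord_mul_vCoord_pos {q v : E3} (hL : angMom q v ≠ 0) : 0 < uCoord q * vCoord q := by
  rw [uCoord_mul_vCoord]
  by_contra hcon
  have h0 : q 0 = 0 := by nlinarith [sq_nonneg (q 0), sq_nonneg (q 1)]
  have h1 : q 1 = 0 := by nlinarith [sq_nonneg (q 0), sq_nonneg (q 1)]
  exact hL (by simp [angMom, h0, h1])

theorem uCoord_pos {q v : E3} (hL : angMom q v ≠ 0) : 0 < uCoord q :=
  pos_of_mul_pos_left (uCoord_mul_vCoord_pos hL) (vCoord_nonneg q)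

theorem vCoord_pos {q v : E3} (hL : angMom q v ≠ 0) : 0 < vCoord q :=
  pos_of_mul_pos_right (uCoord_mul_vCoord_pos hL) (uCoord_nonneg q)

theorem ne_zero_of_angMom {q v : E3} (hL : angMom q v ≠ 0) : q ≠ 0 := by
  rintro rfl; simp [angMom] at hL

theorem xi_sq (q : E3) : xi q ^ 2 = uCoord q := Real.sq_sqrt (uCoord_nonneg q)

theorem eta_sq (q : E3) : eta q ^ 2 = vCoord q := Real.sq_sqrt (vCoord_nonneg q)

theorem xi_pos {q v : E3} (hL : angMom q v ≠ 0) : 0 < xi q := Real.sqrt_pos.2 (uCoord_pos hL)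

theorem eta_pos {q v : E3} (hL : angMom q v ≠ 0) : 0 < eta q := Real.sqrt_pos.2 (vCoord_pos hL)

theorem xiPrime_sq {q v : E3} : xiPrime q v ^ 2 = uMom q v ^ 2 / uCoord q := by
  rw [xiPrime, div_pow, xi_sq, uMom]

theorem etaPrime_sq {q v : E3} : etaPrime q v ^ 2 = vMom q v ^ 2 / vCoord q := by
  rw [etaPrime, div_pow, eta_sq, vMom]

/-- When ξ'² and η'² are taken from the two cubics, the terms with c cancel in the sum and the
energy is what remains. -/
theorem redEnergy_parabolicState {q v : E3} (hL : angMom q v ≠ 0) :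
    redEnergy (angMom q v) (parabolicState q v) = energy q v := by
  have hu := uCoord_pos hL
  have hv := vCoord_pos hL
  simp only [redEnergy, parabolicState, xi_sq, eta_sq, xiPrime_sq, etaPrime_sq,
    uMom_sq v (ne_zero_of_angMom hL), vMom_sq v (ne_zero_of_angMom hL), xiCubic, etaCubic]
  generalize uCoord q = u at *
  generalize vCoord q = w at *
  field_simp
  ring

theorem sepConst_eq_lenz {q v : E3} (hL : angMom q v ≠ 0) : sepConst q v = lenz q v := by
  have hu := uCoord_pos hL
  have h1 := redEnergy_parabolicState hL
  have h4 : xi q ^ 4 = uCoord q ^ 2 := by rw [← xi_sq]; ring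
  simp only [sepConst, redSep, parabolicState] at h1 ⊢
  rw [h1, h4, xi_sq, xiPrime_sq, uMom_sq v (ne_zero_of_angMom hL), xiCubic]
  field_simp
  ring

/-! ### Derivatives along solutions -/

section Derivatives

variable {I : Set ℝ} {q v : ℝ → E3}

theorem starkForce_apply (q : E3) (i : Fin 3) :
    starkForce q i = -(q i / ‖q‖ ^ 3) + if i = 2 then 1 else 0 := by
  simp [starkForce]
  ring

namespace IsStarkSolution

theorem hasDerivAt_q (hs : IsStarkSolution I q v) {t : ℝ} (ht : t ∈ I) (i : Fin 3) :
    HasDerivAt (fun s => q s i) (v t i) t :=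
  (EuclideanSpace.proj (𝕜 := ℝ) i).hasFDerivAt.comp_hasDerivAt t (hs.hasDerivAt_pos t ht)

theorem hasDerivAt_v (hs : IsStarkSolution I q v) {t : ℝ} (ht : t ∈ I) (i : Fin 3) :
    HasDerivAt (fun s => v s i) (-(q t i / ‖q t‖ ^ 3) + if i = 2 then 1 else 0) t := by
  rw [← starkForce_apply]
  exact (EuclideanSpace.proj (𝕜 := ℝ) i).hasFDerivAt.comp_hasDerivAt t (hs.hasDerivAt_vel t ht)

theorem norm_pos (hs : IsStarkSolution I q v) {t : ℝ} (ht : t ∈ I) : 0 < ‖q t‖ :=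
  norm_pos_iff.2 (hs.ne_zero t ht)

theorem hasDerivAt_norm (hs : IsStarkSolution I q v) {t : ℝ} (ht : t ∈ I) :
    HasDerivAt (fun s => ‖q s‖) (inner ℝ (q t) (v t) / ‖q t‖) t := by
  have h1 := ((hs.hasDerivAt_pos t ht).norm_sq).sqrt (by
    have := hs.norm_pos ht; positivity)
  simp only [Real.sqrt_sq (norm_nonneg _)] at h1
  convert h1 using 1
  have := hs.norm_pos ht
  field_simp

theorem hasDerivAt_inner (hs : IsStarkSolution I q v) {t : ℝ} (ht : t ∈ I) :
    HasDerivAt (fun s => inner ℝ (q s) (v s)) (‖v t‖ ^ 2 - 1 / ‖q t‖ + q t 2) t := by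
  have h := (((hs.hasDerivAt_q ht 0).mul (hs.hasDerivAt_v ht 0)).add
    ((hs.hasDerivAt_q ht 1).mul (hs.hasDerivAt_v ht 1))).add
    ((hs.hasDerivAt_q ht 2).mul (hs.hasDerivAt_v ht 2))
  have e : (fun s => inner ℝ (q s) (v s)) = fun s => q s 0 * v s 0 + q s 1 * v s 1 + q s 2 * v s 2 :=
    funext fun s => E3.inner_eq _ _
  rw [e]
  refine h.congr_deriv ?_
  have hr := hs.norm_pos ht
  have h1 := E3.norm_sq (q t)
  rw [E3.norm_sq (v t)]
  simp
  field_simp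
  linear_combination h1

theorem hasDerivAt_normSq_vel (hs : IsStarkSolution I q v) {t : ℝ} (ht : t ∈ I) :
    HasDerivAt (fun s => ‖v s‖ ^ 2)
      (2 * (-(inner ℝ (q t) (v t) / ‖q t‖ ^ 3) + v t 2)) t := by
  have h := (((hs.hasDerivAt_v ht 0).pow 2).add ((hs.hasDerivAt_v ht 1).pow 2)).add
    ((hs.hasDerivAt_v ht 2).pow 2)
  have e : (fun s => ‖v s‖ ^ 2) = fun s => v s 0 ^ 2 + v s 1 ^ 2 + v s 2 ^ 2 :=
    funext fun s => E3.norm_sq _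
  rw [e]
  refine h.congr_deriv ?_
  have hr := hs.norm_pos ht
  rw [E3.inner_eq]
  simp
  field_simp
  ring

theorem hasDerivAt_angMom (hs : IsStarkSolution I q v) {t : ℝ} (ht : t ∈ I) :
    HasDerivAt (fun s => angMom (q s) (v s)) 0 t := by
  have h := ((hs.hasDerivAt_q ht 0).mul (hs.hasDerivAt_v ht 1)).sub
    ((hs.hasDerivAt_q ht 1).mul (hs.hasDerivAt_v ht 0))
  refine h.congr_deriv ?_
  simp
  ring

theorem hasDerivAt_energy (hs : IsStarkSolution I q v) {t : ℝ} (ht : t ∈ I) :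
    HasDerivAt (fun s => energy (q s) (v s)) 0 t := by
  have hr := hs.norm_pos ht
  have h := (((hs.hasDerivAt_normSq_vel ht).div_const 2).sub
    ((hs.hasDerivAt_norm ht).inv hr.ne')).sub (hs.hasDerivAt_q ht 2)
  simp only [energy, one_div]
  refine h.congr_deriv ?_
  field_simp
  ring

theorem hasDerivAt_lenz (hs : IsStarkSolution I q v) {t : ℝ} (ht : t ∈ I) :
    HasDerivAt (fun s => lenz (q s) (v s)) 0 t := by
  have hr := hs.norm_pos ht
  have h := ((((hs.hasDerivAt_inner ht).mul (hs.hasDerivAt_v ht 2)).sub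
    ((hs.hasDerivAt_normSq_vel ht).mul (hs.hasDerivAt_q ht 2))).add
    ((hs.hasDerivAt_q ht 2).div (hs.hasDerivAt_norm ht) hr.ne')).sub
    ((((hs.hasDerivAt_q ht 0).pow 2).add ((hs.hasDerivAt_q ht 1).pow 2)).div_const 2)
  simp only [lenz]
  refine h.congr_deriv ?_
  rw [E3.inner_eq]
  simp
  field_simp
  ring

theorem hasDerivAt_uCoord (hs : IsStarkSolution I q v) {t : ℝ} (ht : t ∈ I) :
    HasDerivAt (fun s => uCoord (q s)) (1 / (2 * ‖q t‖) * (2 * uMom (q t) (v t))) t := by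
  have hr := hs.norm_pos ht
  refine ((hs.hasDerivAt_norm ht).add (hs.hasDerivAt_q ht 2)).congr_deriv ?_
  rw [uMom]; field_simp

theorem hasDerivAt_vCoord (hs : IsStarkSolution I q v) {t : ℝ} (ht : t ∈ I) :
    HasDerivAt (fun s => vCoord (q s)) (1 / (2 * ‖q t‖) * (2 * vMom (q t) (v t))) t := by
  have hr := hs.norm_pos ht
  refine ((hs.hasDerivAt_norm ht).sub (hs.hasDerivAt_q ht 2)).congr_deriv ?_
  rw [vMom]; field_simp

/-- The equation p' = f'(u) is computed directly: differentiating p² = f(u) would lose it at the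
turning points p = 0. -/
theorem hasDerivAt_uMom (hs : IsStarkSolution I q v) {t : ℝ} (ht : t ∈ I) :
    HasDerivAt (fun s => uMom (q s) (v s)) (1 / (2 * ‖q t‖) *
      xiCubic' (energy (q t) (v t)) (lenz (q t) (v t)) (uCoord (q t))) t := by
  have hr := hs.norm_pos ht
  refine ((hs.hasDerivAt_inner ht).add
    ((hs.hasDerivAt_norm ht).mul (hs.hasDerivAt_v ht 2))).congr_deriv ?_
  have h1 := E3.norm_sq (q t)
  simp only [xiCubic', energy, lenz, uCoord]
  have h2 : q t 0 ^ 2 + q t 1 ^ 2 = ‖q t‖ ^ 2 - q t 2 ^ 2 := by linarith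
  rw [h2]
  simp
  field_simp
  ring

theorem hasDerivAt_vMom (hs : IsStarkSolution I q v) {t : ℝ} (ht : t ∈ I) :
    HasDerivAt (fun s => vMom (q s) (v s)) (1 / (2 * ‖q t‖) *
      etaCubic' (energy (q t) (v t)) (lenz (q t) (v t)) (vCoord (q t))) t := by
  have hr := hs.norm_pos ht
  refine ((hs.hasDerivAt_inner ht).sub
    ((hs.hasDerivAt_norm ht).mul (hs.hasDerivAt_v ht 2))).congr_deriv ?_
  have h1 := E3.norm_sq (q t)
  simp only [etaCubic', energy, lenz, vCoord]
  have h2 : q t 0 ^ 2 + q t 1 ^ 2 = ‖q t‖ ^ 2 - q t 2 ^ 2 := by linarith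
  rw [h2]
  simp
  field_simp
  ring

theorem eq_of_hasDerivAt_zero (hs : IsStarkSolution I q v) {G : ℝ → ℝ}
    (hG : ∀ t ∈ I, HasDerivAt G 0 t) {s t : ℝ} (hs' : s ∈ I) (ht : t ∈ I) : G s = G t :=
  hs.isOpen.is_const_of_deriv_eq_zero hs.ordConnected.isPreconnected
    (fun x hx => (hG x hx).differentiableAt.differentiableWithinAt)
    (fun x hx => (hG x hx).deriv) hs' ht

theorem angMom_eq (hs : IsStarkSolution I q v) {s t : ℝ} (hs' : s ∈ I) (ht : t ∈ I) :
    angMom (q s) (v s) = angMom (q t) (v t) :=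
  hs.eq_of_hasDerivAt_zero (fun _ h => hs.hasDerivAt_angMom h) hs' ht

theorem energy_eq (hs : IsStarkSolution I q v) {s t : ℝ} (hs' : s ∈ I) (ht : t ∈ I) :
    energy (q s) (v s) = energy (q t) (v t) :=
  hs.eq_of_hasDerivAt_zero (fun _ h => hs.hasDerivAt_energy h) hs' ht

theorem lenz_eq (hs : IsStarkSolution I q v) {s t : ℝ} (hs' : s ∈ I) (ht : t ∈ I) :
    lenz (q s) (v s) = lenz (q t) (v t) :=
  hs.eq_of_hasDerivAt_zero (fun _ h => hs.hasDerivAt_lenz h) hs' ht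

theorem hasConstants (hs : IsStarkSolution I q v) {t : ℝ} (ht : t ∈ I)
    (hL : angMom (q t) (v t) ≠ 0) :
    HasConstants I q v (angMom (q t) (v t)) (energy (q t) (v t)) (lenz (q t) (v t)) := by
  intro s hs'
  have h1 := hs.angMom_eq hs' ht
  exact ⟨h1, hs.energy_eq hs' ht, by rw [sepConst_eq_lenz (h1 ▸ hL), hs.lenz_eq hs' ht]⟩

end IsStarkSolution

end Derivatives

/-! ### Phase space: uniqueness, and existence for all times when L ≠ 0. -/

/-- The Stark vector field on phase space. -/
noncomputable def starkField (p : E3 × E3) : E3 × E3 := (p.2, starkForce p.1)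

theorem contDiffAt_starkField {p : E3 × E3} (hp : p.1 ≠ 0) : ContDiffAt ℝ 1 starkField p := by
  have h1 : ContDiffAt ℝ 1 (fun p : E3 × E3 => ‖p.1‖) p := contDiffAt_fst.norm ℝ hp
  have h2 : ContDiffAt ℝ 1 (fun p : E3 × E3 => (1 / ‖p.1‖ ^ 3)) p :=
    contDiffAt_const.div (h1.pow 3) (by have := norm_ne_zero_iff.2 hp; positivity)
  exact contDiffAt_snd.prodMk ((h2.neg.smul contDiffAt_fst).add contDiffAt_const)

theorem IsStarkSolution.hasDerivAt_prod {I : Set ℝ} {q v : ℝ → E3} (hs : IsStarkSolution I q v)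
    {t : ℝ} (ht : t ∈ I) :
    HasDerivAt (fun s => (q s, v s)) (starkField (q t, v t)) t :=
  (hs.hasDerivAt_pos t ht).prodMk (hs.hasDerivAt_vel t ht)

theorem IsStarkSolution.continuousOn_prod {I : Set ℝ} {q v : ℝ → E3} (hs : IsStarkSolution I q v) :
    ContinuousOn (fun s => (q s, v s)) I :=
  fun _ ht => (hs.hasDerivAt_prod ht).continuousAt.continuousWithinAt

/-- Two solutions with the same state at one time agree. -/
theorem IsStarkSolution.eqOn {I : Set ℝ} {q v q' v' : ℝ → E3} (hs : IsStarkSolution I q v)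
    (hs' : IsStarkSolution I q' v') {t₀ : ℝ} (ht₀ : t₀ ∈ I) (hq : q t₀ = q' t₀)
    (hv : v t₀ = v' t₀) {t : ℝ} (ht : t ∈ I) : q t = q' t ∧ v t = v' t := by
  have := eqOn_of_hasDerivAt_smul (F := starkField) (κ := fun _ => 1) (X := fun s => (q s, v s))
    (Y := fun s => (q' s, v' s)) hs.isOpen hs.ordConnected.isPreconnected continuousOn_const
    (fun s hs' => contDiffAt_starkField (hs.ne_zero s hs'))
    (fun s hx => by simpa using hs.hasDerivAt_prod hx)
    (fun s hx => by simpa using hs'.hasDerivAt_prod hx) ht₀ (by simp [hq, hv]) ht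
  exact Prod.ext_iff.1 this

theorem IsStarkSolution.mono {I J : Set ℝ} {q v : ℝ → E3} (hs : IsStarkSolution I q v)
    (hJ : IsOpen J) (hJ' : J.OrdConnected) (hJn : J.Nonempty) (h : J ⊆ I) :
    IsStarkSolution J q v :=
  ⟨hJ, hJ', hJn, fun t ht => hs.ne_zero t (h ht), fun t ht => hs.hasDerivAt_pos t (h ht),
    fun t ht => hs.hasDerivAt_vel t (h ht)⟩

theorem IsStarkSolution.comp_add {q v : ℝ → E3} (hs : IsStarkSolution univ q v) (s : ℝ) :
    IsStarkSolution univ (fun t => q (t + s)) (fun t => v (t + s)) :=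
  ⟨isOpen_univ, ordConnected_univ, univ_nonempty, fun _ _ => hs.ne_zero _ trivial,
    fun t _ => (hs.hasDerivAt_pos (t + s) trivial).comp_add_const t s,
    fun t _ => (hs.hasDerivAt_vel (t + s) trivial).comp_add_const t s⟩

/-- Of the constant 4 / δ³ one part comes from the difference of the points. The other three come
from the difference of the factors 1 / |q|³, which telescopes into three terms of size at most 1 /
δ³. -/
theorem lipschitzOnWith_smul_inv_norm_cube {δ : ℝ} (hδ : 0 < δ) :
    LipschitzOnWith (4 / δ ^ 3).toNNReal starkForce {q : E3 | δ ≤ ‖q‖} := by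
  refine LipschitzOnWith.of_dist_le_mul fun a ha b hb => ?_
  rw [Real.coe_toNNReal _ (by positivity), dist_eq_norm, dist_eq_norm]
  simp only [mem_ofPred_eq] at ha hb
  have hα : 0 < ‖a‖ := hδ.trans_le ha
  have hβ : 0 < ‖b‖ := hδ.trans_le hb
  have e : starkForce a - starkForce b =
      (-(1 / ‖a‖ ^ 3)) • (a - b) + (-(1 / ‖a‖ ^ 3) + 1 / ‖b‖ ^ 3) • b := by
    simp only [starkForce]; module
  rw [e]
  have hab : |‖b‖ - ‖a‖| ≤ ‖a - b‖ := by
    rw [abs_sub_comm]; exact abs_norm_sub_norm_le a b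
  have h1 : ‖(-(1 / ‖a‖ ^ 3)) • (a - b)‖ ≤ 1 / δ ^ 3 * ‖a - b‖ := by
    rw [norm_smul, norm_neg, Real.norm_of_nonneg (by positivity)]
    gcongr
  have h2 : ‖(-(1 / ‖a‖ ^ 3) + 1 / ‖b‖ ^ 3) • b‖ ≤ 3 / δ ^ 3 * ‖a - b‖ := by
    have e2 : (-(1 / ‖a‖ ^ 3) + 1 / ‖b‖ ^ 3) * ‖b‖ =
        (‖a‖ - ‖b‖) * (1 / (‖a‖ * ‖b‖ ^ 2) + 1 / (‖a‖ ^ 2 * ‖b‖) + 1 / ‖a‖ ^ 3) := by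
      field_simp; ring
    rw [norm_smul, Real.norm_eq_abs]
    nth_rewrite 2 [← abs_of_pos hβ]
    rw [← abs_mul, e2, abs_mul, abs_of_pos (a := _ + _ + _) (by positivity), abs_sub_comm]
    have h3 : 1 / (‖a‖ * ‖b‖ ^ 2) ≤ 1 / δ ^ 3 := by
      rw [show δ ^ 3 = δ * δ ^ 2 by ring]; gcongr
    have h4 : 1 / (‖a‖ ^ 2 * ‖b‖) ≤ 1 / δ ^ 3 := by
      rw [show δ ^ 3 = δ ^ 2 * δ by ring]; gcongr
    have h5 : 1 / ‖a‖ ^ 3 ≤ 1 / δ ^ 3 := by gcongr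
    have h6 : 3 / δ ^ 3 = 1 / δ ^ 3 + 1 / δ ^ 3 + 1 / δ ^ 3 := by ring
    rw [h6, mul_comm]
    gcongr
  calc _ ≤ 1 / δ ^ 3 * ‖a - b‖ + 3 / δ ^ 3 * ‖a - b‖ := (norm_add_le _ _).trans (add_le_add h1 h2)
    _ = _ := by ring

/-- Orbits with nonzero angular momentum stay away from the origin. -/
theorem angMom_sq_le {q v : E3} (hq : q ≠ 0) :
    angMom q v ^ 2 ≤ 2 * energy q v * ‖q‖ ^ 2 + 2 * ‖q‖ + 2 * ‖q‖ ^ 3 := by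
  have hr : 0 < ‖q‖ := norm_pos_iff.2 hq
  have h1 := E3.norm_sq q
  have h2 := E3.norm_sq v
  have hz : q 2 ≤ ‖q‖ := by have := vCoord_nonneg q; simp only [vCoord] at this; linarith
  have h3 : angMom q v ^ 2 ≤ ‖q‖ ^ 2 * ‖v‖ ^ 2 := by
    rw [h1, h2, angMom]
    nlinarith [sq_nonneg (q 0 * v 0 + q 1 * v 1), sq_nonneg (q 0 * v 2), sq_nonneg (q 1 * v 2),
      sq_nonneg (q 2 * v 0), sq_nonneg (q 2 * v 1), sq_nonneg (q 2 * v 2)]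
  have h4 : ‖q‖ ^ 2 * ‖v‖ ^ 2 = 2 * energy q v * ‖q‖ ^ 2 + 2 * ‖q‖ + 2 * q 2 * ‖q‖ ^ 2 := by
    rw [energy]; field_simp; ring
  have h5 : q 2 * ‖q‖ ^ 2 ≤ ‖q‖ * ‖q‖ ^ 2 := by gcongr
  nlinarith

/-- For |q| < 1 the bound of `angMom_sq_le` is at most (2|h| + 4)|q|, which gives the second entry
of the minimum. -/
theorem exists_le_norm {L : ℝ} (hL : L ≠ 0) (h : ℝ) :
    ∃ δ > 0, ∀ q v : E3, q ≠ 0 → angMom q v = L → energy q v = h → δ ≤ ‖q‖ := by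
  have hL2 : 0 < L ^ 2 := by positivity
  refine ⟨min 1 (L ^ 2 / (2 * |h| + 4)), by positivity, fun q v hq hLq hh => ?_⟩
  by_contra! hlt
  have hr : 0 < ‖q‖ := norm_pos_iff.2 hq
  have h1 := angMom_sq_le (v := v) hq
  rw [hLq, hh] at h1
  have h2 : ‖q‖ < 1 := hlt.trans_le (min_le_left _ _)
  have h3 : ‖q‖ < L ^ 2 / (2 * |h| + 4) := hlt.trans_le (min_le_right _ _)
  rw [lt_div_iff₀ (by positivity)] at h3
  have h4 : h * ‖q‖ ^ 2 ≤ |h| * ‖q‖ := by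
    have : ‖q‖ ^ 2 ≤ ‖q‖ := by nlinarith
    calc h * ‖q‖ ^ 2 ≤ |h| * ‖q‖ ^ 2 := by gcongr; exact le_abs_self h
      _ ≤ _ := by gcongr
  have h5 : ‖q‖ ^ 3 ≤ ‖q‖ := by nlinarith [mul_pos hr hr]
  nlinarith

/-- Global existence. -/
theorem exists_isStarkSolution_univ {q₀ v₀ : E3} (hL : angMom q₀ v₀ ≠ 0) :
    ∃ q v : ℝ → E3, IsStarkSolution univ q v ∧ q 0 = q₀ ∧ v 0 = v₀ := by
  have hq₀ := ne_zero_of_angMom hL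
  obtain ⟨δ', hδ', hδ⟩ := exists_le_norm hL (energy q₀ v₀)
  set δ := δ' / 2 with hδdef
  have hδ0 : 0 < δ := by positivity
  -- Outside the ball of radius δ = δ' / 2 the force is Lipschitz and extends to a globally
  -- Lipschitz map G. The extended equation has a solution for all times; it remains to see that
  -- this solution never enters the ball.
  obtain ⟨G, hG, hGe⟩ := (lipschitzOnWith_smul_inv_norm_cube hδ0).extend_finite_dimension
  set K := lipschitzExtensionConstant E3 * (4 / δ ^ 3).toNNReal
  have hF : LipschitzWith (max 1 K) (fun p : E3 × E3 => (p.2, G p.1)) := by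
    have h1 : LipschitzWith 1 (fun p : E3 × E3 => p.2) := LipschitzWith.prod_snd
    have h2 : LipschitzWith (K * 1) (fun p : E3 × E3 => G p.1) := hG.comp LipschitzWith.prod_fst
    rw [mul_one] at h2
    exact h1.prodMk h2
  obtain ⟨X, hX0, hX⟩ := hF.exists_forall_hasDerivAt (q₀, v₀)
  have hXc : Continuous X := continuous_iff_continuousAt.2 fun t => (hX t).continuousAt
  have hdq : ∀ t, HasDerivAt (fun s => (X s).1) (X t).2 t := fun t =>
    (ContinuousLinearMap.fst ℝ E3 E3).hasFDerivAt.comp_hasDerivAt t (hX t)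
  have hdv : ∀ t, HasDerivAt (fun s => (X s).2) (G (X t).1) t := fun t =>
    (ContinuousLinearMap.snd ℝ E3 E3).hasFDerivAt.comp_hasDerivAt t (hX t)
  have hsol : ∀ J : Set ℝ, IsOpen J → J.OrdConnected → J.Nonempty → (∀ t ∈ J, δ < ‖(X t).1‖) →
      IsStarkSolution J (fun s => (X s).1) (fun s => (X s).2) := by
    intro J hJ hJ' hJn hJδ
    refine ⟨hJ, hJ', hJn, fun t ht => norm_pos_iff.1 (hδ0.trans (hJδ t ht)), fun t _ => hdq t,
      fun t ht => ?_⟩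
    rw [hGe (hJδ t ht).le]
    exact hdv t
  -- S is closed by continuity. It is open because δ < δ': near a time of S the curve solves the
  -- true equation, so L and h are conserved, and these in turn give |q| ≥ δ'.
  set S : Set ℝ := {t | (δ' ≤ ‖(X t).1‖ ∧ angMom (X t).1 (X t).2 = angMom q₀ v₀) ∧
    energy (X t).1 (X t).2 = energy q₀ v₀} with hS
  have hSo : IsOpen S := by
    refine isOpen_iff_mem_nhds.2 fun t ht => ?_
    have hnb : {s | δ < ‖(X s).1‖} ∈ 𝓝 t :=
      (hXc.fst.norm.isOpen_preimage _ isOpen_Ioi).mem_nhds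
        (show δ < ‖(X t).1‖ by linarith [ht.1.1])
    obtain ⟨ε, hε, hball⟩ := Metric.mem_nhds_iff.1 hnb
    have hs := hsol (Metric.ball t ε) Metric.isOpen_ball
      (by rw [Real.ball_eq_Ioo]; exact ordConnected_Ioo) ⟨t, Metric.mem_ball_self hε⟩
      (fun s hs => hball hs)
    filter_upwards [Metric.ball_mem_nhds t hε] with s hsb
    have h1 := (hs.angMom_eq hsb (Metric.mem_ball_self hε)).trans ht.1.2
    have h2 := (hs.energy_eq hsb (Metric.mem_ball_self hε)).trans ht.2
    exact ⟨⟨hδ _ _ (hs.ne_zero s hsb) h1 h2, h1⟩, h2⟩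
  have hSc : IsClosed S := by
    refine isClosed_of_closure_subset fun t ht => ?_
    have hcl : IsClosed {s | δ' ≤ ‖(X s).1‖ ∧ angMom (X s).1 (X s).2 = angMom q₀ v₀} := by
      refine (isClosed_le continuous_const hXc.fst.norm).inter (isClosed_eq ?_ continuous_const)
      simp only [angMom]; fun_prop
    have h1 := closure_minimal (fun s hs => hs.1) hcl ht
    refine ⟨h1, ?_⟩
    have hne : ‖(X t).1‖ ≠ 0 := by linarith [h1.1]
    have hc : ContinuousAt (fun s => energy (X s).1 (X s).2) t := by
      simp only [energy]
      have h3 : ContinuousAt (fun s => ‖(X s).1‖) t := hXc.fst.norm.continuousAt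
      have h4 : ContinuousAt (fun s => (X s).1 2) t := by fun_prop
      have h5 : ContinuousAt (fun s => ‖(X s).2‖) t := hXc.snd.norm.continuousAt
      exact ((h5.pow 2).div_const 2).sub (continuousAt_const.div h3 hne) |>.sub h4
    by_contra hcon
    have := (hc.eventually_ne hcon)
    obtain ⟨s, hs1, hs2⟩ := ((mem_closure_iff_frequently.1 ht).and_eventually this).exists
    exact hs2 hs1.2
  have huniv : S = univ := by
    refine IsClopen.eq_univ ⟨hSc, hSo⟩ ⟨0, ?_⟩
    rw [hS, mem_ofPred_eq, hX0]
    exact ⟨⟨hδ _ _ hq₀ rfl rfl, rfl⟩, rfl⟩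
  refine ⟨_, _, hsol univ isOpen_univ ordConnected_univ univ_nonempty fun t _ => ?_,
    by simp [hX0], by simp [hX0]⟩
  have : t ∈ S := huniv ▸ mem_univ t
  linarith [this.1.1]

theorem IsStarkSolution.isStarkOrbit {q v : ℝ → E3} (hs : IsStarkSolution univ q v) :
    IsStarkOrbit univ q v :=
  ⟨hs, fun _ _ _ _ h _ => univ_subset_iff.1 h⟩

/-- Orbits with nonzero angular momentum are defined for all times. -/
theorem IsStarkOrbit.eq_univ {I : Set ℝ} {q v : ℝ → E3} (ho : IsStarkOrbit I q v) {t₀ : ℝ}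
    (ht₀ : t₀ ∈ I) (hL : angMom (q t₀) (v t₀) ≠ 0) : I = univ := by
  obtain ⟨q', v', hs', hq', hv'⟩ := exists_isStarkSolution_univ hL
  have hs := hs'.comp_add (-t₀)
  refine (ho.maximal univ _ _ hs (subset_univ _) fun t ht => ?_).symm
  exact (ho.toIsStarkSolution.eqOn (hs.mono ho.isOpen ho.ordConnected ho.nonempty (subset_univ _))
    ht₀ (by simp [hq']) (by simp [hv']) ht).1.symm

/-! ### Motion in one variable: escape, periodic motion, homoclinic motion. -/

theorem mul_sub_le_of_hasDerivAt {g g' : ℝ → ℝ} (hg : ∀ t, HasDerivAt g (g' t) t) {C a b : ℝ}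
    (hab : a ≤ b) (h : ∀ t ∈ Icc a b, C ≤ g' t) : C * (b - a) ≤ g b - g a :=
  (convex_Icc a b).mul_sub_le_image_sub_of_le_deriv
    (fun t _ => (hg t).continuousAt.continuousWithinAt)
    (fun t _ => (hg t).differentiableAt.differentiableWithinAt)
    (fun t ht => (hg t).deriv ▸ h t (interior_subset ht)) a ⟨le_rfl, hab⟩ b ⟨hab, le_rfl⟩ hab

/-- `u'' = 2 F(u)` and `p = u' / 2`, in a time `τ` with `dτ = κ dt`. -/
structure IsMotion (κ F u p : ℝ → ℝ) : Prop where
  hasDerivAt_pos : ∀ t, HasDerivAt u (κ t * (2 * p t)) t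
  hasDerivAt_mom : ∀ t, HasDerivAt p (κ t * F (u t)) t

namespace IsMotion

variable {κ F u p : ℝ → ℝ}

/-- Time reversal changes the sign of p, so escape need only be shown for motions that start
outwards. -/
theorem reverse (h : IsMotion κ F u p) :
    IsMotion (fun t => κ (-t)) F (fun t => u (-t)) (fun t => -p (-t)) := by
  refine ⟨fun t => ?_, fun t => ?_⟩
  · refine ((h.hasDerivAt_pos (-t)).comp t (hasDerivAt_neg t)).congr_deriv ?_
    ring
  · refine ((h.hasDerivAt_mom (-t)).comp t (hasDerivAt_neg t)).neg.congr_deriv ?_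
    ring

theorem continuous_pos (h : IsMotion κ F u p) : Continuous u :=
  continuous_iff_continuousAt.2 fun t => (h.hasDerivAt_pos t).continuousAt

theorem eq_of_eq (h : IsMotion κ F u p) {u' p' : ℝ → ℝ} (h' : IsMotion κ F u' p')
    (hκ : Continuous κ) (hF : ContDiff ℝ 1 F) {t₀ : ℝ} (hu : u t₀ = u' t₀) (hp : p t₀ = p' t₀) :
    u = u' ∧ p = p' := by
  have key := eqOn_of_hasDerivAt_smul (F := fun x : ℝ × ℝ => (2 * x.2, F x.1)) (κ := κ)
    (X := fun s => (u s, p s)) (Y := fun s => (u' s, p' s)) isOpen_univ isPreconnected_univ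
    hκ.continuousOn (fun t _ => by fun_prop)
    (fun t _ => by
      simpa using (h.hasDerivAt_pos t).prodMk (h.hasDerivAt_mom t))
    (fun t _ => by
      simpa using (h'.hasDerivAt_pos t).prodMk (h'.hasDerivAt_mom t)) (mem_univ t₀) (by simp [hu, hp])
  exact ⟨funext fun t => (Prod.ext_iff.1 (key (mem_univ t))).1,
    funext fun t => (Prod.ext_iff.1 (key (mem_univ t))).2⟩

theorem eq_const (h : IsMotion κ F u p) (hκ : Continuous κ) (hF : ContDiff ℝ 1 F) {t₀ u₀ : ℝ}
    (hu : u t₀ = u₀) (hp : p t₀ = 0) (h0 : F u₀ = 0) (t : ℝ) : u t = u₀ := by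
  have h' : IsMotion κ F (fun _ => u₀) (fun _ => 0) :=
    ⟨fun t => by simpa using hasDerivAt_const t u₀, fun t => by simpa [h0] using hasDerivAt_const t (0 : ℝ)⟩
  exact congrFun (h.eq_of_eq h' hκ hF hu hp).1 t

/-- A motion that is pushed outwards beyond `y₀` and is beyond `y₀` once escapes. -/
theorem not_bddAbove_of_force (h : IsMotion κ F u p) {κ₀ d y₀ t₀ : ℝ} (hκ₀ : 0 < κ₀)
    (hκ : ∀ t, κ₀ ≤ κ t) (hd : 0 < d) (hF : ∀ t, y₀ < u t → d ≤ F (u t)) (ht₀ : y₀ < u t₀) :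
    ¬ BddAbove (range u) := by
  wlog hp : 0 ≤ p t₀ generalizing κ u p t₀
  · have := this h.reverse (t₀ := -t₀) (fun t => hκ _) (fun t ht => hF _ ht) (by simpa using ht₀)
      (by simp; linarith)
    refine fun hb => this (hb.mono ?_)
    rintro _ ⟨t, rfl⟩
    exact ⟨-t, rfl⟩
  have hκp : ∀ t, 0 < κ t := fun t => hκ₀.trans_le (hκ t)
  have hpos : ∀ s, t₀ ≤ s → (∀ t ∈ Ico t₀ s, y₀ < u t) →
      (∀ t ∈ Icc t₀ s, κ₀ * d * (t - t₀) ≤ p t) := by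
    intro s hs hu t ht
    have hg : ∀ x ∈ Ico t₀ t, κ₀ * d ≤ κ x * F (u x) := fun x hx =>
      mul_le_mul (hκ x) (hF x (hu x ⟨hx.1, hx.2.trans_le ht.2⟩)) hd.le (hκp x).le
    have := (convex_Icc t₀ t).mul_sub_le_image_sub_of_le_deriv
      (fun x _ => (h.hasDerivAt_mom x).continuousAt.continuousWithinAt)
      (fun x _ => (h.hasDerivAt_mom x).differentiableAt.differentiableWithinAt)
      (fun x hx => (h.hasDerivAt_mom x).deriv ▸ hg x (by
        rw [interior_Icc] at hx; exact Ioo_subset_Ico_self hx))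
      t₀ ⟨le_rfl, ht.1⟩ t ⟨ht.1, le_rfl⟩ ht.1
    linarith
  have hmono : ∀ s, t₀ ≤ s → (∀ t ∈ Ico t₀ s, y₀ < u t) → u t₀ ≤ u s := by
    intro s hs hu
    have := mul_sub_le_of_hasDerivAt h.hasDerivAt_pos (C := 0) hs (fun t ht => by
      have h1 := hpos s hs hu t ht
      have h2 : 0 ≤ κ₀ * d * (t - t₀) := mul_nonneg (by positivity) (by linarith [ht.1])
      have := (hκp t).le
      have h3 : 0 ≤ p t := h2.trans h1
      positivity)
    linarith
  -- At a first time with u ≤ y₀, monotonicity up to that time would still give u ≥ u t₀ > y₀.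
  have hall : ∀ t, t₀ ≤ t → y₀ < u t := by
    by_contra! hcon
    obtain ⟨t₁, ht₁, hut₁⟩ := hcon
    set A := {t | t₀ ≤ t ∧ u t ≤ y₀} with hA
    have hAc : IsClosed A := isClosed_Ici.inter (isClosed_le h.continuous_pos continuous_const)
    have hAb : BddBelow A := ⟨t₀, fun t ht => ht.1⟩
    have hmem : sInf A ∈ A := hAc.csInf_mem ⟨t₁, ht₁, hut₁⟩ hAb
    have := hmono _ hmem.1 (fun t ht => by
      by_contra! hle
      exact absurd (csInf_le hAb ⟨ht.1, hle⟩) (not_le.2 ht.2))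
    linarith [hmem.2]
  rintro ⟨B, hB⟩
  set s := κ₀ * (2 * (κ₀ * d)) with hs
  have hs0 : 0 < s := by positivity
  -- From time t₀ + 1 on, p ≥ κ₀ d and u grows at rate at least s; T is late enough for u to pass B.
  set T := t₀ + 1 + (|B - u (t₀ + 1)| + 1) / s with hT
  have hT1 : t₀ + 1 ≤ T := by
    have : 0 ≤ (|B - u (t₀ + 1)| + 1) / s := by positivity
    linarith
  have h1 := mul_sub_le_of_hasDerivAt h.hasDerivAt_pos (C := s) hT1 (fun t ht => by
    have h2 := hpos t (by linarith [ht.1]) (fun x hx => hall x hx.1) t ⟨by linarith [ht.1], le_rfl⟩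
    have h3 : κ₀ * d ≤ κ₀ * d * (t - t₀) := le_mul_of_one_le_right (by positivity) (by linarith [ht.1])
    have h4 : κ₀ * d ≤ p t := h3.trans h2
    exact mul_le_mul (hκ t) (by linarith) (by positivity) (hκp t).le)
  have h2 : s * (T - (t₀ + 1)) = |B - u (t₀ + 1)| + 1 := by
    rw [hT]; field_simp; ring
  have h3 := hB ⟨T, rfl⟩
  have h4 := le_abs_self (B - u (t₀ + 1))
  linarith

/-- A motion along which the virial-like quantity `p exp(l u)` grows escapes. -/
theorem not_bddAbove_of_virial (h : IsMotion κ F u p) {κ₀ d l : ℝ} (hκ₀ : 0 < κ₀)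
    (hκ : ∀ t, κ₀ ≤ κ t) (hd : 0 < d) (hl : 0 ≤ l) (hu : ∀ t, 0 ≤ u t)
    (hp : ∀ t, d ≤ F (u t) + 2 * l * p t ^ 2) : ¬ BddAbove (range u) := by
  have hκp : ∀ t, 0 < κ t := fun t => hκ₀.trans_le (hκ t)
  rintro ⟨B, hB⟩
  have hB' : ∀ t, u t ≤ B := fun t => hB ⟨t, rfl⟩
  -- The derivative of p exp(l u) is κ exp(l u) (F + 2 l p²), so Z grows at least linearly. If u ≤
  -- B, then p is eventually at least exp(-l B), and u grows linearly, a contradiction.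
  set Z : ℝ → ℝ := fun t => p t * Real.exp (l * u t) with hZ
  have hZd : ∀ t, HasDerivAt Z (κ t * (Real.exp (l * u t) * (F (u t) + 2 * l * p t ^ 2))) t := by
    intro t
    refine ((h.hasDerivAt_mom t).mul ((h.hasDerivAt_pos t).const_mul l).exp).congr_deriv ?_
    ring
  have hκd : 0 < κ₀ * d := by positivity
  have hgrow : ∀ t, 0 ≤ t → Z 0 + κ₀ * d * t ≤ Z t := by
    intro t ht
    have := mul_sub_le_of_hasDerivAt hZd (C := κ₀ * d) ht (fun x _ => by
      have h1 : 1 ≤ Real.exp (l * u x) := Real.one_le_exp (mul_nonneg hl (hu x))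
      have h2 : d ≤ Real.exp (l * u x) * (F (u x) + 2 * l * p x ^ 2) :=
        (hp x).trans (le_mul_of_one_le_left (hd.le.trans (hp x)) h1)
      exact mul_le_mul (hκ x) h2 hd.le (hκp x).le)
    linarith
  set T₀ := (|Z 0| + 1) / (κ₀ * d) with hT₀
  have hT₀0 : 0 ≤ T₀ := by positivity
  set e := Real.exp (-(l * B)) with he
  have he0 : 0 < e := Real.exp_pos _
  have hpe : ∀ t, T₀ ≤ t → e ≤ p t := by
    intro t ht
    have h1 := hgrow t (hT₀0.trans ht)
    have h2 : |Z 0| + 1 ≤ κ₀ * d * t := by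
      rw [hT₀, div_le_iff₀ hκd] at ht; linarith
    have h3 : 1 ≤ Z t := by linarith [neg_abs_le (Z 0)]
    have h4 : Real.exp (l * u t) ≤ Real.exp (l * B) := by
      have := hB' t; gcongr
    have hpos : 0 < p t := pos_of_mul_pos_left (lt_of_lt_of_le one_pos h3) (Real.exp_pos _).le
    have h5 : 1 ≤ p t * Real.exp (l * B) := h3.trans (by simp only [hZ]; gcongr)
    rw [he, Real.exp_neg, inv_le_iff_one_le_mul₀ (Real.exp_pos _)]
    exact h5
  set s := κ₀ * (2 * e) with hs
  have hs0 : 0 < s := by positivity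
  set T := T₀ + (|B - u T₀| + 1) / s with hT
  have hT1 : T₀ ≤ T := by rw [hT]; linarith [show 0 ≤ (|B - u T₀| + 1) / s by positivity]
  have h1 := mul_sub_le_of_hasDerivAt h.hasDerivAt_pos (C := s) hT1 (fun t ht =>
    mul_le_mul (hκ t) (by linarith [hpe t ht.1]) (by positivity) (hκp t).le)
  have h2 : s * (T - T₀) = |B - u T₀| + 1 := by
    rw [hT]; field_simp; ring
  linarith [hB' T, le_abs_self (B - u T₀)]

end IsMotion

theorem exists_cos_sin_eq {X Y : ℝ} (h : X ^ 2 + Y ^ 2 = 1) : ∃ θ, Real.cos θ = X ∧ Real.sin θ = Y := by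
  have hX : -1 ≤ X ∧ X ≤ 1 := ⟨by nlinarith [sq_nonneg Y], by nlinarith [sq_nonneg Y]⟩
  have hs : √(1 - X ^ 2) = |Y| := by rw [show 1 - X ^ 2 = Y ^ 2 by linarith, Real.sqrt_sq_eq_abs]
  rcases le_total 0 Y with hY | hY
  · exact ⟨Real.arccos X, Real.cos_arccos hX.1 hX.2, by rw [Real.sin_arccos, hs, abs_of_nonneg hY]⟩
  · exact ⟨-Real.arccos X, by rw [Real.cos_neg, Real.cos_arccos hX.1 hX.2],
      by rw [Real.sin_neg, Real.sin_arccos, hs, abs_of_nonpos hY, neg_neg]⟩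

/-- A motion between two simple roots of `Φ(x) = (x - a) (b - x) (α + β x)` is periodic. -/
theorem IsMotion.exists_periodic {κ F u p τ : ℝ → ℝ} (h : IsMotion κ F u p) (hκ : Continuous κ)
    (hτ : ∀ t, HasDerivAt τ (κ t) t) {a b α β : ℝ} (hab : a < b)
    (hG : ∀ x ∈ Icc a b, 0 < α + β * x)
    (hF : ∀ x, F x = (a + b - 2 * x) * (α + β * x) + (x - a) * (b - x) * β)
    (hu : u 0 ∈ Icc a b) (hp : p 0 ^ 2 = (u 0 - a) * (b - u 0) * (α + β * u 0)) :
    ∃ (N : ℝ → ℝ) (P : ℝ), 0 < P ∧ Function.Periodic N P ∧ (∃ s, N s = a) ∧ (∃ s, N s = b) ∧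
      ∀ t, u t = N (τ t) := by
  set m := (a + b) / 2 with hm
  set d := (b - a) / 2 with hd
  have hd0 : 0 < d := by rw [hd]; linarith
  -- The substitution u = m + d cos θ removes the turning points: (u - a)(b - u) = d² sin² θ, and p
  -- = -d sin θ · w turns the equation into θ' = 2w(θ) in the time τ, with w = √(α + βu) > 0. So θ
  -- runs through the line, and T below is τ as a function of θ.
  set y : ℝ → ℝ := fun θ => m + d * Real.cos θ with hy
  have hyI : ∀ θ, y θ ∈ Icc a b := fun θ => by
    have h1 := Real.neg_one_le_cos θ
    have h2 := Real.cos_le_one θ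
    constructor <;> simp only [hy, hm, hd] <;> nlinarith
  set w : ℝ → ℝ := fun θ => √(α + β * y θ) with hw
  have hwpos : ∀ θ, 0 < w θ := fun θ => Real.sqrt_pos.2 (hG _ (hyI θ))
  have hwsq : ∀ θ, w θ ^ 2 = α + β * y θ := fun θ => Real.sq_sqrt (hG _ (hyI θ)).le
  have hyc : Continuous y := by simp only [hy]; fun_prop
  have hwc : Continuous w := by simp only [hw]; fun_prop
  set M := max (α + β * a) (α + β * b) with hM
  have hMpos : 0 < M := (hG a ⟨le_rfl, hab.le⟩).trans_le (le_max_left _ _)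
  have hwle : ∀ θ, w θ ≤ √M := fun θ => by
    refine Real.sqrt_le_sqrt ?_
    have h1 := hyI θ
    rcases le_total 0 β with hβ | hβ
    · exact le_trans (by nlinarith [h1.2]) (le_max_right _ _)
    · exact le_trans (by nlinarith [h1.1]) (le_max_left _ _)
  have hMs : 0 < √M := Real.sqrt_pos.2 hMpos
  obtain ⟨T, hT0, hTm, hTd, hTs, hTi⟩ := exists_homeomorph_hasDerivAt
    (κ := fun θ => (2 * w θ)⁻¹) (m := (2 * √M)⁻¹)
    ((continuous_const.mul hwc).inv₀ fun θ => by exact (mul_pos two_pos (hwpos θ)).ne') (by positivity)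
    (fun θ => by
      have := hwpos θ
      have := hwle θ
      gcongr)
  set Θ : ℝ → ℝ := fun s => T.symm s with hΘ
  have hΘd : ∀ s, HasDerivAt Θ (2 * w (Θ s)) s := fun s => by simpa using hTs s
  -- The angle of the initial state. The relation `hp` makes the two squares add up to 1, and the
  -- sign of p 0 chooses the half of the circle.
  obtain ⟨θ₀, hc, hs⟩ : ∃ θ, Real.cos θ = (u 0 - m) / d ∧
      Real.sin θ = -(p 0 / (d * √(α + β * u 0))) := by
    refine exists_cos_sin_eq ?_
    have hg := hG _ hu
    rw [neg_sq, div_pow (u 0 - m), div_pow (p 0), mul_pow, Real.sq_sqrt hg.le, hp]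
    generalize α + β * u 0 = g at hg
    field_simp
    simp only [hm, hd]; ring
  set s₀ := T θ₀ with hs₀
  set N : ℝ → ℝ := fun s => y (Θ (s + (s₀ - τ 0))) with hN
  have hΘs : ∀ t, HasDerivAt (fun t => Θ (τ t + (s₀ - τ 0)))
      (κ t * (2 * w (Θ (τ t + (s₀ - τ 0))))) t := fun t => by
    refine ((hΘd _).comp t ((hτ t).add_const (s₀ - τ 0))).congr_deriv ?_
    ring
  set Ψ : ℝ → ℝ := fun t => Θ (τ t + (s₀ - τ 0)) with hΨ
  have hΨ0 : Ψ 0 = θ₀ := by simp [hΨ, hs₀, hΘ]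
  have hyd : ∀ t, HasDerivAt (fun t => y (Ψ t)) (κ t * (2 * (-d * Real.sin (Ψ t) * w (Ψ t)))) t := by
    intro t
    refine (((hΘs t).cos.const_mul d).const_add m).congr_deriv ?_
    simp only [hΨ]; ring
  have hmot : IsMotion κ F (fun t => y (Ψ t)) (fun t => -d * Real.sin (Ψ t) * w (Ψ t)) := by
    refine ⟨hyd, fun t => ?_⟩
    have hwd : HasDerivAt (fun t => w (Ψ t)) _ t :=
      (((hyd t).const_mul β).const_add α).sqrt (hG _ (hyI _)).ne'
    refine (((hΘs t).sin.const_mul (-d)).mul hwd).congr_deriv ?_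
    have h1 := hwpos (Ψ t)
    have h2 := hwsq (Ψ t)
    have h3 := Real.sin_sq_add_cos_sq (Ψ t)
    rw [hF]
    change -d * (Real.cos (Ψ t) * (κ t * (2 * w (Ψ t)))) * w (Ψ t) + -d * Real.sin (Ψ t) *
      (β * (κ t * (2 * (-d * Real.sin (Ψ t) * w (Ψ t)))) / (2 * w (Ψ t))) = κ t * ((a + b - 2 * y (Ψ t)) * (α + β * y (Ψ t)) +
        (y (Ψ t) - a) * (b - y (Ψ t)) * β)
    rw [← h2]
    field_simp
    have ha : a = m - d := by simp only [hm, hd]; ring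
    have hb : b = m + d := by simp only [hm, hd]; ring
    rw [ha, hb]
    simp only [hy]
    linear_combination (κ t * d ^ 2 * β) * h3
  have huN : u = fun t => y (Ψ t) := by
    refine (h.eq_of_eq hmot hκ ?_ (t₀ := 0) ?_ ?_).1
    · have : F = fun x => (a + b - 2 * x) * (α + β * x) + (x - a) * (b - x) * β := funext hF
      rw [this]; fun_prop
    · simp only [hΨ0, hy, hc]; field_simp; ring
    · have e : y θ₀ = u 0 := by simp only [hy, hc]; field_simp; ring
      have hg : 0 < √(α + β * u 0) := Real.sqrt_pos.2 (hG _ hu)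
      simp only [hΨ0, hs, hw, e]
      field_simp
  -- The integrand is 2π-periodic in θ, so one turn always takes the time T (2π). This is the period
  -- of N.
  have hper : ∀ θ, T (θ + 2 * Real.pi) = T θ + T (2 * Real.pi) := by
    intro θ
    have hP : Function.Periodic (fun θ => (2 * w θ)⁻¹) (2 * Real.pi) := fun θ => by
      simp [hw, hy]
    have h1 := hTi θ (θ + 2 * Real.pi)
    have h2 := hTi 0 (0 + 2 * Real.pi)
    rw [hP.intervalIntegral_add_eq θ 0, ← h2, hT0, zero_add] at h1
    linarith
  have hΘp : ∀ s, Θ (s + T (2 * Real.pi)) = Θ s + 2 * Real.pi := fun s => by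
    apply T.injective
    rw [hper]; simp [hΘ]
  refine ⟨N, T (2 * Real.pi), ?_, fun s => ?_, ⟨T Real.pi - (s₀ - τ 0), ?_⟩,
    ⟨T 0 - (s₀ - τ 0), ?_⟩, fun t => ?_⟩
  · rw [← hT0]; exact hTm Real.two_pi_pos
  · simp only [hN]
    rw [add_right_comm, hΘp]
    simp [hy]
  · simp [hN, hΘ, hy, hm, hd]; ring
  · simp only [hN, sub_add_cancel, hΘ, T.symm_apply_apply, hy, hm, hd, Real.cos_zero]; ring
  · rw [huN]

theorem hasDerivAt_tanh (x : ℝ) : HasDerivAt Real.tanh (1 - Real.tanh x ^ 2) x := by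
  have h := (Real.hasDerivAt_sinh x).div (Real.hasDerivAt_cosh x) (Real.cosh_pos x).ne'
  have e : Real.tanh = fun y => Real.sinh y / Real.cosh y := funext Real.tanh_eq_sinh_div_cosh
  rw [e]
  refine h.congr_deriv ?_
  have := Real.cosh_pos x
  field_simp

/-- From cosh² = 1 + sinh² ≥ 1 + x². The bound is even in x, so it serves both ends of time in the
homoclinic limit. -/
theorem one_sub_tanh_sq_le (x : ℝ) : 1 - Real.tanh x ^ 2 ≤ 1 / (1 + x ^ 2) := by
  have h1 : 1 - Real.tanh x ^ 2 = 1 / Real.cosh x ^ 2 := by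
    rw [Real.tanh_eq_sinh_div_cosh]
    have := Real.cosh_pos x
    field_simp
    rw [Real.cosh_sq]; ring
  rw [h1, Real.cosh_sq, add_comm]
  have h2 : x ^ 2 ≤ Real.sinh x ^ 2 := by
    rw [← sq_abs x, ← sq_abs (Real.sinh x), Real.abs_sinh]
    gcongr
    exact Real.self_le_sinh_iff.2 (abs_nonneg x)
  gcongr

/-- A motion between a simple root `a` and a double root `a + D` of
`Φ(x) = (x - a) (x - a - D) ^ 2` is asymptotic to the double root. -/
theorem IsMotion.exists_homoclinic {κ F u p τ : ℝ → ℝ} (h : IsMotion κ F u p) (hκ : Continuous κ)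
    (hτ : ∀ t, HasDerivAt τ (κ t) t) {a D : ℝ} (hD : 0 < D)
    (hF : ∀ x, F x = (x - a - D) ^ 2 + 2 * (x - a) * (x - a - D))
    (hu : u 0 ∈ Ico a (a + D)) (hp : p 0 ^ 2 = (u 0 - a) * (u 0 - a - D) ^ 2) :
    ∃ N : ℝ → ℝ, (∀ s, N s < a + D) ∧ Tendsto N atTop (𝓝 (a + D)) ∧ Tendsto N atBot (𝓝 (a + D)) ∧
      ∀ t, u t = N (τ t) := by
  set k := √D with hk
  have hk0 : 0 < k := Real.sqrt_pos.2 hD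
  have hk2 : k ^ 2 = D := Real.sq_sqrt hD.le
  -- The solution is u = a + D tanh²(kτ + s₀) with k = √D. Here θ is the value of tanh at the
  -- initial time, and the sign of p 0 decides on which branch of the loop the motion starts.
  obtain ⟨θ, hθ2, hθp⟩ : ∃ θ : ℝ, D * θ ^ 2 = u 0 - a ∧ p 0 = D * k * (θ * (1 - θ ^ 2)) := by
    have hlt : u 0 - a - D < 0 := by linarith [hu.2]
    have hne : u 0 - a - D ≠ 0 := hlt.ne
    refine ⟨p 0 / (k * -(u 0 - a - D)), ?_, ?_⟩
    · rw [div_pow, mul_pow, hk2, hp]; field_simp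
    · have e : (p 0 / (k * -(u 0 - a - D))) ^ 2 = (u 0 - a) / D := by
        rw [div_pow, mul_pow, hk2, hp]; field_simp
      rw [e]; field_simp; ring_nf
  have hθ : θ ∈ Ioo (-1) 1 := by
    refine abs_lt.1 ((sq_lt_one_iff_abs_lt_one θ).1 ?_)
    nlinarith [hu.2]
  set s₀ := Real.artanh θ - k * τ 0 with hs₀
  have hth0 : Real.tanh (k * τ 0 + s₀) = θ := by
    rw [hs₀, add_sub_cancel, Real.tanh_artanh hθ]
  have hTd : ∀ t, HasDerivAt (fun t => Real.tanh (k * τ t + s₀))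
      (κ t * (k * (1 - Real.tanh (k * τ t + s₀) ^ 2))) t := fun t => by
    refine ((hasDerivAt_tanh _).comp t (((hτ t).const_mul k).add_const s₀)).congr_deriv ?_
    ring
  have hmot : IsMotion κ F (fun t => a + D * Real.tanh (k * τ t + s₀) ^ 2)
      (fun t => D * k * (Real.tanh (k * τ t + s₀) * (1 - Real.tanh (k * τ t + s₀) ^ 2))) := by
    refine ⟨fun t => ?_, fun t => ?_⟩
    · refine ((((hTd t).pow 2).const_mul D).const_add a).congr_deriv ?_
      simp; ring
    · refine (((hTd t).mul (((hTd t).pow 2).const_sub 1)).const_mul (D * k)).congr_deriv ?_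
      rw [hF, ← hk2]
      simp; ring
  have huN := (h.eq_of_eq hmot hκ (by rw [show F = _ from funext hF]; fun_prop) (t₀ := 0)
    (by rw [hth0]; linarith) (by rw [hth0, hθp])).1
  have hlim : ∀ l : Filter ℝ, Tendsto (fun s => (k * s + s₀) ^ 2) l atTop →
      Tendsto (fun s => a + D * Real.tanh (k * s + s₀) ^ 2) l (𝓝 (a + D)) := by
    intro l hl
    have h1 : Tendsto (fun s => 1 / (1 + (k * s + s₀) ^ 2)) l (𝓝 0) := by
      simp only [one_div]
      exact (tendsto_atTop_add_const_left l 1 hl).inv_tendsto_atTop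
    have h2 : Tendsto (fun s => 1 - Real.tanh (k * s + s₀) ^ 2) l (𝓝 0) :=
      squeeze_zero (fun s => by linarith [Real.tanh_sq_lt_one (k * s + s₀)])
        (fun s => one_sub_tanh_sq_le _) h1
    have h3 := (h2.const_mul D).const_sub (a + D)
    simp only [mul_zero, sub_zero] at h3
    refine h3.congr fun s => by ring
  refine ⟨fun s => a + D * Real.tanh (k * s + s₀) ^ 2, fun s => ?_, hlim _ ?_, hlim _ ?_,
    fun t => congrFun huN t⟩
  · have := Real.tanh_sq_lt_one (k * s + s₀); nlinarith
  · exact (tendsto_pow_atTop two_ne_zero).comp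
      (tendsto_atTop_add_const_right _ s₀ (tendsto_id.const_mul_atTop hk0))
  · have h1 : Tendsto (fun s => k * s + s₀) atBot atBot :=
      tendsto_atBot_add_const_right _ s₀ (tendsto_id.const_mul_atBot hk0)
    refine ((tendsto_pow_atTop (α := ℝ) two_ne_zero).comp (tendsto_neg_atBot_atTop.comp h1)).congr
      fun s => by simp only [Function.comp_apply]; ring

/-! ### Double roots of the two cubics -/

/-- The product of the roots is L², whence the third root L² / m². A change of c only adds a
multiple of u, so f at any c is compared with a cubic whose sign is visible; the bounds on c and the
monotonicity of the thresholds rest on this form. -/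
theorem xiCubic_eq_of_double {L h m : ℝ} (hm : 0 < m) (he : 2 * m ^ 3 + 2 * h * m ^ 2 + L ^ 2 = 0)
    (c u : ℝ) : xiCubic L h c u = (u - m) ^ 2 * (u - L ^ 2 / m ^ 2) +
      2 * (c - ((m + 2 * L ^ 2 / m ^ 2) * m / 2 - 1)) * u := by
  have hh : h = -(2 * m ^ 3 + L ^ 2) / (2 * m ^ 2) := by field_simp; linarith
  rw [xiCubic, hh]
  field_simp
  ring

theorem etaCubic_eq_of_double {L h m : ℝ} (hm : 0 < m) (he : 2 * m ^ 3 - 2 * h * m ^ 2 - L ^ 2 = 0)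
    (c v : ℝ) : etaCubic L h c v = -((v - m) ^ 2 * (v + L ^ 2 / m ^ 2)) +
      2 * ((m - 2 * L ^ 2 / m ^ 2) * m / 2 + 1 - c) * v := by
  have hh : h = (2 * m ^ 3 - L ^ 2) / (2 * m ^ 2) := by field_simp; linarith
  rw [etaCubic, hh]
  field_simp
  ring

theorem double_iff {L h u : ℝ} (hu : 0 < u) :
    2 * u + L ^ 2 / u ^ 2 = -2 * h ↔ 2 * u ^ 3 + 2 * h * u ^ 2 + L ^ 2 = 0 := by
  constructor
  · intro e; field_simp at e; linarith
  · intro e; field_simp; linarith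

theorem double_iff' {L h v : ℝ} (hv : 0 < v) :
    2 * v - L ^ 2 / v ^ 2 = 2 * h ↔ 2 * v ^ 3 - 2 * h * v ^ 2 - L ^ 2 = 0 := by
  constructor
  · intro e; field_simp at e; linarith
  · intro e; field_simp; linarith

theorem rpow_two_thirds_cube (L : ℝ) : (|L| ^ (2 / 3 : ℝ)) ^ 3 = L ^ 2 := by
  rw [← Real.rpow_natCast, ← Real.rpow_mul (abs_nonneg L)]
  norm_num

/-- With a³ = L² this is 2u³ - 3au² + a³ = (u - a)²(2u + a) ≥ 0. -/
theorem le_hTop_of_double {L h u : ℝ} (hu : 0 < u) (he : 2 * u ^ 3 + 2 * h * u ^ 2 + L ^ 2 = 0) :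
    h ≤ hTop L := by
  have h3 := rpow_two_thirds_cube L
  rw [hTop]
  set a := |L| ^ (2 / 3 : ℝ)
  have ha : 0 ≤ a := Real.rpow_nonneg (abs_nonneg L) _
  have h1 : 0 ≤ (u - a) ^ 2 * (2 * u + a) := by positivity
  by_contra! hcon
  have : 2 * (-(3 / 2) * a) * u ^ 2 < 2 * h * u ^ 2 := by
    have := pow_pos hu 2
    nlinarith
  nlinarith

theorem rpow_two_thirds_pos {L : ℝ} (hL : L ≠ 0) : 0 < |L| ^ (2 / 3 : ℝ) :=
  Real.rpow_pos_of_pos (abs_pos.2 hL) _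

/-- Eliminating h leaves (u - w)(2u²w² - a³(u + w)) = 0. The second factor is -(u(a³ - uw²) + w(a³ -
u²w)), a sum of two terms of one sign; if it vanishes, then uw² = u²w. -/
theorem eq_of_double_of_le {L h u w a : ℝ} (ha : a ^ 3 = L ^ 2) (hu : 0 < u) (hua : u ≤ a)
    (hw : 0 < w) (hwa : w ≤ a) (he : 2 * u ^ 3 + 2 * h * u ^ 2 + L ^ 2 = 0)
    (he' : 2 * w ^ 3 + 2 * h * w ^ 2 + L ^ 2 = 0) : u = w := by
  have key : (u - w) * (2 * u ^ 2 * w ^ 2 - a ^ 3 * (u + w)) = 0 := by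
    rw [ha]; linear_combination w ^ 2 * he - u ^ 2 * he'
  rcases mul_eq_zero.1 key with h0 | h0
  · linarith
  · have ha0 : 0 < a := hu.trans_le hua
    have h1 : u * w * w ≤ a * a * a := by gcongr
    have h2 : u * w * u ≤ a * a * a := by gcongr
    have h3 : u * (a ^ 3 - u * w ^ 2) = 0 := by nlinarith
    have h4 : w * (a ^ 3 - u ^ 2 * w) = 0 := by nlinarith
    have h5 : a ^ 3 - u * w ^ 2 = 0 := (mul_eq_zero.1 h3).resolve_left hu.ne'
    have h6 : a ^ 3 - u ^ 2 * w = 0 := (mul_eq_zero.1 h4).resolve_left hw.ne'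
    have h7 : u * w * (u - w) = 0 := by linarith
    linarith [(mul_eq_zero.1 h7).resolve_left (mul_pos hu hw).ne']

theorem eq_of_double_of_ge {L h u w a : ℝ} (ha0 : 0 < a) (ha : a ^ 3 = L ^ 2) (hua : a ≤ u)
    (hwa : a ≤ w) (he : 2 * u ^ 3 + 2 * h * u ^ 2 + L ^ 2 = 0)
    (he' : 2 * w ^ 3 + 2 * h * w ^ 2 + L ^ 2 = 0) : u = w := by
  have hu := ha0.trans_le hua
  have hw := ha0.trans_le hwa
  have key : (u - w) * (2 * u ^ 2 * w ^ 2 - a ^ 3 * (u + w)) = 0 := by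
    rw [ha]; linear_combination w ^ 2 * he - u ^ 2 * he'
  rcases mul_eq_zero.1 key with h0 | h0
  · linarith
  · have h1 : a * a * a ≤ u * w * w := by gcongr
    have h2 : a * a * a ≤ u * w * u := by gcongr
    have h3 : u * (u * w ^ 2 - a ^ 3) = 0 := by nlinarith
    have h4 : w * (u ^ 2 * w - a ^ 3) = 0 := by nlinarith
    have h5 := (mul_eq_zero.1 h3).resolve_left hu.ne'
    have h6 := (mul_eq_zero.1 h4).resolve_left hw.ne'
    have h7 : u * w * (u - w) = 0 := by linarith
    linarith [(mul_eq_zero.1 h7).resolve_left (mul_pos hu hw).ne']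

theorem uLow_eq {L h m : ℝ} (hm : 0 < m) (hma : m ≤ |L| ^ (2 / 3 : ℝ))
    (he : 2 * m ^ 3 + 2 * h * m ^ 2 + L ^ 2 = 0) : uLow L h = m := by
  have : {u | 0 < u ∧ u ≤ |L| ^ (2 / 3 : ℝ) ∧ 2 * u + L ^ 2 / u ^ 2 = -2 * h} = {m} := by
    ext u
    refine ⟨fun ⟨h0, h1, h2⟩ => ?_, ?_⟩
    · exact eq_of_double_of_le (rpow_two_thirds_cube L) h0 h1 hm hma ((double_iff h0).1 h2) he
    · rintro rfl; exact ⟨hm, hma, (double_iff hm).2 he⟩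
  rw [uLow, this, csInf_singleton]

theorem uHigh_eq {L h m : ℝ} (hL : L ≠ 0) (hma : |L| ^ (2 / 3 : ℝ) ≤ m)
    (he : 2 * m ^ 3 + 2 * h * m ^ 2 + L ^ 2 = 0) : uHigh L h = m := by
  have ha := rpow_two_thirds_pos hL
  have : {u | |L| ^ (2 / 3 : ℝ) ≤ u ∧ 2 * u + L ^ 2 / u ^ 2 = -2 * h} = {m} := by
    ext u
    refine ⟨fun ⟨h1, h2⟩ => ?_, ?_⟩
    · exact eq_of_double_of_ge ha (rpow_two_thirds_cube L) h1 hma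
        ((double_iff (ha.trans_le h1)).1 h2) he
    · rintro rfl; exact ⟨hma, (double_iff (ha.trans_le hma)).2 he⟩
  rw [uHigh, this, csInf_singleton]

theorem vDouble_eq {L h m : ℝ} (hm : 0 < m)
    (he : 2 * m ^ 3 - 2 * h * m ^ 2 - L ^ 2 = 0) : vDouble L h = m := by
  have : {v | 0 < v ∧ 2 * v - L ^ 2 / v ^ 2 = 2 * h} = {m} := by
    ext u
    refine ⟨fun ⟨h0, h2⟩ => ?_, ?_⟩
    · have h3 := (double_iff' h0).1 h2
      have key : (u - m) * (2 * u ^ 2 * m ^ 2 + L ^ 2 * (u + m)) = 0 := by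
        linear_combination m ^ 2 * h3 - u ^ 2 * he
      have : 0 < 2 * u ^ 2 * m ^ 2 + L ^ 2 * (u + m) := by positivity
      have := (mul_eq_zero.1 key).resolve_right this.ne'
      simp only [mem_singleton_iff]; linarith
    · rintro rfl; exact ⟨hm, (double_iff' hm).2 he⟩
  rw [vDouble, this, csInf_singleton]

theorem uLow_spec {L h : ℝ} (hL : L ≠ 0) (hh : h ≤ hTop L) :
    0 < uLow L h ∧ uLow L h ≤ |L| ^ (2 / 3 : ℝ) ∧
      2 * uLow L h ^ 3 + 2 * h * uLow L h ^ 2 + L ^ 2 = 0 := by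
  have ha := rpow_two_thirds_pos hL
  have h3 := rpow_two_thirds_cube L
  have hL2 : 0 < L ^ 2 := by positivity
  suffices H : ∃ m, 0 < m ∧ m ≤ |L| ^ (2 / 3 : ℝ) ∧ 2 * m ^ 3 + 2 * h * m ^ 2 + L ^ 2 = 0 by
    obtain ⟨m, h1, h2, h4⟩ := H
    rw [uLow_eq h1 h2 h4]; exact ⟨h1, h2, h4⟩
  rw [hTop] at hh
  set a := |L| ^ (2 / 3 : ℝ)
  have hc : ContinuousOn (fun u : ℝ => 2 * u ^ 3 + 2 * h * u ^ 2 + L ^ 2) (Icc 0 a) := by fun_prop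
  have h4 : 2 * a ^ 3 + 2 * h * a ^ 2 + L ^ 2 ≤ 0 := by
    have := mul_le_mul_of_nonneg_right hh (sq_nonneg a)
    nlinarith
  obtain ⟨m, hm, hme⟩ := intermediate_value_Icc' ha.le hc
    (show (0 : ℝ) ∈ _ from ⟨h4, by simpa using hL2.le⟩)
  refine ⟨m, hm.1.lt_of_ne ?_, hm.2, hme⟩
  rintro rfl
  simp at hme; exact hL hme

theorem uHigh_spec {L h : ℝ} (hL : L ≠ 0) (hh : h ≤ hTop L) :
    |L| ^ (2 / 3 : ℝ) ≤ uHigh L h ∧ 2 * uHigh L h ^ 3 + 2 * h * uHigh L h ^ 2 + L ^ 2 = 0 := by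
  have ha := rpow_two_thirds_pos hL
  have h3 := rpow_two_thirds_cube L
  suffices H : ∃ m, |L| ^ (2 / 3 : ℝ) ≤ m ∧ 2 * m ^ 3 + 2 * h * m ^ 2 + L ^ 2 = 0 by
    obtain ⟨m, h2, h4⟩ := H
    rw [uHigh_eq hL h2 h4]; exact ⟨h2, h4⟩
  rw [hTop] at hh
  set a := |L| ^ (2 / 3 : ℝ)
  have hc : ContinuousOn (fun u : ℝ => 2 * u ^ 3 + 2 * h * u ^ 2 + L ^ 2) (Icc a (-h)) := by fun_prop
  have h4 : 2 * a ^ 3 + 2 * h * a ^ 2 + L ^ 2 ≤ 0 := by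
    have := mul_le_mul_of_nonneg_right hh (sq_nonneg a)
    nlinarith
  obtain ⟨m, hm, hme⟩ := intermediate_value_Icc (by linarith) hc
    (show (0 : ℝ) ∈ _ from ⟨h4, by nlinarith [sq_nonneg L]⟩)
  exact ⟨m, hm.1, hme⟩

theorem vDouble_spec {L : ℝ} (hL : L ≠ 0) (h : ℝ) :
    0 < vDouble L h ∧ 2 * vDouble L h ^ 3 - 2 * h * vDouble L h ^ 2 - L ^ 2 = 0 := by
  have hL2 : 0 < L ^ 2 := by positivity
  suffices H : ∃ m, 0 < m ∧ 2 * m ^ 3 - 2 * h * m ^ 2 - L ^ 2 = 0 by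
    obtain ⟨m, h2, h4⟩ := H
    rw [vDouble_eq h2 h4]; exact ⟨h2, h4⟩
  set M := |h| + L ^ 2 + 1 with hM
  have hM0 : 0 < M := by positivity
  have hc : ContinuousOn (fun u : ℝ => 2 * u ^ 3 - 2 * h * u ^ 2 - L ^ 2) (Icc 0 M) := by fun_prop
  have h4 : 0 ≤ 2 * M ^ 3 - 2 * h * M ^ 2 - L ^ 2 := by
    have e : 2 * M ^ 3 - 2 * h * M ^ 2 = 2 * (M - h) * M ^ 2 := by ring
    have h5 : L ^ 2 + 1 ≤ M - h := by rw [hM]; linarith [le_abs_self h]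
    have h6 : 1 ≤ M ^ 2 := by
      have : 1 ≤ M := by rw [hM]; linarith [abs_nonneg h]
      nlinarith
    rw [e]; nlinarith
  obtain ⟨m, hm, hme⟩ := intermediate_value_Icc hM0.le hc
    (show (0 : ℝ) ∈ _ from ⟨by simpa using hL2.le, h4⟩)
  refine ⟨m, hm.1.lt_of_ne ?_, hme⟩
  rintro rfl
  simp at hme; exact hL hme

theorem uHigh_pos {L h : ℝ} (hL : L ≠ 0) (hh : h ≤ hTop L) : 0 < uHigh L h :=
  (rpow_two_thirds_pos hL).trans_le (uHigh_spec hL hh).1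

theorem uLow_le_uHigh {L h : ℝ} (hL : L ≠ 0) (hh : h ≤ hTop L) : uLow L h ≤ uHigh L h :=
  (uLow_spec hL hh).2.1.trans (uHigh_spec hL hh).1

theorem xiCubic_eq_low {L h : ℝ} (hL : L ≠ 0) (hh : h ≤ hTop L) (c u : ℝ) :
    xiCubic L h c u = (u - uLow L h) ^ 2 * (u - L ^ 2 / uLow L h ^ 2) + 2 * (c - C1xi L h) * u :=
  xiCubic_eq_of_double (uLow_spec hL hh).1 (uLow_spec hL hh).2.2 c u

theorem xiCubic_eq_high {L h : ℝ} (hL : L ≠ 0) (hh : h ≤ hTop L) (c u : ℝ) :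
    xiCubic L h c u = (u - uHigh L h) ^ 2 * (u - L ^ 2 / uHigh L h ^ 2) + 2 * (c - C2xi L h) * u :=
  xiCubic_eq_of_double (uHigh_pos hL hh) (uHigh_spec hL hh).2 c u

theorem etaCubic_eq {L : ℝ} (hL : L ≠ 0) (h c v : ℝ) :
    etaCubic L h c v = -((v - vDouble L h) ^ 2 * (v + L ^ 2 / vDouble L h ^ 2)) +
      2 * (Ceta L h - c) * v :=
  etaCubic_eq_of_double (vDouble_spec hL h).1 (vDouble_spec hL h).2 c v

theorem hTop_eq_of_uLow_eq {L h : ℝ} (hL : L ≠ 0) (hh : h ≤ hTop L) (he : uLow L h = uHigh L h) :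
    h = hTop L := by
  have ha := rpow_two_thirds_pos hL
  have h3 := rpow_two_thirds_cube L
  obtain ⟨h1, h2, h4⟩ := uLow_spec hL hh
  have h5 : uLow L h = |L| ^ (2 / 3 : ℝ) := le_antisymm h2 (he ▸ (uHigh_spec hL hh).1)
  rw [h5] at h4
  rw [hTop]
  set a := |L| ^ (2 / 3 : ℝ)
  have h6 : a ^ 2 * (2 * h + 3 * a) = 0 := by linear_combination h4 + h3
  have := (mul_eq_zero.1 h6).resolve_left (by positivity)
  linarith

theorem uLow_lt_uHigh {L h : ℝ} (hL : L ≠ 0) (hh : h < hTop L) : uLow L h < uHigh L h :=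
  (uLow_le_uHigh hL hh.le).lt_of_ne fun he => hh.ne (hTop_eq_of_uLow_eq hL hh.le he)

theorem uLow_hTop {L : ℝ} (hL : L ≠ 0) : uLow L (hTop L) = |L| ^ (2 / 3 : ℝ) := by
  refine uLow_eq (rpow_two_thirds_pos hL) le_rfl ?_
  rw [hTop, ← rpow_two_thirds_cube L]; ring

theorem uHigh_hTop {L : ℝ} (hL : L ≠ 0) : uHigh L (hTop L) = |L| ^ (2 / 3 : ℝ) := by
  refine uHigh_eq hL le_rfl ?_
  rw [hTop, ← rpow_two_thirds_cube L]; ring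

theorem vDouble_hTop {L : ℝ} (hL : L ≠ 0) : vDouble L (hTop L) = |L| ^ (2 / 3 : ℝ) / 2 := by
  refine vDouble_eq (by have := rpow_two_thirds_pos hL; positivity) ?_
  rw [hTop, ← rpow_two_thirds_cube L]; ring

theorem C1xi_hTop {L : ℝ} (hL : L ≠ 0) :
    C1xi L (hTop L) = 3 / 2 * (|L| ^ (2 / 3 : ℝ)) ^ 2 - 1 := by
  have := rpow_two_thirds_pos hL
  rw [C1xi, uLow_hTop hL, ← rpow_two_thirds_cube L]; field_simp; ring

theorem Ceta_hTop {L : ℝ} (hL : L ≠ 0) :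
    Ceta L (hTop L) = -(15 / 8) * (|L| ^ (2 / 3 : ℝ)) ^ 2 + 1 := by
  have := rpow_two_thirds_pos hL
  rw [Ceta, vDouble_hTop hL, ← rpow_two_thirds_cube L]; field_simp; ring

/-- The relation between the two positive critical points of the potential of `ξ`. -/
theorem double_relation {L h : ℝ} (hL : L ≠ 0) (hh : h ≤ hTop L) :
    L ^ 2 * (uLow L h + uHigh L h) = 2 * uLow L h ^ 2 * uHigh L h ^ 2 := by
  rcases hh.eq_or_lt with rfl | hlt
  · rw [uLow_hTop hL, uHigh_hTop hL, ← rpow_two_thirds_cube L]; ring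
  · have h1 := (uLow_spec hL hh).2.2
    have h2 := (uHigh_spec hL hh).2
    have h3 := uLow_lt_uHigh hL hlt
    have key : (uHigh L h - uLow L h) * (L ^ 2 * (uLow L h + uHigh L h) -
        2 * uLow L h ^ 2 * uHigh L h ^ 2) = 0 := by
      linear_combination uHigh L h ^ 2 * h1 - uLow L h ^ 2 * h2
    linarith [(mul_eq_zero.1 key).resolve_left (by linarith)]

/-- With `third_le_uLow` this orders all roots involved: L² / `uHigh`² ≤ `uLow` ≤ `uHigh` ≤ L² /
`uLow`². It gives the sign of the simple factor in the double-root forms of f. -/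
theorem uHigh_le_third {L h : ℝ} (hL : L ≠ 0) (hh : h ≤ hTop L) :
    uHigh L h ≤ L ^ 2 / uLow L h ^ 2 := by
  have h0 := (uLow_spec hL hh).1
  have h1 := uHigh_pos hL hh
  have h2 := uLow_le_uHigh hL hh
  have h3 := double_relation hL hh
  rw [le_div_iff₀ (by positivity)]
  nlinarith [mul_pos h0 h0, mul_pos (mul_pos h0 h0) h1,
    mul_le_mul_of_nonneg_left h2 (mul_pos (mul_pos h0 h0) h1).le]

theorem third_le_uLow {L h : ℝ} (hL : L ≠ 0) (hh : h ≤ hTop L) :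
    L ^ 2 / uHigh L h ^ 2 ≤ uLow L h := by
  have h0 := (uLow_spec hL hh).1
  have h1 := uHigh_pos hL hh
  have h2 := uLow_le_uHigh hL hh
  have h3 := double_relation hL hh
  rw [div_le_iff₀ (by positivity)]
  nlinarith [mul_pos h0 h1, mul_pos (mul_pos h1 h1) h0,
    mul_le_mul_of_nonneg_left h2 (mul_pos (mul_pos h1 h1) h0).le]

theorem third_lt_uHigh {L h : ℝ} (hL : L ≠ 0) (hh : h < hTop L) :
    L ^ 2 / uHigh L h ^ 2 < uHigh L h :=
  (third_le_uLow hL hh.le).trans_lt (uLow_lt_uHigh hL hh)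

theorem uLow_lt_third {L h : ℝ} (hL : L ≠ 0) (hh : h < hTop L) :
    uLow L h < L ^ 2 / uLow L h ^ 2 :=
  (uLow_lt_uHigh hL hh).trans_le (uHigh_le_third hL hh.le)

theorem xiCubic_low {L h : ℝ} (hL : L ≠ 0) (hh : h ≤ hTop L) (c : ℝ) :
    xiCubic L h c (uLow L h) = 2 * (c - C1xi L h) * uLow L h := by
  rw [xiCubic_eq_low hL hh]; ring

theorem xiCubic_high {L h : ℝ} (hL : L ≠ 0) (hh : h ≤ hTop L) (c : ℝ) :
    xiCubic L h c (uHigh L h) = 2 * (c - C2xi L h) * uHigh L h := by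
  rw [xiCubic_eq_high hL hh]; ring

theorem etaCubic_vDouble {L : ℝ} (hL : L ≠ 0) (h c : ℝ) :
    etaCubic L h c (vDouble L h) = 2 * (Ceta L h - c) * vDouble L h := by
  rw [etaCubic_eq hL]; ring

/-- For c = `C2xi` the value f(`uLow`) is on the one hand 2(`C2xi` - `C1xi`)`uLow`, on the other a
square times a positive simple factor. -/
theorem C1xi_lt_C2xi {L h : ℝ} (hL : L ≠ 0) (hh : h < hTop L) : C1xi L h < C2xi L h := by
  have h1 := xiCubic_low hL hh.le (C2xi L h)
  rw [xiCubic_eq_high hL hh.le] at h1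
  have h0 := (uLow_spec hL hh.le).1
  have h2 := uLow_lt_uHigh hL hh
  have h3 : 0 < uLow L h - L ^ 2 / uHigh L h ^ 2 := by
    have h4 := double_relation hL hh.le
    have h5 := uHigh_pos hL hh.le
    rw [sub_pos, div_lt_iff₀ (by positivity)]
    nlinarith [mul_pos h0 h5, mul_pos (mul_pos h5 h5) h0,
      mul_lt_mul_of_pos_left h2 (mul_pos (mul_pos h5 h5) h0)]
  have h4 : 0 < (uLow L h - uHigh L h) ^ 2 * (uLow L h - L ^ 2 / uHigh L h ^ 2) :=
    mul_pos (by nlinarith) h3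
  by_contra! hcon
  nlinarith

/-- An envelope argument in place of derivatives. The cubic for h' with c = `C1xi` of h' is
nonpositive at `uLow` of h, and the cubic for h with its own `C1xi` vanishes there; the difference
bounds the drop of `C1xi` by (h' - h)`uLow` from below. The next two lemmas evaluate one cubic at
the double root of the other in the same way. -/
theorem C1xi_strictAnti {L h h' : ℝ} (hL : L ≠ 0) (hlt : h < h') (hh : h' ≤ hTop L) :
    C1xi L h' < C1xi L h := by
  obtain ⟨h0, h1, -⟩ := uLow_spec hL (hlt.le.trans hh)
  have h2 := xiCubic_eq_low hL hh (C1xi L h') (uLow L h)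
  have h3 := xiCubic_low hL (hlt.le.trans hh) (C1xi L h)
  have h4 : uLow L h ≤ L ^ 2 / uLow L h' ^ 2 :=
    h1.trans ((uHigh_spec hL hh).1.trans (uHigh_le_third hL hh))
  have h5 : (uLow L h - uLow L h') ^ 2 * (uLow L h - L ^ 2 / uLow L h' ^ 2) ≤ 0 :=
    mul_nonpos_of_nonneg_of_nonpos (sq_nonneg _) (by linarith)
  simp only [xiCubic] at h2 h3
  have h6 : uLow L h * ((h' - h) * uLow L h + (C1xi L h' - C1xi L h)) ≤ 0 := by nlinarith
  have h7 := nonpos_of_mul_nonpos_right h6 h0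
  nlinarith [mul_pos (sub_pos.2 hlt) h0]

theorem C2xi_strictAnti {L h h' : ℝ} (hL : L ≠ 0) (hlt : h < h') (hh : h' ≤ hTop L) :
    C2xi L h' < C2xi L h := by
  have hh' := hlt.le.trans hh
  have h0 := uHigh_pos hL hh
  have h2 := xiCubic_eq_high hL hh' (C2xi L h) (uHigh L h')
  have h3 := xiCubic_high hL hh (C2xi L h')
  have h4 : L ^ 2 / uHigh L h ^ 2 ≤ uHigh L h' :=
    (third_le_uLow hL hh').trans ((uLow_spec hL hh').2.1.trans (uHigh_spec hL hh).1)
  have h5 : 0 ≤ (uHigh L h' - uHigh L h) ^ 2 * (uHigh L h' - L ^ 2 / uHigh L h ^ 2) :=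
    mul_nonneg (sq_nonneg _) (by linarith)
  simp only [xiCubic] at h2 h3
  have h6 : 0 ≤ uHigh L h' * ((C2xi L h - C2xi L h') - (h' - h) * uHigh L h') := by nlinarith
  have h7 := nonneg_of_mul_nonneg_right h6 h0
  nlinarith [mul_pos (sub_pos.2 hlt) h0]

theorem Ceta_strictMono {L h h' : ℝ} (hL : L ≠ 0) (hlt : h < h') : Ceta L h < Ceta L h' := by
  have h0 := (vDouble_spec hL h).1
  have h1 := (vDouble_spec hL h').1
  have h2 := etaCubic_eq hL h' (Ceta L h') (vDouble L h)
  have h3 := etaCubic_vDouble hL h (Ceta L h)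
  have h5 : 0 ≤ (vDouble L h - vDouble L h') ^ 2 * (vDouble L h + L ^ 2 / vDouble L h' ^ 2) := by
    positivity
  simp only [etaCubic] at h2 h3
  have h6 : 0 ≤ vDouble L h * ((Ceta L h' - Ceta L h) - (h' - h) * vDouble L h) := by nlinarith
  have h7 := nonneg_of_mul_nonneg_right h6 h0
  nlinarith [mul_pos (sub_pos.2 hlt) h0]

/-! ### The critical angular momentum -/

theorem critL2_pos : 0 < critL2 := by rw [critL2]; positivity

theorem critL2_sq : critL2 ^ 2 = (16 / 27 : ℝ) ^ 3 := by
  rw [critL2, ← Real.rpow_natCast, ← Real.rpow_mul (by norm_num)]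
  norm_num

/-- Raising one side to the third power and the other to the second removes both real powers: with
a³ = L² one has (a²)³ = (L²)², and (16/27)³ = `critL2`². -/
theorem rpow_sq_lt_iff {L : ℝ} : (|L| ^ (2 / 3 : ℝ)) ^ 2 < 16 / 27 ↔ L ^ 2 < critL2 := by
  rw [← pow_lt_pow_iff_left₀ (sq_nonneg _) (by norm_num : (0 : ℝ) ≤ 16 / 27) three_ne_zero, ← critL2_sq,
    ← pow_lt_pow_iff_left₀ (sq_nonneg L) critL2_pos.le two_ne_zero, ← rpow_two_thirds_cube L]
  rw [← pow_mul, ← pow_mul]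

theorem rpow_sq_gt_iff {L : ℝ} : 16 / 27 < (|L| ^ (2 / 3 : ℝ)) ^ 2 ↔ critL2 < L ^ 2 := by
  rw [← pow_lt_pow_iff_left₀ (by norm_num : (0 : ℝ) ≤ 16 / 27) (sq_nonneg _) three_ne_zero, ← critL2_sq,
    ← pow_lt_pow_iff_left₀ critL2_pos.le (sq_nonneg L) two_ne_zero, ← rpow_two_thirds_cube L]
  rw [← pow_mul, ← pow_mul]

/-- At `hTop L`, with a = |L|^(2/3), the comparison is between 1 - (15/8)a² and (3/2)a² - 1, which
agree exactly for a² = 16/27. Monotonicity in h carries it to lower energies. -/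
theorem Ceta_lt_C1xi_of_crit_lt {L h : ℝ} (hL : L ≠ 0) (hc : critL2 < L ^ 2) (hh : h ≤ hTop L) :
    Ceta L h < C1xi L h := by
  have h1 := rpow_sq_gt_iff.2 hc
  have h2 : Ceta L (hTop L) < C1xi L (hTop L) := by
    rw [Ceta_hTop hL, C1xi_hTop hL]; linarith
  rcases hh.eq_or_lt with rfl | hlt
  · exact h2
  · linarith [C1xi_strictAnti hL hlt le_rfl, Ceta_strictMono hL hlt]

theorem C1xi_eq_Ceta_of_crit {L : ℝ} (hL : L ≠ 0) (hc : L ^ 2 = critL2) :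
    C1xi L (hTop L) = -1 / 9 ∧ Ceta L (hTop L) = -1 / 9 := by
  have h1 := mt rpow_sq_gt_iff.1 (by rw [hc]; exact lt_irrefl _)
  have h2 := mt rpow_sq_lt_iff.1 (by rw [hc]; exact lt_irrefl _)
  rw [Ceta_hTop hL, C1xi_hTop hL]
  constructor <;> linarith

theorem Ceta_lt_C1xi_of_crit {L h : ℝ} (hL : L ≠ 0) (hc : L ^ 2 = critL2) (hh : h < hTop L) :
    Ceta L h < C1xi L h := by
  have := C1xi_eq_Ceta_of_crit hL hc
  linarith [C1xi_strictAnti hL hh le_rfl, Ceta_strictMono hL hh]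

/-! ### Circular orbits, parametrized by the distance `r` to the origin -/

/-- `r` is the distance to the origin of the points of a circular orbit with angular momentum `L`. -/
def IsCircRadius (L r : ℝ) : Prop := 0 < r ∧ r < 1 ∧ L ^ 2 = r * (1 - r ^ 4) ^ 2

/-- The energy of a circular orbit. -/
noncomputable def circEnergy (r : ℝ) : ℝ := -(1 + 3 * r ^ 4) / (2 * r)

/-- The separation constant of a circular orbit. -/
noncomputable def circSep (r : ℝ) : ℝ := -(r ^ 2) / 2 + 3 * r ^ 6 / 2

namespace IsCircRadius

variable {L r : ℝ}

theorem pos (hr : IsCircRadius L r) : 0 < r := hr.1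

theorem lt_one (hr : IsCircRadius L r) : r < 1 := hr.2.1

theorem eq (hr : IsCircRadius L r) : L ^ 2 = r * (1 - r ^ 4) ^ 2 := hr.2.2

theorem one_sub_pos (hr : IsCircRadius L r) : 0 < 1 - r ^ 2 := by
  have := hr.pos; have := hr.lt_one; nlinarith

/-- On a circular orbit the vertical balance gives z = r³, so u = r + r³ and v = r - r³. This and
`double_v` place both at double roots of the cubics for the energy `circEnergy r`. -/
theorem double_u (hr : IsCircRadius L r) :
    2 * (r + r ^ 3) ^ 3 + 2 * circEnergy r * (r + r ^ 3) ^ 2 + L ^ 2 = 0 := by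
  have := hr.pos
  rw [hr.eq, circEnergy]; field_simp; ring

theorem v_pos (hr : IsCircRadius L r) : 0 < r - r ^ 3 := by
  have := mul_pos hr.pos hr.one_sub_pos; nlinarith

theorem double_v (hr : IsCircRadius L r) :
    2 * (r - r ^ 3) ^ 3 - 2 * circEnergy r * (r - r ^ 3) ^ 2 - L ^ 2 = 0 := by
  have := hr.pos
  rw [hr.eq, circEnergy]; field_simp; ring

theorem vDouble_eq (hr : IsCircRadius L r) : vDouble L (circEnergy r) = r - r ^ 3 :=
  _root_.vDouble_eq hr.v_pos hr.double_v

theorem circEnergy_le (hr : IsCircRadius L r) : circEnergy r ≤ hTop L :=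
  le_hTop_of_double (by have := hr.pos; positivity) hr.double_u

/-- Here (r + r³)³ - L² = r(1 + r²)²(3r² - 1), so 3r² = 1 separates the orbits that sit at `uLow`
from those that sit at `uHigh`. -/
theorem uLow_eq (hr : IsCircRadius L r) (h3 : 3 * r ^ 2 ≤ 1) :
    uLow L (circEnergy r) = r + r ^ 3 := by
  have hp := hr.pos
  refine _root_.uLow_eq (by positivity) ?_ hr.double_u
  rw [← pow_le_pow_iff_left₀ (by positivity) (by positivity) three_ne_zero, rpow_two_thirds_cube,
    hr.eq]
  have : 0 ≤ r * (1 + r ^ 2) ^ 2 * (1 - 3 * r ^ 2) :=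
    mul_nonneg (by positivity) (by linarith)
  nlinarith

theorem uHigh_eq (hr : IsCircRadius L r) (hL : L ≠ 0) (h3 : 1 ≤ 3 * r ^ 2) :
    uHigh L (circEnergy r) = r + r ^ 3 := by
  have hp := hr.pos
  refine _root_.uHigh_eq hL ?_ hr.double_u
  rw [← pow_le_pow_iff_left₀ (by positivity) (by positivity) three_ne_zero, rpow_two_thirds_cube,
    hr.eq]
  have : 0 ≤ r * (1 + r ^ 2) ^ 2 * (3 * r ^ 2 - 1) :=
    mul_nonneg (by positivity) (by linarith)
  nlinarith

theorem Ceta_eq (hr : IsCircRadius L r) : Ceta L (circEnergy r) = circSep r := by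
  have hp := hr.pos
  have hv := hr.one_sub_pos.ne'
  rw [Ceta, hr.vDouble_eq, hr.eq, circSep, show r - r ^ 3 = r * (1 - r ^ 2) by ring]
  field_simp
  ring

theorem C1xi_eq (hr : IsCircRadius L r) (h3 : 3 * r ^ 2 ≤ 1) :
    C1xi L (circEnergy r) = circSep r := by
  have hp := hr.pos
  rw [C1xi, hr.uLow_eq h3, hr.eq, circSep, show r + r ^ 3 = r * (1 + r ^ 2) by ring]
  field_simp
  ring

theorem C2xi_eq (hr : IsCircRadius L r) (hL : L ≠ 0) (h3 : 1 ≤ 3 * r ^ 2) :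
    C2xi L (circEnergy r) = circSep r := by
  have hp := hr.pos
  rw [C2xi, hr.uHigh_eq hL h3, hr.eq, circSep, show r + r ^ 3 = r * (1 + r ^ 2) by ring]
  field_simp
  ring

theorem circEnergy_lt (hr : IsCircRadius L r) (hL : L ≠ 0) (h3 : 3 * r ^ 2 ≠ 1) :
    circEnergy r < hTop L := by
  refine hr.circEnergy_le.lt_of_ne fun he => ?_
  have hp := hr.pos
  have hu : r + r ^ 3 = |L| ^ (2 / 3 : ℝ) := by
    rcases le_total (3 * r ^ 2) 1 with h | h
    · rw [← uLow_hTop hL, ← he, hr.uLow_eq h]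
    · rw [← uHigh_hTop hL, ← he, hr.uHigh_eq hL h]
  have h4 := rpow_two_thirds_cube L
  rw [← hu, hr.eq] at h4
  have h5 : r * (1 + r ^ 2) ^ 2 * (3 * r ^ 2 - 1) = 0 := by linear_combination h4
  have := (mul_eq_zero.1 h5).resolve_left (by positivity)
  exact h3 (by linarith)

end IsCircRadius

theorem circ_crit_value {r : ℝ} (hr : 0 < r) (h3 : 3 * r ^ 2 = 1) :
    r * (1 - r ^ 4) ^ 2 = critL2 := by
  have h2 : r ^ 2 = 1 / 3 := by linarith
  have h4 : r ^ 4 = 1 / 9 := by rw [show r ^ 4 = (r ^ 2) ^ 2 by ring, h2]; norm_num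
  rw [← pow_left_inj₀ (by rw [h4]; positivity) critL2_pos.le two_ne_zero, critL2_sq, mul_pow, h2, h4]
  norm_num

theorem exists_crit_radius : ∃ r : ℝ, 0 < r ∧ r < 1 ∧ 3 * r ^ 2 = 1 := by
  refine ⟨√(1 / 3), by positivity, ?_, ?_⟩
  · rw [Real.sqrt_lt' one_pos]; norm_num
  · rw [Real.sq_sqrt (by norm_num)]; norm_num

theorem exists_circRadius_of_crit {L : ℝ} (hc : L ^ 2 = critL2) :
    ∃ r, IsCircRadius L r ∧ 3 * r ^ 2 = 1 := by
  obtain ⟨r, h0, h1, h3⟩ := exists_crit_radius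
  exact ⟨r, ⟨h0, h1, by rw [circ_crit_value h0 h3, hc]⟩, h3⟩

/-- The function r(1 - r⁴)² vanishes at 0 and at 1 and equals `critL2` where 3r² = 1. The
intermediate value theorem gives a solution on either side. -/
theorem exists_circRadius_low {L : ℝ} (hL : L ≠ 0) (hc : L ^ 2 < critL2) :
    ∃ r, IsCircRadius L r ∧ 3 * r ^ 2 < 1 := by
  obtain ⟨s, h0, h1, h3⟩ := exists_crit_radius
  have hL2 : 0 < L ^ 2 := by positivity
  have hcont : Continuous fun r : ℝ => r * (1 - r ^ 4) ^ 2 := by fun_prop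
  obtain ⟨r, hr, he⟩ := intermediate_value_Ioo h0.le hcont.continuousOn
    ⟨by norm_num; exact hL2, by rw [circ_crit_value h0 h3]; exact hc⟩
  exact ⟨r, ⟨hr.1, hr.2.trans h1, he.symm⟩, by nlinarith [hr.1, hr.2]⟩

theorem exists_circRadius_high {L : ℝ} (hL : L ≠ 0) (hc : L ^ 2 < critL2) :
    ∃ r, IsCircRadius L r ∧ 1 < 3 * r ^ 2 := by
  obtain ⟨s, h0, h1, h3⟩ := exists_crit_radius
  have hL2 : 0 < L ^ 2 := by positivity
  have hcont : Continuous fun r : ℝ => r * (1 - r ^ 4) ^ 2 := by fun_prop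
  obtain ⟨r, hr, he⟩ := intermediate_value_Ioo' h1.le hcont.continuousOn
    ⟨by norm_num; exact hL2, by rw [circ_crit_value h0 h3]; exact hc⟩
  exact ⟨r, ⟨h0.trans hr.1, hr.2, he.symm⟩, by nlinarith [hr.1, hr.2]⟩

/-! ### Roots of the cubics between the thresholds -/

/-- f is negative at 0, positive at `uLow` and negative at `uHigh`, which locates two roots; the
third follows from the sum of the roots, -2h. -/
theorem exists_xi_roots {L h c : ℝ} (hL : L ≠ 0) (hh : h ≤ hTop L) (h1 : C1xi L h < c)
    (h2 : c < C2xi L h) :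
    ∃ u₁ u₂ u₃, 0 < u₁ ∧ u₁ < uLow L h ∧ uLow L h < u₂ ∧ u₂ < uHigh L h ∧ uHigh L h < u₃ ∧
      ∀ u, xiCubic L h c u = (u - u₁) * (u - u₂) * (u - u₃) := by
  have hL2 : 0 < L ^ 2 := by positivity
  have hm := (uLow_spec hL hh).1
  have hM := uHigh_pos hL hh
  have hfm : 0 < xiCubic L h c (uLow L h) := by
    rw [xiCubic_low hL hh]; exact mul_pos (by linarith) hm
  have hfM : xiCubic L h c (uHigh L h) < 0 := by
    rw [xiCubic_high hL hh]; exact mul_neg_of_neg_of_pos (by linarith) hM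
  have hf0 : xiCubic L h c 0 < 0 := by simp only [xiCubic]; linarith
  have hcont : Continuous (xiCubic L h c) := by unfold xiCubic; fun_prop
  obtain ⟨u₁, hu₁, he₁⟩ := intermediate_value_Ioo hm.le hcont.continuousOn
    ⟨hf0, hfm⟩
  obtain ⟨u₂, hu₂, he₂⟩ := intermediate_value_Ioo' (uLow_le_uHigh hL hh) hcont.continuousOn
    (show (0 : ℝ) ∈ _ from ⟨hfM, hfm⟩)
  have hfac : ∀ u, xiCubic L h c u = (u - u₁) * (u - u₂) * (u - (-2 * h - u₁ - u₂)) := by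
    intro u
    have hne : u₂ - u₁ ≠ 0 := by linarith [hu₁.2, hu₂.1]
    rw [xiCubic] at he₁ he₂ ⊢
    refine mul_left_cancel₀ hne ?_
    linear_combination (u₂ - u) * he₁ + (u - u₁) * he₂
  refine ⟨u₁, u₂, -2 * h - u₁ - u₂, hu₁.1, hu₁.2, hu₂.1, hu₂.2, ?_, hfac⟩
  rw [hfac] at hfM
  by_contra! hcon
  exact absurd hfM (not_lt.2 (mul_nonneg (mul_nonneg (by linarith [hu₁.2, hu₂.1, hu₂.2])
    (by linarith [hu₂.2])) (by linarith)))

theorem exists_eta_roots {L c : ℝ} (hL : L ≠ 0) (h : ℝ) (hc : c < Ceta L h) :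
    ∃ v₁ v₂ v₃, v₁ < 0 ∧ 0 < v₂ ∧ v₂ < vDouble L h ∧ vDouble L h < v₃ ∧
      ∀ v, etaCubic L h c v = -((v - v₁) * (v - v₂) * (v - v₃)) := by
  have hL2 : 0 < L ^ 2 := by positivity
  have hm := (vDouble_spec hL h).1
  have hgm : 0 < etaCubic L h c (vDouble L h) := by
    rw [etaCubic_vDouble hL]; exact mul_pos (by linarith) hm
  -- With D = 2(`Ceta` - c), at the point `vDouble` + 1 + D the square (1 + D)² exceeds D, so the
  -- cubic term outweighs Dv and g is negative.
  set M := vDouble L h + (1 + 2 * (Ceta L h - c)) with hMdef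
  have hM : vDouble L h < M := by linarith
  have hM0 := hm.trans hM
  have hgM : etaCubic L h c M < 0 := by
    rw [etaCubic_eq hL]
    have e1 : M - vDouble L h = 1 + 2 * (Ceta L h - c) := by rw [hMdef]; ring
    rw [e1]
    have h1 : 0 < L ^ 2 / vDouble L h ^ 2 := by positivity
    have h2 : 2 * (Ceta L h - c) < (1 + 2 * (Ceta L h - c)) ^ 2 := by nlinarith
    have h3 : 2 * (Ceta L h - c) * M < (1 + 2 * (Ceta L h - c)) ^ 2 * M := by gcongr
    have h4 : 0 ≤ (1 + 2 * (Ceta L h - c)) ^ 2 * (L ^ 2 / vDouble L h ^ 2) := by positivity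
    linarith
  have hg0 : etaCubic L h c 0 < 0 := by simp only [etaCubic]; linarith
  have hcont : Continuous (etaCubic L h c) := by unfold etaCubic; fun_prop
  obtain ⟨v₂, hv₂, he₂⟩ := intermediate_value_Ioo hm.le hcont.continuousOn
    ⟨hg0, hgm⟩
  obtain ⟨v₃, hv₃, he₃⟩ := intermediate_value_Ioo' hM.le hcont.continuousOn
    (show (0 : ℝ) ∈ _ from ⟨hgM, hgm⟩)
  have hfac : ∀ v, etaCubic L h c v = -((v - (2 * h - v₂ - v₃)) * (v - v₂) * (v - v₃)) := by
    intro v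
    have hne : v₃ - v₂ ≠ 0 := by linarith [hv₂.2, hv₃.1]
    rw [etaCubic] at he₂ he₃ ⊢
    refine mul_left_cancel₀ hne ?_
    linear_combination (v₃ - v) * he₂ + (v - v₂) * he₃
  refine ⟨2 * h - v₂ - v₃, v₂, v₃, ?_, hv₂.1, hv₂.2, hv₃.1, hfac⟩
  have h0 := hfac 0
  simp only [etaCubic] at h0
  have hp : 0 < v₂ * v₃ := mul_pos hv₂.1 (hm.trans hv₃.1)
  by_contra! hcon
  nlinarith [mul_nonneg hcon hp.le]

/-! ### Global orbits with given constants. -/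

/-- A solution for all times with constants `L`, `h`, `c`. -/
structure IsGlobalWith (L h c : ℝ) (q v : ℝ → E3) : Prop where
  sol : IsStarkSolution univ q v
  angMom_eq : ∀ t, angMom (q t) (v t) = L
  energy_eq : ∀ t, energy (q t) (v t) = h
  lenz_eq : ∀ t, lenz (q t) (v t) = c

theorem IsOrbitWith.global {L h c : ℝ} (hL : L ≠ 0) {I : Set ℝ} {q v : ℝ → E3}
    (ho : IsOrbitWith L h c I q v) : I = univ ∧ IsGlobalWith L h c q v := by
  obtain ⟨t₀, ht₀⟩ := ho.1.nonempty
  have h1 := ho.1.eq_univ ht₀ (by rw [(ho.2 t₀ ht₀).1]; exact hL)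
  subst h1
  refine ⟨rfl, ho.1.toIsStarkSolution, fun t => (ho.2 t trivial).1, fun t => (ho.2 t trivial).2.1,
    fun t => ?_⟩
  rw [← sepConst_eq_lenz (by rw [(ho.2 t trivial).1]; exact hL)]
  exact (ho.2 t trivial).2.2

theorem contDiff_xiCubic' (h c : ℝ) : ContDiff ℝ 1 (xiCubic' h c) := by
  unfold xiCubic'; fun_prop

namespace IsGlobalWith

variable {L h c : ℝ} {q v : ℝ → E3}

theorem of_zero {q v : ℝ → E3} (hs : IsStarkSolution univ q v) :
    IsGlobalWith (angMom (q 0) (v 0)) (energy (q 0) (v 0)) (lenz (q 0) (v 0)) q v :=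
  ⟨hs, fun _ => hs.angMom_eq trivial trivial, fun _ => hs.energy_eq trivial trivial,
    fun _ => hs.lenz_eq trivial trivial⟩

theorem angMom_ne (hL : L ≠ 0) (hg : IsGlobalWith L h c q v) (t : ℝ) : angMom (q t) (v t) ≠ 0 := by
  rw [hg.angMom_eq]; exact hL

theorem isOrbitWith (hL : L ≠ 0) (hg : IsGlobalWith L h c q v) : IsOrbitWith L h c univ q v :=
  ⟨hg.sol.isStarkOrbit, fun t _ => ⟨hg.angMom_eq t, hg.energy_eq t, by
    rw [sepConst_eq_lenz (hg.angMom_ne hL t), hg.lenz_eq]⟩⟩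

theorem u_pos (hL : L ≠ 0) (hg : IsGlobalWith L h c q v) (t : ℝ) : 0 < uCoord (q t) :=
  uCoord_pos (hg.angMom_ne hL t)

theorem v_pos (hL : L ≠ 0) (hg : IsGlobalWith L h c q v) (t : ℝ) : 0 < vCoord (q t) :=
  vCoord_pos (hg.angMom_ne hL t)

theorem uMom_sq (hg : IsGlobalWith L h c q v) (t : ℝ) :
    uMom (q t) (v t) ^ 2 = xiCubic L h c (uCoord (q t)) := by
  rw [_root_.uMom_sq _ (hg.sol.ne_zero t trivial), hg.angMom_eq, hg.energy_eq, hg.lenz_eq]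

theorem vMom_sq (hg : IsGlobalWith L h c q v) (t : ℝ) :
    vMom (q t) (v t) ^ 2 = etaCubic L h c (vCoord (q t)) := by
  rw [_root_.vMom_sq _ (hg.sol.ne_zero t trivial), hg.angMom_eq, hg.energy_eq, hg.lenz_eq]

theorem xiCubic_nonneg (hg : IsGlobalWith L h c q v) (t : ℝ) :
    0 ≤ xiCubic L h c (uCoord (q t)) := by rw [← hg.uMom_sq]; positivity

theorem etaCubic_nonneg (hg : IsGlobalWith L h c q v) (t : ℝ) :
    0 ≤ etaCubic L h c (vCoord (q t)) := by rw [← hg.vMom_sq]; positivity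

theorem motion_u (hg : IsGlobalWith L h c q v) :
    IsMotion (fun t => 1 / (2 * ‖q t‖)) (xiCubic' h c) (fun t => uCoord (q t))
      (fun t => uMom (q t) (v t)) :=
  ⟨fun t => hg.sol.hasDerivAt_uCoord trivial, fun t => by
    have := hg.sol.hasDerivAt_uMom (t := t) trivial
    rwa [hg.energy_eq, hg.lenz_eq] at this⟩

theorem motion_v (hg : IsGlobalWith L h c q v) :
    IsMotion (fun t => 1 / (2 * ‖q t‖)) (etaCubic' h c) (fun t => vCoord (q t))
      (fun t => vMom (q t) (v t)) :=
  ⟨fun t => hg.sol.hasDerivAt_vCoord trivial, fun t => by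
    have := hg.sol.hasDerivAt_vMom (t := t) trivial
    rwa [hg.energy_eq, hg.lenz_eq] at this⟩

theorem continuous_q (hg : IsGlobalWith L h c q v) : Continuous q :=
  continuous_iff_continuousAt.2 fun t => (hg.sol.hasDerivAt_pos t trivial).continuousAt

theorem continuous_v (hg : IsGlobalWith L h c q v) : Continuous v :=
  continuous_iff_continuousAt.2 fun t => (hg.sol.hasDerivAt_vel t trivial).continuousAt

theorem continuous_rate (hg : IsGlobalWith L h c q v) : Continuous fun t => 1 / (2 * ‖q t‖) :=
  continuous_const.div (continuous_const.mul hg.continuous_q.norm) fun t => by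
    have := hg.sol.norm_pos (t := t) trivial; positivity

theorem exists_le_norm (hL : L ≠ 0) (hg : IsGlobalWith L h c q v) : ∃ δ > 0, ∀ t, δ ≤ ‖q t‖ := by
  obtain ⟨δ, hδ, H⟩ := _root_.exists_le_norm hL h
  exact ⟨δ, hδ, fun t => H _ _ (hg.sol.ne_zero t trivial) (hg.angMom_eq t) (hg.energy_eq t)⟩

/-- The term -v³ makes g negative beyond this bound. Thus η is bounded along every orbit, and only ξ
can escape. -/
theorem exists_vCoord_le (hL : L ≠ 0) (hg : IsGlobalWith L h c q v) : ∃ B, ∀ t, vCoord (q t) ≤ B := by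
  refine ⟨2 * |h| + 2 * |c - 1| + 1, fun t => ?_⟩
  have h0 := hg.v_pos hL t
  have h1 := hg.etaCubic_nonneg t
  set x := vCoord (q t)
  by_contra! hcon
  have hh := abs_nonneg h
  have hc := abs_nonneg (c - 1)
  have h2 : 1 < x := by linarith
  have h3 : h * x ^ 2 ≤ |h| * x ^ 2 := by gcongr; exact le_abs_self h
  have h4 : -(c - 1) * x ≤ |c - 1| * x ^ 2 := by
    calc -(c - 1) * x ≤ |c - 1| * x := by gcongr; exact neg_le_abs _
      _ ≤ |c - 1| * x ^ 2 := by gcongr; nlinarith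
  have h5 : (2 * |h| + 2 * |c - 1| + 1) * x ^ 2 < x * x ^ 2 := by gcongr
  have h6 : 0 < L ^ 2 := by positivity
  rw [etaCubic] at h1
  nlinarith [sq_nonneg x]

theorem norm_eq (q : E3) : ‖q‖ = (uCoord q + vCoord q) / 2 := by
  simp only [uCoord, vCoord]; ring

theorem isBounded_iff (hL : L ≠ 0) (hg : IsGlobalWith L h c q v) :
    IsBoundedOrbit univ q ↔ BddAbove (range fun t => uCoord (q t)) := by
  rw [IsBoundedOrbit, isBounded_iff_forall_norm_le]
  constructor
  · rintro ⟨B, hB⟩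
    refine ⟨2 * B, ?_⟩
    rintro _ ⟨t, rfl⟩
    have h1 := hB _ ⟨t, trivial, rfl⟩
    have h2 := vCoord_nonneg (q t)
    rw [norm_eq] at h1
    simp only; linarith
  · rintro ⟨B, hB⟩
    obtain ⟨B', hB'⟩ := hg.exists_vCoord_le hL
    refine ⟨(B + B') / 2, ?_⟩
    rintro _ ⟨t, -, rfl⟩
    have h1 : uCoord (q t) ≤ B := hB ⟨t, rfl⟩
    have h2 := hB' t
    rw [norm_eq]; linarith

theorem exists_rate_ge (hg : IsGlobalWith L h c q v) (hb : IsBoundedOrbit univ q) :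
    ∃ κ₀ > 0, ∀ t, κ₀ ≤ 1 / (2 * ‖q t‖) := by
  obtain ⟨B, hB⟩ := isBounded_iff_forall_norm_le.1 hb
  have hB' : ∀ t, ‖q t‖ ≤ B := fun t => hB _ ⟨t, trivial, rfl⟩
  have h0 := hg.sol.norm_pos (t := 0) trivial
  have hB0 : 0 < B := h0.trans_le (hB' 0)
  refine ⟨1 / (2 * B), by positivity, fun t => ?_⟩
  have := hg.sol.norm_pos (t := t) trivial
  have := hB' t
  gcongr

theorem exists_tau (hg : IsGlobalWith L h c q v) :
    ∃ τ : ℝ → ℝ, ∀ t, HasDerivAt τ (1 / (2 * ‖q t‖)) t :=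
  ⟨fun t => ∫ s in (0 : ℝ)..t, 1 / (2 * ‖q s‖), fun t =>
    (hg.continuous_rate.integral_hasStrictDerivAt 0 t).hasDerivAt⟩

/-- The time change `t ↦ τ` of a bounded orbit. -/
theorem exists_tau_homeomorph (hg : IsGlobalWith L h c q v) (hb : IsBoundedOrbit univ q) :
    ∃ τ : ℝ ≃ₜ ℝ, StrictMono τ ∧ ∀ t, HasDerivAt τ (1 / (2 * ‖q t‖)) t := by
  obtain ⟨κ₀, hκ₀, hκ⟩ := hg.exists_rate_ge hb
  obtain ⟨T, -, hm, hT, -⟩ := exists_homeomorph_hasDerivAt hg.continuous_rate hκ₀ hκ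
  exact ⟨T, hm, hT⟩

/-! ### Necessary conditions for boundedness -/

/-- In `etaCubic_eq` the cubic part is nonpositive for v > 0, so g ≥ 0 at one point forces c ≤
`Ceta`; equality pins v to the double root, which is `v_eq_of_eq`. -/
theorem le_Ceta (hL : L ≠ 0) (hg : IsGlobalWith L h c q v) : c ≤ Ceta L h := by
  have h1 := hg.etaCubic_nonneg 0
  rw [etaCubic_eq hL] at h1
  have h2 := hg.v_pos hL 0
  have h3 : 0 < L ^ 2 / vDouble L h ^ 2 := by have := (vDouble_spec hL h).1; positivity
  have h4 : 0 ≤ (vCoord (q 0) - vDouble L h) ^ 2 * (vCoord (q 0) + L ^ 2 / vDouble L h ^ 2) := by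
    positivity
  by_contra! hcon
  nlinarith

theorem v_eq_of_eq (hL : L ≠ 0) (hg : IsGlobalWith L h c q v) (hc : Ceta L h ≤ c) (t : ℝ) :
    vCoord (q t) = vDouble L h := by
  have h1 := hg.etaCubic_nonneg t
  rw [etaCubic_eq hL] at h1
  have h2 := hg.v_pos hL t
  have h3 : 0 < L ^ 2 / vDouble L h ^ 2 := by have := (vDouble_spec hL h).1; positivity
  have h4 : (vCoord (q t) - vDouble L h) ^ 2 * (vCoord (q t) + L ^ 2 / vDouble L h ^ 2) ≤ 0 := by
    nlinarith
  have h5 : (vCoord (q t) - vDouble L h) ^ 2 ≤ 0 := by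
    by_contra! hcon
    have := mul_pos hcon (add_pos h2 h3)
    linarith
  linarith [pow_eq_zero_iff two_ne_zero |>.1 (le_antisymm h5 (sq_nonneg _))]

/-- Where f ≥ 0, the force f' is bounded below by a quantity free of c. For h ≤ `hTop L` its
numerator vanishes at `uLow` and `uHigh`. -/
theorem mul_xiCubic' (L h c u : ℝ) :
    u * xiCubic' h c u = xiCubic L h c u + (2 * u ^ 3 + 2 * h * u ^ 2 + L ^ 2) := by
  simp only [xiCubic', xiCubic]; ring

theorem le_hTop (hL : L ≠ 0) (hg : IsGlobalWith L h c q v) (hb : IsBoundedOrbit univ q) :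
    h ≤ hTop L := by
  by_contra! hcon
  obtain ⟨κ₀, hκ₀, hκ⟩ := hg.exists_rate_ge hb
  have hu0 := hg.u_pos hL 0
  -- The force is at least 2(h - `hTop L`)u everywhere on the orbit. Half of the initial value
  -- serves as y₀: the orbit starts beyond it, and beyond it the force is at least d.
  refine hg.motion_u.not_bddAbove_of_force hκ₀ hκ (y₀ := uCoord (q 0) / 2) (t₀ := 0)
    (d := uCoord (q 0) * (h - hTop L)) (mul_pos hu0 (by linarith)) (fun t ht => ?_) (by linarith)
    ((hg.isBounded_iff hL).1 hb)
  have h1 := mul_xiCubic' L h c (uCoord (q t))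
  have h2 := hg.xiCubic_nonneg t
  have h3 := hg.u_pos hL t
  have h4 : 2 * (h - hTop L) * uCoord (q t) ^ 2 ≤
      2 * uCoord (q t) ^ 3 + 2 * h * uCoord (q t) ^ 2 + L ^ 2 := by
    have ha := rpow_two_thirds_pos hL
    rw [hTop, ← rpow_two_thirds_cube L]
    set a := |L| ^ (2 / 3 : ℝ)
    have : 0 ≤ (uCoord (q t) - a) ^ 2 * (2 * uCoord (q t) + a) := by positivity
    nlinarith
  have h5 : 2 * (h - hTop L) * uCoord (q t) ≤ xiCubic' h c (uCoord (q t)) := by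
    refine le_of_mul_le_mul_left ?_ h3
    rw [h1]; nlinarith
  have : uCoord (q 0) * (h - hTop L) ≤ 2 * (h - hTop L) * uCoord (q t) := by
    nlinarith [sub_pos.2 hcon]
  linarith

/-- Beyond M = `uHigh` the force is at least 2(u - M)²: since h ≥ -(3/2)M, the numerator 2u³ + 2hu²
+ L² is at least 2(u - M)²u. An orbit that passes M is therefore driven out, forwards or backwards
in time. -/
theorem u_le_uHigh (hL : L ≠ 0) (hg : IsGlobalWith L h c q v) (hb : IsBoundedOrbit univ q) (t : ℝ) :
    uCoord (q t) ≤ uHigh L h := by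
  have hh := hg.le_hTop hL hb
  obtain ⟨hMa, hMe⟩ := uHigh_spec hL hh
  have hM := uHigh_pos hL hh
  by_contra! hcon
  obtain ⟨κ₀, hκ₀, hκ⟩ := hg.exists_rate_ge hb
  set M := uHigh L h
  set y₀ := (M + uCoord (q t)) / 2 with hy₀
  refine hg.motion_u.not_bddAbove_of_force hκ₀ hκ (y₀ := y₀) (t₀ := t)
    (d := 2 * (y₀ - M) ^ 2) (by
      have : 0 < y₀ - M := by rw [hy₀]; linarith
      positivity) (fun s hs => ?_) (by simp only [hy₀]; linarith)
    ((hg.isBounded_iff hL).1 hb)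
  have h1 := mul_xiCubic' L h c (uCoord (q s))
  have h2 := hg.xiCubic_nonneg s
  have h3 := hg.u_pos hL s
  have h0 : M < y₀ := by rw [hy₀]; linarith
  change y₀ < uCoord (q s) at hs
  set u := uCoord (q s)
  have hML : L ^ 2 ≤ M ^ 3 := by
    rw [← rpow_two_thirds_cube L]
    have := rpow_two_thirds_pos hL
    gcongr
  have hhM : -(3 / 2) * M ≤ h := by
    by_contra! hlt
    have := mul_lt_mul_of_pos_right hlt (pow_pos hM 2)
    nlinarith
  have h4 : 2 * u ^ 3 + 2 * h * u ^ 2 + L ^ 2 =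
      (u - M) * (2 * (u ^ 2 + u * M + M ^ 2) + 2 * h * (u + M)) := by linear_combination hMe
  have h5 : 2 * (u - M) * u ≤ 2 * (u ^ 2 + u * M + M ^ 2) + 2 * h * (u + M) := by
    have := mul_le_mul_of_nonneg_right hhM (add_pos h3 hM).le
    nlinarith
  have h6 : (u - M) * (2 * (u - M) * u) ≤ 2 * u ^ 3 + 2 * h * u ^ 2 + L ^ 2 := by
    rw [h4]; exact mul_le_mul_of_nonneg_left h5 (by linarith)
  have h7 : 2 * (u - M) ^ 2 ≤ xiCubic' h c u := by
    refine le_of_mul_le_mul_left ?_ h3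
    rw [h1]; nlinarith
  have h8 : (y₀ - M) ^ 2 ≤ (u - M) ^ 2 := by
    have : 0 ≤ y₀ - M := by linarith
    gcongr
  linarith

/-- For u ≤ `uHigh` ≤ L² / `uLow`² the first summand of `xiCubic_eq_low` is nonpositive, so f ≥ 0
needs c ≥ `C1xi`. -/
theorem C1xi_le (hL : L ≠ 0) (hg : IsGlobalWith L h c q v) (hh : h ≤ hTop L) {t : ℝ}
    (hu : uCoord (q t) ≤ uHigh L h) : C1xi L h ≤ c := by
  have h1 := hg.xiCubic_nonneg t
  rw [xiCubic_eq_low hL hh] at h1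
  have h2 := hg.u_pos hL t
  have h3 := uHigh_le_third hL hh
  have h4 : (uCoord (q t) - uLow L h) ^ 2 * (uCoord (q t) - L ^ 2 / uLow L h ^ 2) ≤ 0 :=
    mul_nonpos_of_nonneg_of_nonpos (sq_nonneg _) (by linarith)
  by_contra! hcon
  nlinarith

theorem u_eq_of_C1xi (hL : L ≠ 0) (hg : IsGlobalWith L h c q v) (hh : h ≤ hTop L)
    (hc : c ≤ C1xi L h) {t : ℝ} (hu : uCoord (q t) ≤ uHigh L h) : uCoord (q t) = uLow L h := by
  have h1 := hg.xiCubic_nonneg t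
  rw [xiCubic_eq_low hL hh] at h1
  have h2 := hg.u_pos hL t
  have h3 := uHigh_le_third hL hh
  have h4 : 2 * (c - C1xi L h) * uCoord (q t) ≤ 0 :=
    mul_nonpos_of_nonpos_of_nonneg (by linarith) h2.le
  have h5 : 0 ≤ (uCoord (q t) - uLow L h) ^ 2 * (uCoord (q t) - L ^ 2 / uLow L h ^ 2) := by linarith
  -- At `uHigh` itself f would be negative, since c ≤ `C1xi` < `C2xi`, unless h = `hTop L`, where
  -- `uLow` and `uHigh` coincide.
  rcases hu.eq_or_lt with he | hlt
  · rcases hh.eq_or_lt with rfl | hh'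
    · rw [he, uHigh_hTop hL, uLow_hTop hL]
    · exfalso
      have h6 := uLow_lt_uHigh hL hh'
      have h7 := xiCubic_high hL hh c
      rw [xiCubic_eq_low hL hh, ← he] at h7
      have h8 := C1xi_lt_C2xi hL hh'
      nlinarith
  · by_contra hne
    have h6 : 0 < (uCoord (q t) - uLow L h) ^ 2 := by
      have := sub_ne_zero.2 hne; positivity
    nlinarith

/-- For c > `C2xi` write f = (u - M)²(u - T) + δu with M = `uHigh`. For u ≤ T the force is at least
δ. On [T, M] it may be negative, but not below δ - 2M², while p² = f ≥ δT; hence l = M² / (δT) makes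
2 l p² outweigh the negative part in the virial criterion. -/
theorem le_C2xi (hL : L ≠ 0) (hg : IsGlobalWith L h c q v) (hb : IsBoundedOrbit univ q) :
    c ≤ C2xi L h := by
  have hh := hg.le_hTop hL hb
  have hM := uHigh_pos hL hh
  by_contra! hcon
  obtain ⟨κ₀, hκ₀, hκ⟩ := hg.exists_rate_ge hb
  set δ := 2 * (c - C2xi L h) with hδ
  have hδ0 : 0 < δ := by rw [hδ]; linarith
  set T := L ^ 2 / uHigh L h ^ 2 with hT
  have hT0 : 0 < T := by positivity
  have hTM : T ≤ uHigh L h := (third_le_uLow hL hh).trans (uLow_le_uHigh hL hh)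
  refine hg.motion_u.not_bddAbove_of_virial hκ₀ hκ hδ0 (l := uHigh L h ^ 2 / (δ * T))
    (by positivity) (fun t => (hg.u_pos hL t).le) (fun t => ?_) ((hg.isBounded_iff hL).1 hb)
  rw [hg.uMom_sq]
  have h1 := hg.u_le_uHigh hL hb t
  have h2 := hg.u_pos hL t
  have h3 := hg.xiCubic_nonneg t
  have h4 := xiCubic_eq_high hL hh c (uCoord (q t))
  have h5 : xiCubic' h c (uCoord (q t)) = 2 * (uCoord (q t) - uHigh L h) * (uCoord (q t) - T) +
      (uCoord (q t) - uHigh L h) ^ 2 + δ := by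
    -- Central difference: for a cubic, (f(x + 1) - f(x - 1)) / 2 is f'(x) plus the leading
    -- coefficient, so two forms of f give two forms of f' without differentiation.
    have e1 := xiCubic_eq_high hL hh c (uCoord (q t) + 1)
    have e2 := xiCubic_eq_high hL hh c (uCoord (q t) - 1)
    rw [xiCubic] at e1 e2
    rw [xiCubic', hδ]
    linear_combination (e1 - e2) / 2
  rw [← hδ, ← hT] at h4
  set u := uCoord (q t)
  set M := uHigh L h
  rcases le_total u T with huT | huT
  · have h6 : 0 ≤ (u - M) * (u - T) := mul_nonneg_of_nonpos_of_nonpos (by linarith) (by linarith)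
    have h7 : 0 ≤ 2 * (M ^ 2 / (δ * T)) * xiCubic L h c u := by positivity
    nlinarith [sq_nonneg (u - M)]
  · have h6 : δ * T ≤ xiCubic L h c u := by
      rw [h4]
      have : 0 ≤ (u - M) ^ 2 * (u - T) := mul_nonneg (sq_nonneg _) (by linarith)
      nlinarith
    have h7 : M ^ 2 ≤ M ^ 2 / (δ * T) * xiCubic L h c u := by
      rw [div_mul_eq_mul_div, le_div_iff₀ (by positivity)]
      gcongr
    have h8 : -(M ^ 2) ≤ (u - M) * (u - T) := by
      have : (M - u) * (u - T) ≤ M * M := by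
        apply mul_le_mul <;> linarith
      nlinarith
    nlinarith [sq_nonneg (u - M)]

/-- For c < `C2xi` the value f(`uHigh`) is negative, and the continuous function u cannot cross this
barrier. -/
theorem u_lt_uHigh (hL : L ≠ 0) (hg : IsGlobalWith L h c q v) (hh : h ≤ hTop L)
    (hc : c < C2xi L h) {t₀ : ℝ} (hu : uCoord (q t₀) ≤ uHigh L h) (t : ℝ) :
    uCoord (q t) < uHigh L h := by
  have hM := uHigh_pos hL hh
  have hne : ∀ s, uCoord (q s) ≠ uHigh L h := fun s hs => by
    have h1 := hg.xiCubic_nonneg s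
    rw [hs, xiCubic_high hL hh] at h1
    nlinarith
  by_contra! hcon
  obtain ⟨s, hs⟩ := mem_range_of_exists_le_of_exists_ge hg.motion_u.continuous_pos
    ⟨t₀, hu⟩ ⟨t, hcon⟩
  exact hne s hs

theorem bounded_of_u_le (hL : L ≠ 0) (hg : IsGlobalWith L h c q v) {B : ℝ}
    (hB : ∀ t, uCoord (q t) ≤ B) : IsBoundedOrbit univ q :=
  (hg.isBounded_iff hL).2 ⟨B, by rintro _ ⟨t, rfl⟩; exact hB t⟩

/-! ### Periodicity -/

/-- Passes from the square G of a coordinate to the coordinate F; the two values 0 < a < b keep the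
root nonconstant. Boundedness of the orbit makes τ run through the whole line. -/
theorem isTauPeriodic_of (hg : IsGlobalWith L h c q v) (hb : IsBoundedOrbit univ q) {F G : E3 → ℝ}
    (hF : ∀ q, F q = √(G q)) (hG : ∀ τ : ℝ → ℝ, (∀ t, HasDerivAt τ (1 / (2 * ‖q t‖)) t) →
      ∃ (N : ℝ → ℝ) (P a b : ℝ), 0 < P ∧ Function.Periodic N P ∧ (∃ s, N s = a) ∧ (∃ s, N s = b) ∧
        0 < a ∧ a < b ∧ ∀ t, G (q t) = N (τ t)) : IsTauPeriodic F univ q := by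
  obtain ⟨τ, -, hτ⟩ := hg.exists_tau_homeomorph hb
  obtain ⟨N, P, a, b, hP, hN, ⟨s, hs⟩, ⟨s', hs'⟩, ha, hab, hGN⟩ := hG τ hτ
  refine ⟨τ, fun s => √(N s), P, fun t _ => hτ t, by rw [image_univ]; exact τ.surjective.range_eq,
    hP, fun s => by simp only [hN s], ⟨s, s', ?_⟩, fun t _ => by rw [hF, hGN]⟩
  simp only [hs, hs']
  exact (Real.sqrt_lt_sqrt ha.le hab).ne

theorem isTauPeriodic_eta (hL : L ≠ 0) (hg : IsGlobalWith L h c q v) (hb : IsBoundedOrbit univ q)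
    (hc : c < Ceta L h) : IsTauPeriodic eta univ q := by
  obtain ⟨v₁, v₂, v₃, h1, h2, h23, h34, hfac⟩ := exists_eta_roots hL h hc
  refine hg.isTauPeriodic_of hb (G := vCoord) (fun q => rfl) fun τ hτ => ?_
  have h0 := hg.v_pos hL 0
  have hn := hg.etaCubic_nonneg 0
  have hsq := hg.vMom_sq 0
  have hu : vCoord (q 0) ∈ Icc v₂ v₃ := by
    rw [hfac] at hn
    have h5 : (vCoord (q 0) - v₂) * (vCoord (q 0) - v₃) ≤ 0 := by
      by_contra! hcon
      have : 0 < vCoord (q 0) - v₁ := by linarith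
      nlinarith [mul_pos this hcon]
    constructor
    · by_contra! hlt
      nlinarith
    · by_contra! hlt
      nlinarith
  obtain ⟨N, P, hP, hN, hs, hs', hall⟩ := hg.motion_v.exists_periodic hg.continuous_rate hτ
    (a := v₂) (b := v₃) (α := -v₁) (β := 1) (h23.trans h34) (fun x hx => by linarith [hx.1])
    (fun x => by
      have e1 := hfac (x + 1)
      have e2 := hfac (x - 1)
      rw [etaCubic] at e1 e2
      rw [etaCubic']
      linear_combination (e1 - e2) / 2) hu (by rw [hsq, hfac]; ring)
  exact ⟨N, P, v₂, v₃, hP, hN, hs, hs', h2, h23.trans h34, hall⟩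

theorem isTauPeriodic_xi (hL : L ≠ 0) (hg : IsGlobalWith L h c q v) (hb : IsBoundedOrbit univ q)
    (hc1 : C1xi L h < c) (hc2 : c < C2xi L h) : IsTauPeriodic xi univ q := by
  have hh := hg.le_hTop hL hb
  obtain ⟨u₁, u₂, u₃, h1, h12, h23, h34, h45, hfac⟩ := exists_xi_roots hL hh hc1 hc2
  refine hg.isTauPeriodic_of hb (G := uCoord) (fun q => rfl) fun τ hτ => ?_
  have h0 := hg.u_le_uHigh hL hb 0
  have hn := hg.xiCubic_nonneg 0
  have hsq := hg.uMom_sq 0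
  have hu : uCoord (q 0) ∈ Icc u₁ u₂ := by
    rw [hfac] at hn
    have h5 : (uCoord (q 0) - u₁) * (uCoord (q 0) - u₂) ≤ 0 := by
      by_contra! hcon
      have : uCoord (q 0) - u₃ < 0 := by linarith
      nlinarith [mul_neg_of_pos_of_neg hcon this]
    constructor
    · by_contra! hlt
      nlinarith
    · by_contra! hlt
      nlinarith
  obtain ⟨N, P, hP, hN, hs, hs', hall⟩ := hg.motion_u.exists_periodic hg.continuous_rate hτ
    (a := u₁) (b := u₂) (α := u₃) (β := -1) (h12.trans h23) (fun x hx => by linarith [hx.2])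
    (fun x => by
      have e1 := hfac (x + 1)
      have e2 := hfac (x - 1)
      rw [xiCubic] at e1 e2
      rw [xiCubic']
      linear_combination (e1 - e2) / 2) hu (by rw [hsq, hfac]; ring)
  exact ⟨N, P, u₁, u₂, hP, hN, hs, hs', h1, h12.trans h23, hall⟩

end IsGlobalWith

theorem IsTauPeriodic.exists_ne {F : E3 → ℝ} {q : ℝ → E3} (h : IsTauPeriodic F univ q) :
    ∃ s t, F (q s) ≠ F (q t) := by
  obtain ⟨τ, N, P, -, hτ, -, -, ⟨a, b, hab⟩, hN⟩ := h
  obtain ⟨s, -, hs⟩ : a ∈ τ '' univ := by rw [hτ]; trivial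
  obtain ⟨t, -, ht⟩ : b ∈ τ '' univ := by rw [hτ]; trivial
  exact ⟨s, t, by rw [hN s trivial, hN t trivial, hs, ht]; exact hab⟩

/-! ### Existence -/

/-- Every reduced state on the two cubics is realized by a point of the half-plane y = 0, x > 0; its
velocity is solved for from p, w and L. -/
theorem exists_globalWith {L h c u p v w : ℝ} (hL : L ≠ 0) (hu : 0 < u) (hv : 0 < v)
    (hp : p ^ 2 = xiCubic L h c u) (hw : w ^ 2 = etaCubic L h c v) :
    ∃ q q' : ℝ → E3, IsGlobalWith L h c q q' ∧ uCoord (q 0) = u ∧ uMom (q 0) (q' 0) = p ∧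
      vCoord (q 0) = v ∧ vMom (q 0) (q' 0) = w := by
  have huv : 0 < u * v := mul_pos hu hv
  set ρ := √(u * v) with hρ
  have hρ0 : 0 < ρ := Real.sqrt_pos.2 huv
  have hρ2 : ρ ^ 2 = u * v := Real.sq_sqrt huv.le
  set b := (p - w) / (u + v) with hb
  set q₀ : E3 := !₂[ρ, 0, (u - v) / 2] with hq₀
  set v₀ : E3 := !₂[((p + w) / 2 - (u - v) / 2 * b) / ρ, L / ρ, b] with hv₀
  have hn : ‖q₀‖ = (u + v) / 2 := by
    have h1 := E3.norm_sq q₀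
    have h2 : ‖q₀‖ ^ 2 = ((u + v) / 2) ^ 2 := by
      rw [h1]; simp [hq₀, hρ2]; ring
    exact (pow_left_inj₀ (norm_nonneg _) (by positivity) two_ne_zero).1 h2
  have hang : angMom q₀ v₀ = L := by simp [angMom, hq₀, hv₀]; field_simp
  have hinner : inner ℝ q₀ v₀ = (p + w) / 2 := by
    rw [E3.inner_eq]; simp [hq₀, hv₀]; field_simp; ring
  have hU : uCoord q₀ = u := by rw [uCoord, hn]; simp [hq₀]; ring
  have hV : vCoord q₀ = v := by rw [vCoord, hn]; simp [hq₀]; ring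
  have hP : uMom q₀ v₀ = p := by
    rw [uMom, hinner, hn]; simp [hv₀, hb]; field_simp; ring
  have hW : vMom q₀ v₀ = w := by
    rw [vMom, hinner, hn]; simp [hv₀, hb]; field_simp; ring
  have hne := ne_zero_of_angMom (hang ▸ hL)
  have e1 := uMom_sq v₀ hne
  have e2 := vMom_sq v₀ hne
  rw [hP, hp, hang, hU, xiCubic, xiCubic] at e1
  rw [hW, hw, hang, hV, etaCubic, etaCubic] at e2
  -- The energy and c of this point need no computation. Both cubic relations hold with (h, c) and
  -- with the true values; the differences give two linear equations, which have only the zero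
  -- solution as u + v > 0.
  have h1 : u * ((h - energy q₀ v₀) * u + (c - lenz q₀ v₀)) = 0 := by linear_combination e1 / 2
  have h2 : v * ((h - energy q₀ v₀) * v - (c - lenz q₀ v₀)) = 0 := by linear_combination e2 / 2
  have h1' := (mul_eq_zero.1 h1).resolve_left hu.ne'
  have h2' := (mul_eq_zero.1 h2).resolve_left hv.ne'
  have h3 : (h - energy q₀ v₀) * (u + v) = 0 := by linear_combination h1' + h2'
  have he : h - energy q₀ v₀ = 0 := (mul_eq_zero.1 h3).resolve_right (by positivity)
  have hc : c - lenz q₀ v₀ = 0 := by rw [he] at h1'; linarith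
  obtain ⟨q, q', hs, hq, hq'⟩ := exists_isStarkSolution_univ (hang ▸ hL)
  have hg := IsGlobalWith.of_zero hs
  rw [hq, hq', hang, show energy q₀ v₀ = h by linarith, show lenz q₀ v₀ = c by linarith] at hg
  exact ⟨q, q', hg, by rw [hq, hU], by rw [hq, hq', hP], by rw [hq, hV], by rw [hq, hq', hW]⟩

/-- An orbit is started at u = `uLow`, v = `vDouble`, where f and g are nonnegative; the barrier at
`uHigh` confines it. -/
theorem existsBoundedOrbit_of_lt {L h c : ℝ} (hL : L ≠ 0) (hh : h ≤ hTop L) (h1 : C1xi L h ≤ c)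
    (h2 : c < C2xi L h) (h3 : c ≤ Ceta L h) : ExistsBoundedOrbit L h c := by
  have hm := (uLow_spec hL hh).1
  have hv := (vDouble_spec hL h).1
  obtain ⟨q, v, hg, hu, -⟩ := exists_globalWith (L := L) (h := h) (c := c)
    (p := √(xiCubic L h c (uLow L h))) (w := √(etaCubic L h c (vDouble L h))) hL hm hv
    (Real.sq_sqrt (by rw [xiCubic_low hL hh]; exact mul_nonneg (by linarith) hm.le))
    (Real.sq_sqrt (by rw [etaCubic_vDouble hL]; exact mul_nonneg (by linarith) hv.le))
  exact ⟨univ, q, v, hg.isOrbitWith hL, hg.bounded_of_u_le hL fun t =>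
    (hg.u_lt_uHigh hL hh h2 (t₀ := 0) (by rw [hu]; exact uLow_le_uHigh hL hh) t).le⟩

/-- The barrier degenerates for c = `C2xi`, but `uHigh` becomes an equilibrium of the ξ-motion, and
u may rest there while η moves. -/
theorem existsBoundedOrbit_C2xi {L h : ℝ} (hL : L ≠ 0) (hh : h ≤ hTop L)
    (h3 : C2xi L h ≤ Ceta L h) : ExistsBoundedOrbit L h (C2xi L h) := by
  have hm := uHigh_pos hL hh
  have hv := (vDouble_spec hL h).1
  obtain ⟨q, v, hg, hu, hp, -⟩ := exists_globalWith (L := L) (h := h) (c := C2xi L h)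
    (p := 0) (w := √(etaCubic L h (C2xi L h) (vDouble L h))) hL hm hv
    (by rw [xiCubic_high hL hh]; ring)
    (Real.sq_sqrt (by rw [etaCubic_vDouble hL]; exact mul_nonneg (by linarith) hv.le))
  have h0 : xiCubic' h (C2xi L h) (uHigh L h) = 0 := by
    have h1 := IsGlobalWith.mul_xiCubic' L h (C2xi L h) (uHigh L h)
    rw [xiCubic_high hL hh, (uHigh_spec hL hh).2] at h1
    exact (mul_eq_zero.1 (h1.trans (by ring))).resolve_left hm.ne'
  exact ⟨univ, q, v, hg.isOrbitWith hL, hg.bounded_of_u_le hL fun t =>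
    (hg.motion_u.eq_const hg.continuous_rate (contDiff_xiCubic' _ _) hu hp h0 t).le⟩

theorem existsBoundedOrbit_iff {L h : ℝ} (hL : L ≠ 0) (hh : h ≤ hTop L) (c : ℝ) :
    ExistsBoundedOrbit L h c ↔ C1xi L h ≤ c ∧ c ≤ C2xi L h ∧ c ≤ Ceta L h := by
  constructor
  · rintro ⟨I, q, v, ho, hb⟩
    obtain ⟨rfl, hg⟩ := ho.global hL
    exact ⟨hg.C1xi_le hL hh (hg.u_le_uHigh hL hb 0), hg.le_C2xi hL hb, hg.le_Ceta hL⟩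
  · rintro ⟨h1, h2, h3⟩
    rcases h2.eq_or_lt with rfl | hlt
    · exact existsBoundedOrbit_C2xi hL hh h3
    · exact existsBoundedOrbit_of_lt hL hh h1 hlt h3

/-! ### Geometry of orbits with constant height, constant axial distance or circular trace. -/

theorem E3.ext_iff {p q : E3} : p = q ↔ p 0 = q 0 ∧ p 1 = q 1 ∧ p 2 = q 2 := by
  constructor
  · rintro rfl; exact ⟨rfl, rfl, rfl⟩
  · rintro ⟨h0, h1, h2⟩
    ext i; fin_cases i <;> assumption

theorem eq_zero_of_hasDerivAt_of_const {G : ℝ → ℝ} {k g t : ℝ} (hG : ∀ t, G t = k)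
    (hd : HasDerivAt G g t) : g = 0 := by
  rw [show G = fun _ => k from funext hG] at hd
  exact hd.unique (hasDerivAt_const t k)

namespace IsGlobalWith

variable {L h c : ℝ} {q v : ℝ → E3}

/-- An orbit at constant distance to the origin has constant height. -/
theorem z_eq_of_norm_eq (hg : IsGlobalWith L h c q v) {r : ℝ} (hr : ∀ t, ‖q t‖ = r) (t : ℝ) :
    q t 2 = -(2 * h + 1 / r) / 3 := by
  have h1 : ∀ t, inner ℝ (q t) (v t) = (0 : ℝ) := fun t => by
    have := eq_zero_of_hasDerivAt_of_const hr (hg.sol.hasDerivAt_norm (t := t) trivial)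
    exact (div_eq_zero_iff.1 this).resolve_right (hg.sol.norm_pos trivial).ne'
  have h2 := eq_zero_of_hasDerivAt_of_const h1 (hg.sol.hasDerivAt_inner (t := t) trivial)
  have h3 := hg.energy_eq t
  rw [energy] at h3
  rw [hr] at h2 h3
  linarith

/-- For constant z the vertical equation z'' = 0 reads |q|³ = z. -/
theorem norm_eq_of_z_eq (hg : IsGlobalWith L h c q v) {k : ℝ} (hz : ∀ t, q t 2 = k) (s t : ℝ) :
    ‖q s‖ = ‖q t‖ := by
  have h1 : ∀ t, v t 2 = 0 := fun t =>
    eq_zero_of_hasDerivAt_of_const hz (hg.sol.hasDerivAt_q (t := t) trivial 2)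
  have h2 : ∀ t, ‖q t‖ ^ 3 = k := fun t => by
    have h3 := eq_zero_of_hasDerivAt_of_const h1 (hg.sol.hasDerivAt_v (t := t) trivial 2)
    have := hg.sol.norm_pos (t := t) trivial
    rw [hz] at h3
    simp at h3
    field_simp at h3
    linarith
  exact (pow_left_inj₀ (norm_nonneg _) (norm_nonneg _) three_ne_zero).1 ((h2 s).trans (h2 t).symm)

/-- Two derivatives of ρ² = k: the horizontal velocity is orthogonal to the radius and has square L²
/ k, and the centripetal balance gives |q|³ = k² / L². -/
theorem norm_eq_of_rho_eq (hL : L ≠ 0) (hg : IsGlobalWith L h c q v) {k : ℝ}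
    (hρ : ∀ t, q t 0 ^ 2 + q t 1 ^ 2 = k) (s t : ℝ) : ‖q s‖ = ‖q t‖ := by
  have h1 : ∀ t, q t 0 * v t 0 + q t 1 * v t 1 = 0 := fun t => by
    have := eq_zero_of_hasDerivAt_of_const hρ
      (((hg.sol.hasDerivAt_q (t := t) trivial 0).pow 2).add
        ((hg.sol.hasDerivAt_q (t := t) trivial 1).pow 2))
    simp at this
    linarith
  have h2 : ∀ t, ‖q t‖ ^ 3 = k ^ 2 / L ^ 2 := fun t => by
    have h3 := eq_zero_of_hasDerivAt_of_const h1
      (((hg.sol.hasDerivAt_q (t := t) trivial 0).mul (hg.sol.hasDerivAt_v (t := t) trivial 0)).add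
        ((hg.sol.hasDerivAt_q (t := t) trivial 1).mul (hg.sol.hasDerivAt_v (t := t) trivial 1)))
    have hr := hg.sol.norm_pos (t := t) trivial
    have h4 := hg.angMom_eq t
    rw [angMom] at h4
    have h5 := h1 t
    have h6 := hρ t
    simp at h3
    field_simp at h3
    rw [eq_div_iff (by positivity), ← h4, ← h6]
    generalize ‖q t‖ = r at *
    generalize q t 0 = x at *
    generalize q t 1 = y at *
    generalize v t 0 = a at *
    generalize v t 1 = b at *
    linear_combination (x ^ 2 + y ^ 2) * h3 - (r ^ 3 * (x * a + y * b)) * h5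
  exact (pow_left_inj₀ (norm_nonneg _) (norm_nonneg _) three_ne_zero).1 ((h2 s).trans (h2 t).symm)

/-- A circular orbit stays at constant distance to the origin. -/
theorem norm_eq_of_isCircular (hL : L ≠ 0) (hg : IsGlobalWith L h c q v) (hc : IsCircular univ q)
    (s t : ℝ) : ‖q s‖ = ‖q t‖ := by
  obtain ⟨a, n, R, hn, -, hq⟩ := hc
  have h0 : ∀ t, n 0 * q t 0 + n 1 * q t 1 + n 2 * q t 2 = inner ℝ n a := fun t => by
    have : q t ∈ q '' univ := ⟨t, trivial, rfl⟩
    rw [hq] at this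
    have h := this.2
    rw [inner_sub_right, E3.inner_eq n (q t)] at h
    linarith
  have h1 : ∀ t, n 0 * v t 0 + n 1 * v t 1 + n 2 * v t 2 = 0 := fun t =>
    eq_zero_of_hasDerivAt_of_const h0
      ((((hg.sol.hasDerivAt_q (t := t) trivial 0).const_mul (n 0)).add
        ((hg.sol.hasDerivAt_q (t := t) trivial 1).const_mul (n 1))).add
        ((hg.sol.hasDerivAt_q (t := t) trivial 2).const_mul (n 2)))
  have h2 : ∀ t, n 2 * ‖q t‖ ^ 3 = inner ℝ n a := fun t => by
    have h3 := eq_zero_of_hasDerivAt_of_const h1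
      ((((hg.sol.hasDerivAt_v (t := t) trivial 0).const_mul (n 0)).add
        ((hg.sol.hasDerivAt_v (t := t) trivial 1).const_mul (n 1))).add
        ((hg.sol.hasDerivAt_v (t := t) trivial 2).const_mul (n 2)))
    have hr := hg.sol.norm_pos (t := t) trivial
    rw [← h0 t]
    simp at h3
    field_simp at h3
    linarith
  -- Two derivatives of the equation of the plane gave n₂|q|³ = ⟨n, a⟩. If n₂ = 0 the plane contains
  -- the z-axis, and then L = 0.
  by_cases hn2 : n 2 = 0
  · exfalso
    have h3 : inner ℝ n a = (0 : ℝ) := by rw [← h2 0, hn2, zero_mul]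
    have e0 := h0 0
    have e1 := h1 0
    have e2 := hg.angMom_eq 0
    rw [h3, hn2] at e0
    rw [hn2] at e1
    rw [angMom] at e2
    have k0 : n 0 * L = 0 := by rw [← e2]; linear_combination v 0 1 * e0 - q 0 1 * e1
    have k1 : n 1 * L = 0 := by rw [← e2]; linear_combination q 0 0 * e1 - v 0 0 * e0
    exact hn (E3.ext_iff.2 ⟨by simpa [hL] using k0, by simpa [hL] using k1, by simpa using hn2⟩)
  · have h3 := (h2 s).trans (h2 t).symm
    exact (pow_left_inj₀ (norm_nonneg _) (norm_nonneg _) three_ne_zero).1 (mul_left_cancel₀ hn2 h3)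

theorem uCoord_eq_of_norm_eq (hg : IsGlobalWith L h c q v) (hr : ∀ s t, ‖q s‖ = ‖q t‖) (s t : ℝ) :
    uCoord (q s) = uCoord (q t) := by
  have h1 := hg.z_eq_of_norm_eq (r := ‖q 0‖) (fun t => hr t 0)
  rw [uCoord, uCoord, hr s t, h1 s, h1 t]

theorem vCoord_eq_of_norm_eq (hg : IsGlobalWith L h c q v) (hr : ∀ s t, ‖q s‖ = ‖q t‖) (s t : ℝ) :
    vCoord (q s) = vCoord (q t) := by
  have h1 := hg.z_eq_of_norm_eq (r := ‖q 0‖) (fun t => hr t 0)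
  rw [vCoord, vCoord, hr s t, h1 s, h1 t]

theorem not_isCircular_of_eta (hL : L ≠ 0) (hg : IsGlobalWith L h c q v)
    (hη : IsTauPeriodic eta univ q) : ¬ IsCircular univ q := fun hc => by
  obtain ⟨s, t, hst⟩ := hη.exists_ne
  have := hg.vCoord_eq_of_norm_eq (hg.norm_eq_of_isCircular hL hc) s t
  exact hst (congrArg Real.sqrt this)

/-- Constant height or constant distance to the axis would make |q| constant, hence z too, and with
them ξ. -/
theorem isOscillatory (hL : L ≠ 0) (hg : IsGlobalWith L h c q v)
    (hξ : IsTauPeriodic xi univ q) (hη : IsTauPeriodic eta univ q) : IsOscillatory univ q := by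
  obtain ⟨s, t, hst⟩ := hξ.exists_ne
  have hr : ¬ ∀ s t, ‖q s‖ = ‖q t‖ := fun hr =>
    hst (congrArg Real.sqrt (hg.uCoord_eq_of_norm_eq hr s t))
  refine ⟨hξ, hη, ?_, ?_⟩
  · by_contra! hcon
    exact hr (hg.norm_eq_of_z_eq (k := q 0 2) fun t => hcon t trivial 0 trivial)
  · by_contra! hcon
    refine hr (hg.norm_eq_of_rho_eq hL (k := q 0 0 ^ 2 + q 0 1 ^ 2) fun t => ?_)
    exact (Real.sqrt_inj (by positivity) (by positivity)).1 (hcon t trivial 0 trivial)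

end IsGlobalWith

theorem IsCircular.isBoundedOrbit {I : Set ℝ} {q : ℝ → E3} (h : IsCircular I q) :
    IsBoundedOrbit I q := by
  obtain ⟨a, n, R, -, -, hq⟩ := h
  rw [IsBoundedOrbit, hq]
  refine (Metric.isBounded_closedBall (x := a) (r := R)).subset fun p hp => ?_
  rw [Metric.mem_closedBall, dist_eq_norm]; exact hp.1.le

/-! ### The circular orbits -/

/-- Distance of a circular orbit to the axis. -/
noncomputable def circRho (r : ℝ) : ℝ := √(r ^ 2 - r ^ 6)

/-- Angular velocity of a circular orbit. -/
noncomputable def circFreq (L r : ℝ) : ℝ := L / (r ^ 2 - r ^ 6)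

/-- Position along a circular orbit. -/
noncomputable def circPos (L r t : ℝ) : E3 :=
  !₂[circRho r * Real.cos (circFreq L r * t), circRho r * Real.sin (circFreq L r * t), r ^ 3]

/-- Velocity along a circular orbit. -/
noncomputable def circVel (L r t : ℝ) : E3 :=
  !₂[-(circFreq L r * circRho r * Real.sin (circFreq L r * t)),
    circFreq L r * circRho r * Real.cos (circFreq L r * t), 0]

theorem hasDerivAt_E3 {f : ℝ → E3} {f' : E3} {t : ℝ} (h : ∀ i, HasDerivAt (fun s => f s i) (f' i) t) :
    HasDerivAt f f' t := by
  have h1 : HasDerivAt (fun s => (EuclideanSpace.equiv (Fin 3) ℝ) (f s))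
      ((EuclideanSpace.equiv (Fin 3) ℝ) f') t := hasDerivAt_pi.2 h
  exact (EuclideanSpace.equiv (Fin 3) ℝ).symm.hasFDerivAt.comp_hasDerivAt t h1

namespace IsCircRadius

variable {L r : ℝ}

theorem rho_sq_pos (hr : IsCircRadius L r) : 0 < r ^ 2 - r ^ 6 := by
  have h1 := hr.one_sub_pos
  have h2 := hr.pos
  have : r ^ 2 - r ^ 6 = r ^ 2 * (1 - r ^ 2) * (1 + r ^ 2) := by ring
  rw [this]; positivity

theorem rho_sq (hr : IsCircRadius L r) : circRho r ^ 2 = r ^ 2 - r ^ 6 := Real.sq_sqrt hr.rho_sq_pos.le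

theorem rho_pos (hr : IsCircRadius L r) : 0 < circRho r := Real.sqrt_pos.2 hr.rho_sq_pos

theorem freq_sq (hr : IsCircRadius L r) : circFreq L r ^ 2 = 1 / r ^ 3 := by
  have h1 := hr.rho_sq_pos.ne'
  have h2 := hr.pos
  rw [circFreq, div_pow, hr.eq, div_eq_div_iff (pow_ne_zero 2 h1) (by positivity)]
  ring

theorem freq_mul (hr : IsCircRadius L r) : circFreq L r * (r ^ 2 - r ^ 6) = L :=
  div_mul_cancel₀ _ hr.rho_sq_pos.ne'

theorem freq_ne_zero (hr : IsCircRadius L r) : circFreq L r ≠ 0 := fun h0 => by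
  have h1 := hr.freq_sq
  have := hr.pos
  rw [h0] at h1
  have : 0 < 1 / r ^ 3 := by positivity
  linarith [h1]

theorem norm_circPos (hr : IsCircRadius L r) (t : ℝ) : ‖circPos L r t‖ = r := by
  have h1 := E3.norm_sq (circPos L r t)
  refine (pow_left_inj₀ (norm_nonneg _) hr.pos.le two_ne_zero).1 ?_
  rw [h1]
  simp [circPos, mul_pow]
  rw [hr.rho_sq]
  linear_combination (r ^ 2 - r ^ 6) * Real.sin_sq_add_cos_sq (circFreq L r * t)

theorem norm_circVel_sq (hr : IsCircRadius L r) (t : ℝ) : ‖circVel L r t‖ ^ 2 = (1 - r ^ 4) / r := by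
  have := hr.pos
  rw [E3.norm_sq]
  simp [circVel, mul_pow]
  rw [hr.rho_sq, hr.freq_sq]
  field_simp
  linear_combination (1 - r ^ 4) * Real.sin_sq_add_cos_sq (circFreq L r * t)

theorem isStarkSolution (hr : IsCircRadius L r) :
    IsStarkSolution univ (circPos L r) (circVel L r) := by
  have hp := hr.pos
  have hcos : ∀ t, HasDerivAt (fun s => Real.cos (circFreq L r * s))
      (-Real.sin (circFreq L r * t) * circFreq L r) t := fun t => by
    simpa using ((hasDerivAt_id t).const_mul (circFreq L r)).cos
  have hsin : ∀ t, HasDerivAt (fun s => Real.sin (circFreq L r * s))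
      (Real.cos (circFreq L r * t) * circFreq L r) t := fun t => by
    simpa using ((hasDerivAt_id t).const_mul (circFreq L r)).sin
  refine ⟨isOpen_univ, ordConnected_univ, univ_nonempty, fun t _ => ?_, fun t _ => ?_, fun t _ => ?_⟩
  · rw [← norm_ne_zero_iff, hr.norm_circPos]; exact hp.ne'
  · refine hasDerivAt_E3 fun i => ?_
    fin_cases i
    · simp only [circPos, circVel]
      refine ((hcos t).const_mul _).congr_deriv ?_
      simp; ring
    · simp only [circPos, circVel]
      refine ((hsin t).const_mul _).congr_deriv ?_
      simp; ring
    · simp only [circPos, circVel]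
      simpa using hasDerivAt_const t (r ^ 3)
  · refine hasDerivAt_E3 fun i => ?_
    rw [starkForce_apply, hr.norm_circPos]
    have hf := hr.freq_sq
    fin_cases i
    · simp only [circPos, circVel]
      refine ((hsin t).const_mul (circFreq L r * circRho r)).neg.congr_deriv ?_
      simp
      rw [div_eq_mul_one_div, ← hf]; ring
    · simp only [circPos, circVel]
      refine ((hcos t).const_mul (circFreq L r * circRho r)).congr_deriv ?_
      simp
      rw [div_eq_mul_one_div, ← hf]; ring
    · simp only [circPos, circVel]
      refine (hasDerivAt_const t (0 : ℝ)).congr_deriv ?_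
      simp
      field_simp; ring

theorem inner_circ (t : ℝ) : inner ℝ (circPos L r t) (circVel L r t) = (0 : ℝ) := by
  rw [E3.inner_eq]; simp [circPos, circVel]; ring

theorem uMom_circ (t : ℝ) : uMom (circPos L r t) (circVel L r t) = 0 := by
  rw [uMom, inner_circ]; simp [circVel]

theorem vMom_circ (t : ℝ) : vMom (circPos L r t) (circVel L r t) = 0 := by
  rw [vMom, inner_circ]; simp [circVel]

theorem uCoord_circ (hr : IsCircRadius L r) (t : ℝ) : uCoord (circPos L r t) = r + r ^ 3 := by
  rw [uCoord, hr.norm_circPos]; simp [circPos]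

theorem vCoord_circ (hr : IsCircRadius L r) (t : ℝ) : vCoord (circPos L r t) = r - r ^ 3 := by
  rw [vCoord, hr.norm_circPos]; simp [circPos]

theorem isGlobalWith (hr : IsCircRadius L r) :
    IsGlobalWith L (circEnergy r) (circSep r) (circPos L r) (circVel L r) := by
  have hp := hr.pos
  refine ⟨hr.isStarkSolution, fun t => ?_, fun t => ?_, fun t => ?_⟩
  · rw [angMom]
    simp [circPos, circVel]
    have h1 := Real.sin_sq_add_cos_sq (circFreq L r * t)
    have h2 := hr.rho_sq
    have h3 := hr.freq_mul
    rw [← h2] at h3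
    linear_combination h3 + circFreq L r * circRho r ^ 2 * h1
  · rw [energy, hr.norm_circVel_sq, hr.norm_circPos, circEnergy]
    simp [circPos]
    field_simp
    ring
  · have h0 : circPos L r t 0 ^ 2 + circPos L r t 1 ^ 2 = r ^ 2 - r ^ 6 := by
      simp [circPos, mul_pow]
      rw [hr.rho_sq]
      linear_combination (r ^ 2 - r ^ 6) * Real.sin_sq_add_cos_sq (circFreq L r * t)
    rw [lenz, inner_circ, hr.norm_circVel_sq, hr.norm_circPos, circSep, h0]
    simp [circPos]
    field_simp
    ring

/-- The circular orbit is determined by the reduced state. -/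
theorem exists_eq_circ (hr : IsCircRadius L r) {q v : E3} (hL : angMom q v = L)
    (hu : uCoord q = r + r ^ 3) (hv : vCoord q = r - r ^ 3) (hp : uMom q v = 0) (hw : vMom q v = 0) :
    ∃ t, q = circPos L r t ∧ v = circVel L r t := by
  have hr0 := hr.pos
  have hρ := hr.rho_pos
  have hρ2 := hr.rho_sq
  have hxy := uCoord_mul_vCoord q
  have h2 : q 2 = r ^ 3 := by simp only [uCoord, vCoord] at hu hv; linarith
  have hn : ‖q‖ = r := by simp only [uCoord, vCoord] at hu hv; linarith
  have hv2 : v 2 = 0 := by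
    have : ‖q‖ * v 2 = 0 := by simp only [uMom, vMom] at hp hw; linarith
    exact (mul_eq_zero.1 this).resolve_left (by rw [hn]; exact hr0.ne')
  have hin : q 0 * v 0 + q 1 * v 1 = 0 := by
    have : inner ℝ q v = (0 : ℝ) := by simp only [uMom, vMom] at hp hw; linarith
    rw [E3.inner_eq, hv2] at this
    linarith
  have hxy' : q 0 ^ 2 + q 1 ^ 2 = circRho r ^ 2 := by rw [← hxy, hu, hv, hρ2]; ring
  obtain ⟨θ, hc, hs⟩ := exists_cos_sin_eq (X := q 0 / circRho r) (Y := q 1 / circRho r) (by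
    rw [div_pow, div_pow, ← add_div, hxy']; field_simp)
  have hx : q 0 = circRho r * Real.cos θ := by rw [hc]; field_simp
  have hy : q 1 = circRho r * Real.sin θ := by rw [hs]; field_simp
  have hθ : circFreq L r * (θ / circFreq L r) = θ := by have := hr.freq_ne_zero; field_simp
  have hfreq := hr.freq_mul
  rw [angMom] at hL
  refine ⟨θ / circFreq L r, E3.ext_iff.2 ⟨?_, ?_, ?_⟩, E3.ext_iff.2 ⟨?_, ?_, ?_⟩⟩
  · simp [circPos, hθ, hx]
  · simp [circPos, hθ, hy]
  · simp [circPos, h2]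
  · simp [circVel, hθ]
    refine mul_left_cancel₀ (pow_pos hρ 2).ne' ?_
    rw [mul_assoc, ← hy, ← hxy']
    rw [← hρ2, ← hxy'] at hfreq
    rw [← hfreq] at hL
    linear_combination q 0 * hin - q 1 * hL
  · simp [circVel, hθ]
    refine mul_left_cancel₀ (pow_pos hρ 2).ne' ?_
    rw [mul_assoc, ← hx, ← hxy']
    rw [← hρ2, ← hxy'] at hfreq
    rw [← hfreq] at hL
    linear_combination q 1 * hin + q 0 * hL
  · simp [circVel, hv2]

theorem isTimeShiftOf (hr : IsCircRadius L r) {h c : ℝ} {q v : ℝ → E3} (hg : IsGlobalWith L h c q v)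
    {t₀ : ℝ} (hu : uCoord (q t₀) = r + r ^ 3) (hv : vCoord (q t₀) = r - r ^ 3)
    (hp : uMom (q t₀) (v t₀) = 0) (hw : vMom (q t₀) (v t₀) = 0) :
    IsTimeShiftOf univ q v (circPos L r) (circVel L r) := by
  obtain ⟨s, hq, hv⟩ := hr.exists_eq_circ (hg.angMom_eq t₀) hu hv hp hw
  refine ⟨rfl, s - t₀, fun t => ?_⟩
  exact hg.sol.eqOn (hr.isStarkSolution.comp_add (s - t₀)) (t₀ := t₀) trivial (by simpa using hq)
    (by simpa using hv) trivial

theorem isCircular (hr : IsCircRadius L r) : IsCircular univ (circPos L r) := by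
  have hρ := hr.rho_pos
  refine ⟨EuclideanSpace.single 2 (r ^ 3), EuclideanSpace.single 2 1, circRho r, ?_, hρ, ?_⟩
  · intro h0
    have := congrArg (fun p : E3 => p 2) h0
    simp at this
  ext p
  have hin : inner ℝ (EuclideanSpace.single 2 1 : E3) (p - EuclideanSpace.single 2 (r ^ 3)) =
      p 2 - r ^ 3 := by rw [E3.inner_eq]; simp
  have hnorm : ‖p - EuclideanSpace.single 2 (r ^ 3)‖ ^ 2 =
      p 0 ^ 2 + p 1 ^ 2 + (p 2 - r ^ 3) ^ 2 := by rw [E3.norm_sq]; simp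
  rw [mem_ofPred_eq, hin, ← pow_left_inj₀ (norm_nonneg _) hρ.le two_ne_zero, hnorm]
  constructor
  · rintro ⟨t, -, rfl⟩
    simp [circPos, mul_pow]
    linear_combination circRho r ^ 2 * Real.sin_sq_add_cos_sq (circFreq L r * t)
  · rintro ⟨h1, h2⟩
    rw [h2] at h1
    obtain ⟨θ, hc, hs⟩ := exists_cos_sin_eq (X := p 0 / circRho r) (Y := p 1 / circRho r) (by
      rw [div_pow, div_pow, ← add_div]; field_simp; linarith)
    have hθ : circFreq L r * (θ / circFreq L r) = θ := by have := hr.freq_ne_zero; field_simp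
    refine ⟨θ / circFreq L r, trivial, (E3.ext_iff.2 ⟨?_, ?_, ?_⟩).symm⟩
    · simp [circPos, hθ, hc]; field_simp
    · simp [circPos, hθ, hs]; field_simp
    · simp [circPos]; linarith

theorem isCompact_phaseTrace (hr : IsCircRadius L r) :
    IsCompact (phaseTrace (circPos L r) (circVel L r)) := by
  have hf := hr.freq_ne_zero
  refine Function.Periodic.compact_of_continuous (c := 2 * Real.pi / circFreq L r) (fun t => ?_)
    (by have := Real.pi_pos; positivity)
    (hr.isGlobalWith.continuous_q.prodMk hr.isGlobalWith.continuous_v)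
  have e : circFreq L r * (t + 2 * Real.pi / circFreq L r) = circFreq L r * t + 2 * Real.pi := by
    field_simp
  simp only [circPos, circVel, e, Real.cos_add_two_pi, Real.sin_add_two_pi]

theorem xi_sq_circ (hr : IsCircRadius L r) (t : ℝ) : xi (circPos L r t) ^ 2 = r + r ^ 3 := by
  rw [xi_sq, hr.uCoord_circ]

theorem eta_sq_circ (hr : IsCircRadius L r) (t : ℝ) : eta (circPos L r t) ^ 2 = r - r ^ 3 := by
  rw [eta_sq, hr.vCoord_circ]

/-- `η` sits at the double root of `g`. -/
theorem isEtaDouble (hr : IsCircRadius L r) (hL : L ≠ 0) (t : ℝ) :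
    IsEtaDouble L (circEnergy r) (circSep r) (eta (circPos L r t)) := by
  have hv := hr.v_pos
  refine ⟨-(L ^ 2 / (r - r ^ 3) ^ 2), by
    have : 0 < L ^ 2 / (r - r ^ 3) ^ 2 := by positivity
    linarith, by rw [hr.eta_sq_circ]; exact hv, fun v => ?_⟩
  rw [hr.eta_sq_circ, etaCubic_eq hL, hr.Ceta_eq, hr.vDouble_eq]
  ring

end IsCircRadius

/-! ### Hyperbolic and elliptic fixed points of the ξ-equation. -/

theorem hasDerivAt_xiPot (L h c : ℝ) {w : ℝ} (hw : w ≠ 0) :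
    HasDerivAt (xiPot L h c) (4 * w ^ 3 + 4 * h * w + 2 * L ^ 2 / w ^ 3) w := by
  have h1 := (((hasDerivAt_id w).pow 4).add (((hasDerivAt_id w).pow 2).const_mul (2 * h))).add_const
    (2 * (c + 1))
  have h2 := (hasDerivAt_const w (L ^ 2)).div ((hasDerivAt_id w).pow 2) (by simpa using hw)
  refine (h1.sub h2).congr_deriv ?_
  simp
  field_simp
  ring

theorem deriv_deriv_xiPot (L h c : ℝ) {w : ℝ} (hw : w ≠ 0) :
    deriv (deriv (xiPot L h c)) w = 12 * w ^ 2 + 4 * h - 6 * L ^ 2 / w ^ 4 := by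
  have h0 : deriv (xiPot L h c) =ᶠ[𝓝 w] fun w => 4 * w ^ 3 + 4 * h * w + 2 * L ^ 2 / w ^ 3 := by
    filter_upwards [isOpen_ne.mem_nhds hw] with x hx
    exact (hasDerivAt_xiPot L h c hx).deriv
  rw [h0.deriv_eq]
  have h1 := (((hasDerivAt_id w).pow 3).const_mul 4).add ((hasDerivAt_id w).const_mul (4 * h))
  have h2 := (hasDerivAt_const w (2 * L ^ 2)).div ((hasDerivAt_id w).pow 3) (by simpa using hw)
  refine ((h1.add h2).congr_deriv ?_).deriv
  simp
  field_simp
  ring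

/-- Derivatives of the potential at a double root of `f`. -/
theorem xiPot_of_double {L h c w m : ℝ} (hm : 0 < m) (hw : w ^ 2 = m)
    (he : 2 * m ^ 3 + 2 * h * m ^ 2 + L ^ 2 = 0) (hf : xiCubic L h c m = 0) :
    xiPot L h c w = 0 ∧ deriv (xiPot L h c) w = 0 ∧
      deriv (deriv (xiPot L h c)) w = 8 * (m ^ 3 - L ^ 2) / m ^ 2 := by
  have hw0 : w ≠ 0 := by rintro rfl; simp at hw; exact hm.ne hw
  have w4 : w ^ 4 = m ^ 2 := by rw [← hw]; ring
  refine ⟨?_, ?_, ?_⟩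
  · rw [xiPot, w4, hw]
    rw [xiCubic] at hf
    field_simp
    linear_combination hf
  · rw [(hasDerivAt_xiPot L h c hw0).deriv]
    have e : 4 * w ^ 3 + 4 * h * w + 2 * L ^ 2 / w ^ 3 =
        2 * (2 * (w ^ 2) ^ 3 + 2 * h * (w ^ 2) ^ 2 + L ^ 2) / w ^ 3 := by
      field_simp
      ring
    rw [e, hw, he]; simp
  · rw [deriv_deriv_xiPot L h c hw0, w4, hw]
    field_simp
    linear_combination 2 * he

namespace IsCircRadius

variable {L r : ℝ}

/-- By `xiPot_of_double` the second derivative has the sign of m³ - L² with m = r + r³. This sign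
tells on which side of the double root m the third root L² / m² lies; the elliptic case is the
opposite one. -/
theorem isXiHyperbolic (hr : IsCircRadius L r) (hL : L ≠ 0) (h3 : 1 < 3 * r ^ 2) (t : ℝ) :
    IsXiHyperbolic L (circEnergy r) (circSep r) (xi (circPos L r t)) := by
  have hp := hr.pos
  have hu : 0 < r + r ^ 3 := by positivity
  have hh := hr.circEnergy_lt hL h3.ne'
  have h4 := third_lt_uHigh hL hh
  have hfac := xiCubic_eq_high hL hh.le (circSep r)
  rw [hr.uHigh_eq hL h3.le] at h4
  simp only [hr.uHigh_eq hL h3.le, hr.C2xi_eq hL h3.le] at hfac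
  obtain ⟨e1, e2, e3⟩ := xiPot_of_double hu (hr.xi_sq_circ t) hr.double_u
    (c := circSep r) (by rw [hfac]; ring)
  refine ⟨⟨L ^ 2 / (r + r ^ 3) ^ 2, by positivity, by rw [hr.xi_sq_circ]; exact h4, fun u => ?_⟩,
    e1, e2, ?_⟩
  · rw [hr.xi_sq_circ, hfac]; ring
  · rw [e3]
    rw [div_lt_iff₀ (by positivity)] at h4
    have : 0 < (r + r ^ 3) ^ 3 - L ^ 2 := by nlinarith
    positivity

theorem isXiElliptic (hr : IsCircRadius L r) (hL : L ≠ 0) (h3 : 3 * r ^ 2 < 1) (t : ℝ) :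
    IsXiElliptic L (circEnergy r) (circSep r) (xi (circPos L r t)) := by
  have hp := hr.pos
  have hu : 0 < r + r ^ 3 := by positivity
  have hh := hr.circEnergy_lt hL h3.ne
  have h4 := uLow_lt_third hL hh
  have hfac := xiCubic_eq_low hL hh.le (circSep r)
  rw [hr.uLow_eq h3.le] at h4
  simp only [hr.uLow_eq h3.le, hr.C1xi_eq h3.le] at hfac
  obtain ⟨e1, e2, e3⟩ := xiPot_of_double hu (hr.xi_sq_circ t) hr.double_u
    (c := circSep r) (by rw [hfac]; ring)
  refine ⟨⟨L ^ 2 / (r + r ^ 3) ^ 2, by rw [hr.xi_sq_circ]; exact hu,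
    by rw [hr.xi_sq_circ]; exact h4, fun u => ?_⟩, e1, e2, ?_⟩
  · rw [hr.xi_sq_circ, hfac]; ring
  · rw [e3]
    rw [lt_div_iff₀ (by positivity)] at h4
    exact div_neg_of_neg_of_pos (by nlinarith) (by positivity)

end IsCircRadius

/-! ### First integrals, orbital stability, and convergence to a circular orbit. -/

/-- A compact orbit that is isolated, in a neighbourhood, by the values of a continuous first
integral is orbitally stable. -/
theorem isOrbitallyStable_of_isolated {Y : Type*} [MetricSpace Y] {q₀ v₀ : ℝ → E3}
    (hΓ : IsCompact (phaseTrace q₀ v₀)) {U : Set (E3 × E3)} (hU : IsOpen U)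
    (hΓU : phaseTrace q₀ v₀ ⊆ U) {G : E3 × E3 → Y} (hG : ContinuousOn G U) {g₀ : Y}
    (hG₀ : ∀ x ∈ phaseTrace q₀ v₀, G x = g₀)
    (hinv : ∀ (I : Set ℝ) (q v : ℝ → E3), IsStarkSolution I q v → ∀ s ∈ I, ∀ t ∈ I,
      G (q s, v s) = G (q t, v t))
    (hiso : ∀ x ∈ U, G x = g₀ → x ∈ phaseTrace q₀ v₀) : IsOrbitallyStable univ q₀ v₀ := by
  intro ε hε
  set Γ := phaseTrace q₀ v₀ with hΓdef
  have hne : Γ.Nonempty := range_nonempty _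
  obtain ⟨δ₀, hδ₀, hsub⟩ := hΓ.exists_cthickening_subset_open hU hΓU
  set e := min ε δ₀ with he
  have he0 : 0 < e := lt_min hε hδ₀
  have hcont : Continuous fun x : E3 × E3 => Metric.infDist x Γ := Metric.continuous_infDist_pt Γ
  -- On the compact set S of points at distance e from the orbit, G stays at distance at least m
  -- from g₀. A solution that starts where G is closer to g₀ than m cannot reach S, since G is
  -- conserved.
  set S : Set (E3 × E3) := {x | Metric.infDist x Γ = e} with hS
  have hSsub : S ⊆ Metric.cthickening δ₀ Γ := fun x hx =>
    Metric.cthickening_mono (min_le_right ε δ₀) Γ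
      (Metric.mem_cthickening_iff.2
        ((ENNReal.le_ofReal_iff_toReal_le (Metric.infEDist_ne_top hne) he0.le).2 (le_of_eq hx)))
  have hSc : IsCompact S :=
    hΓ.cthickening.of_isClosed_subset (isClosed_eq hcont continuous_const) hSsub
  have hfc : ContinuousOn (fun x => dist (G x) g₀) U := continuous_dist.comp_continuousOn (hG.prodMk continuousOn_const)
  obtain ⟨m, hm, hmS⟩ : ∃ m > 0, ∀ x ∈ S, m ≤ dist (G x) g₀ := by
    rcases S.eq_empty_or_nonempty with h0 | h0
    · exact ⟨1, one_pos, by simp [h0]⟩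
    · obtain ⟨x, hx, hmin⟩ := hSc.exists_isMinOn h0 (hfc.mono (hSsub.trans hsub))
      refine ⟨_, dist_pos.2 fun hx0 => ?_, fun y hy => hmin hy⟩
      have h1 := Metric.infDist_zero_of_mem (hiso x (hsub (hSsub hx)) hx0)
      rw [show Metric.infDist x Γ = e from hx] at h1
      exact he0.ne' h1
  have hVo : IsOpen (U ∩ (fun x => dist (G x) g₀) ⁻¹' Iio m) := hfc.isOpen_inter_preimage hU isOpen_Iio
  obtain ⟨δ₁, hδ₁, hsub₁⟩ := hΓ.exists_thickening_subset_open hVo fun x hx =>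
    ⟨hΓU hx, by simpa [hG₀ x hx] using hm⟩
  refine ⟨min δ₁ e, lt_min hδ₁ he0, fun I q v hs h0 _ hd t ht h0t => ?_⟩
  by_contra! hcon
  have h1 : (q 0, v 0) ∈ Metric.thickening δ₁ Γ :=
    (Metric.mem_thickening_iff_infDist_lt hne).2 (hd.trans_le (min_le_left _ _))
  have hIcc : Icc 0 t ⊆ I := hs.ordConnected.out h0 ht
  have hc : ContinuousOn (fun s => Metric.infDist (q s, v s) Γ) (Icc 0 t) :=
    hcont.comp_continuousOn (hs.continuousOn_prod.mono hIcc)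
  obtain ⟨s, hs1, hs2⟩ := intermediate_value_Icc h0t hc
    ⟨(hd.trans_le (min_le_right _ _)).le, (min_le_left ε δ₀).trans hcon⟩
  have h2 := hmS (q s, v s) hs2
  rw [hinv I q v hs s (hIcc hs1) 0 h0] at h2
  exact absurd (hsub₁ h1).2 (not_lt.2 h2)

/-- The first integrals of the Stark problem. -/
noncomputable def firstIntegrals (x : E3 × E3) : ℝ × ℝ × ℝ :=
  (angMom x.1 x.2, energy x.1 x.2, lenz x.1 x.2)

theorem continuousOn_firstIntegrals : ContinuousOn firstIntegrals {x | x.1 ≠ 0} := by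
  unfold firstIntegrals angMom energy lenz
  refine ContinuousOn.prodMk (by fun_prop) (ContinuousOn.prodMk ?_ ?_)
  · exact (((by fun_prop : Continuous fun x : E3 × E3 => ‖x.2‖ ^ 2 / 2).continuousOn.sub
      (continuousOn_const.div (by fun_prop) fun x hx => norm_ne_zero_iff.2 hx))).sub (by fun_prop)
  · exact (((by fun_prop : Continuous fun x : E3 × E3 =>
      inner ℝ x.1 x.2 * x.2 2 - ‖x.2‖ ^ 2 * x.1 2).continuousOn.add
      (ContinuousOn.div (by fun_prop) (by fun_prop) fun x hx => norm_ne_zero_iff.2 hx))).sub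
        (by fun_prop)

theorem IsStarkSolution.firstIntegrals_eq {I : Set ℝ} {q v : ℝ → E3} (hs : IsStarkSolution I q v)
    {s t : ℝ} (hs' : s ∈ I) (ht : t ∈ I) :
    firstIntegrals (q s, v s) = firstIntegrals (q t, v t) := by
  simp only [firstIntegrals, hs.angMom_eq hs' ht, hs.energy_eq hs' ht, hs.lenz_eq hs' ht]

theorem continuous_uCoord : Continuous uCoord := by unfold uCoord; fun_prop

theorem exists_globalWith_of_firstIntegrals {L h c : ℝ} (hL : L ≠ 0) {x : E3 × E3}
    (hx : firstIntegrals x = (L, h, c)) :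
    ∃ q v : ℝ → E3, q 0 = x.1 ∧ v 0 = x.2 ∧ IsGlobalWith L h c q v := by
  simp only [firstIntegrals, Prod.mk.injEq] at hx
  obtain ⟨q, v, hs, hq, hv⟩ := exists_isStarkSolution_univ (q₀ := x.1) (v₀ := x.2)
    (by rw [hx.1]; exact hL)
  have hg := IsGlobalWith.of_zero hs
  rw [hq, hv, hx.1, hx.2.1, hx.2.2] at hg
  exact ⟨q, v, hq, hv, hg⟩

namespace IsCircRadius

variable {L r : ℝ}

theorem xiCubic_circ (hr : IsCircRadius L r) :
    xiCubic L (circEnergy r) (circSep r) (r + r ^ 3) = 0 := by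
  have := hr.isGlobalWith.uMom_sq 0
  rwa [uMom_circ, hr.uCoord_circ, zero_pow two_ne_zero, eq_comm] at this

theorem etaCubic_circ (hr : IsCircRadius L r) :
    etaCubic L (circEnergy r) (circSep r) (r - r ^ 3) = 0 := by
  have := hr.isGlobalWith.vMom_sq 0
  rwa [vMom_circ, hr.vCoord_circ, zero_pow two_ne_zero, eq_comm] at this

theorem state_of_uCoord (hr : IsCircRadius L r) (hL : L ≠ 0) {q v : ℝ → E3}
    (hg : IsGlobalWith L (circEnergy r) (circSep r) q v) {t : ℝ} (hu : uCoord (q t) = r + r ^ 3) :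
    vCoord (q t) = r - r ^ 3 ∧ uMom (q t) (v t) = 0 ∧ vMom (q t) (v t) = 0 := by
  have hv : vCoord (q t) = r - r ^ 3 := by
    rw [hg.v_eq_of_eq hL hr.Ceta_eq.le, hr.vDouble_eq]
  refine ⟨hv, pow_eq_zero_iff two_ne_zero |>.1 ?_, pow_eq_zero_iff two_ne_zero |>.1 ?_⟩
  · rw [hg.uMom_sq, hu, hr.xiCubic_circ]
  · rw [hg.vMom_sq, hv, hr.etaCubic_circ]

theorem isTimeShiftOf_of_uCoord (hr : IsCircRadius L r) (hL : L ≠ 0) {q v : ℝ → E3}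
    (hg : IsGlobalWith L (circEnergy r) (circSep r) q v) {t : ℝ} (hu : uCoord (q t) = r + r ^ 3) :
    IsTimeShiftOf univ q v (circPos L r) (circVel L r) := by
  obtain ⟨h1, h2, h3⟩ := hr.state_of_uCoord hL hg hu
  exact hr.isTimeShiftOf hg hu h1 h2 h3

theorem mem_phaseTrace (hr : IsCircRadius L r) (hL : L ≠ 0) {x : E3 × E3}
    (hx : firstIntegrals x = (L, circEnergy r, circSep r)) (hu : uCoord x.1 = r + r ^ 3) :
    x ∈ phaseTrace (circPos L r) (circVel L r) := by
  obtain ⟨q, v, hq, hv, hg⟩ := exists_globalWith_of_firstIntegrals hL hx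
  rw [← hq] at hu
  obtain ⟨-, s, hs⟩ := hr.isTimeShiftOf_of_uCoord hL hg hu
  refine ⟨s, ?_⟩
  have := hs 0
  rw [zero_add, hq, hv] at this
  exact Prod.ext this.1.symm this.2.symm

theorem firstIntegrals_of_mem (hr : IsCircRadius L r) {x : E3 × E3}
    (hx : x ∈ phaseTrace (circPos L r) (circVel L r)) :
    firstIntegrals x = (L, circEnergy r, circSep r) := by
  obtain ⟨t, rfl⟩ := hx
  simp [firstIntegrals, hr.isGlobalWith.angMom_eq, hr.isGlobalWith.energy_eq,
    hr.isGlobalWith.lenz_eq]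

theorem uCoord_of_mem (hr : IsCircRadius L r) {x : E3 × E3}
    (hx : x ∈ phaseTrace (circPos L r) (circVel L r)) : uCoord x.1 = r + r ^ 3 := by
  obtain ⟨t, rfl⟩ := hx
  exact hr.uCoord_circ t

/-- In the region u < `uHigh` the first integrals take their values of the circular orbit only on
that orbit: c = `C1xi` = `Ceta` pins u and v to the double roots. As L is one of these integrals,
perturbations of L are covered. -/
theorem isOrbitallyStable (hr : IsCircRadius L r) (hL : L ≠ 0) (h3 : 3 * r ^ 2 < 1) :
    IsOrbitallyStable univ (circPos L r) (circVel L r) := by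
  have hh := hr.circEnergy_lt hL h3.ne
  have hlt := uLow_lt_uHigh hL hh
  refine isOrbitallyStable_of_isolated hr.isCompact_phaseTrace
    (U := {x | x.1 ≠ 0} ∩ {x | uCoord x.1 < uHigh L (circEnergy r)})
    ((isOpen_ne_fun continuous_fst continuous_const).inter
      (isOpen_lt (continuous_uCoord.comp continuous_fst) continuous_const))
    (fun x hx => ⟨?_, ?_⟩) (continuousOn_firstIntegrals.mono inter_subset_left)
    (fun x hx => hr.firstIntegrals_of_mem hx)
    (fun I q v hs s hs' t ht => hs.firstIntegrals_eq hs' ht) fun x hx hxe => ?_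
  · obtain ⟨t, rfl⟩ := hx
    exact hr.isStarkSolution.ne_zero t trivial
  · rw [Set.mem_ofPred_eq, hr.uCoord_of_mem hx, ← hr.uLow_eq h3.le]
    exact hlt
  · obtain ⟨q, v, hq, hv, hg⟩ := exists_globalWith_of_firstIntegrals hL hxe
    refine hr.mem_phaseTrace hL hxe ?_
    have hu : uCoord (q 0) ≤ uHigh L (circEnergy r) := by rw [hq]; exact hx.2.le
    rw [← hq, hg.u_eq_of_C1xi hL hh.le (hr.C1xi_eq h3.le).ge hu, hr.uLow_eq h3.le]

/-- Convergence of u is enough: the orbit stays in a compact part of a level set of the first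
integrals, and on this level u = r + r³ holds only on the circular orbit. -/
theorem tendsToOrbit (hr : IsCircRadius L r) (hL : L ≠ 0) {q v : ℝ → E3}
    (hg : IsGlobalWith L (circEnergy r) (circSep r) q v) (hb : IsBoundedOrbit univ q) {l : Filter ℝ}
    (hu : Tendsto (fun t => uCoord (q t)) l (𝓝 (r + r ^ 3))) :
    TendsToOrbit l q v (circPos L r) (circVel L r) := by
  set Γ := phaseTrace (circPos L r) (circVel L r) with hΓ
  obtain ⟨δ, hδ, hδq⟩ := hg.exists_le_norm hL
  obtain ⟨B, hB⟩ := isBounded_iff_forall_norm_le.1 hb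
  have hBq : ∀ t, ‖q t‖ ≤ B := fun t => hB _ ⟨t, trivial, rfl⟩
  set B' := 2 * (|circEnergy r| + 1 / δ + B) with hB'
  have hBv : ∀ t, ‖v t‖ ^ 2 ≤ B' := fun t => by
    have h1 := hg.energy_eq t
    rw [energy] at h1
    have h2 : 1 / ‖q t‖ ≤ 1 / δ := one_div_le_one_div_of_le hδ (hδq t)
    have h3 := vCoord_nonneg (q t)
    rw [vCoord] at h3
    have h4 := hBq t
    have h5 := le_abs_self (circEnergy r)
    rw [hB']; linarith
  set K₀ : Set (E3 × E3) := {x | δ ≤ ‖x.1‖ ∧ ‖x.1‖ ≤ B ∧ ‖x.2‖ ^ 2 ≤ B'} with hK₀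
  have hK₀c : IsClosed K₀ :=
    (isClosed_le continuous_const continuous_fst.norm).inter
      ((isClosed_le continuous_fst.norm continuous_const).inter
        (isClosed_le (continuous_snd.norm.pow 2) continuous_const))
  have hK₀k : IsCompact K₀ := by
    refine Metric.isCompact_of_isClosed_isBounded hK₀c ?_
    refine isBounded_iff_forall_norm_le.2 ⟨max B √B', fun x hx => ?_⟩
    rw [Prod.norm_def]
    exact max_le_max hx.2.1 (Real.le_sqrt_of_sq_le hx.2.2)
  have hGc : ContinuousOn firstIntegrals K₀ := continuousOn_firstIntegrals.mono fun x hx => by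
    have : 0 < ‖x.1‖ := hδ.trans_le hx.1
    exact norm_pos_iff.1 this
  have hK : IsCompact (K₀ ∩ firstIntegrals ⁻¹' {(L, circEnergy r, circSep r)}) :=
    hK₀k.of_isClosed_subset (hGc.preimage_isClosed_of_isClosed hK₀c isClosed_singleton)
      inter_subset_left
  have hmem : ∀ t, (q t, v t) ∈ K₀ ∩ firstIntegrals ⁻¹' {(L, circEnergy r, circSep r)} := fun t =>
    ⟨⟨hδq t, hBq t, hBv t⟩, by simp [firstIntegrals, hg.angMom_eq, hg.energy_eq, hg.lenz_eq]⟩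
  rw [TendsToOrbit, Metric.tendsto_nhds]
  intro ε hε
  have hS := hK.inter_right (isClosed_le (continuous_const (y := ε))
    (Metric.continuous_infDist_pt Γ))
  obtain ⟨m, hm, hmS⟩ : ∃ m > 0, ∀ x ∈ (K₀ ∩ firstIntegrals ⁻¹' {(L, circEnergy r, circSep r)}) ∩
      {x | ε ≤ Metric.infDist x Γ}, m ≤ dist (uCoord x.1) (r + r ^ 3) := by
    rcases Set.eq_empty_or_nonempty ((K₀ ∩ firstIntegrals ⁻¹' {(L, circEnergy r, circSep r)}) ∩
      {x | ε ≤ Metric.infDist x Γ}) with h0 | h0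
    · exact ⟨1, one_pos, by simp [h0]⟩
    · obtain ⟨x, hx, hmin⟩ := hS.exists_isMinOn h0
        (f := fun x => dist (uCoord x.1) (r + r ^ 3))
        ((continuous_uCoord.comp continuous_fst).dist continuous_const).continuousOn
      refine ⟨_, dist_pos.2 fun hx0 => ?_, fun y hy => hmin hy⟩
      have h1 : ε ≤ Metric.infDist x Γ := hx.2
      rw [Metric.infDist_zero_of_mem (hr.mem_phaseTrace hL hx.1.2 hx0)] at h1
      exact absurd hε (not_lt.2 h1)
  filter_upwards [Metric.tendsto_nhds.1 hu m hm] with t ht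
  rw [dist_zero_right, Real.norm_of_nonneg Metric.infDist_nonneg]
  by_contra! hcon
  exact absurd ht (not_lt.2 (hmS (q t, v t) ⟨hmem t, hcon⟩))

/-! ### Homoclinic orbits and instability. -/

/-- Motions on the separatrix inside the hyperbolic circular orbit are homoclinic to it. -/
theorem homoclinic (hr : IsCircRadius L r) (hL : L ≠ 0) (h3 : 1 < 3 * r ^ 2) {q v : ℝ → E3}
    (hg : IsGlobalWith L (circEnergy r) (circSep r) q v) (hu : uCoord (q 0) < r + r ^ 3) :
    IsBoundedOrbit univ q ∧ Tendsto (fun t => uCoord (q t)) atTop (𝓝 (r + r ^ 3)) ∧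
      TendsToOrbit atTop q v (circPos L r) (circVel L r) ∧
      TendsToOrbit atBot q v (circPos L r) (circVel L r) := by
  have hh := hr.circEnergy_lt hL h3.ne'
  have hM := hr.uHigh_eq hL h3.le
  have ha := third_lt_uHigh hL hh
  have hfac : ∀ c u, xiCubic L (circEnergy r) c u = (u - (r + r ^ 3)) ^ 2 *
      (u - L ^ 2 / (r + r ^ 3) ^ 2) + 2 * (c - circSep r) * u := fun c u => by
    rw [xiCubic_eq_high hL hh.le, hM, hr.C2xi_eq hL h3.le]
  rw [hM] at ha
  set M := r + r ^ 3 with hMdef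
  set a := L ^ 2 / M ^ 2 with hadef
  have hF : ∀ x, xiCubic' (circEnergy r) (circSep r) x =
      (x - a - (M - a)) ^ 2 + 2 * (x - a) * (x - a - (M - a)) := fun x => by
    have e1 := hfac (circSep r) (x + 1)
    have e2 := hfac (circSep r) (x - 1)
    rw [xiCubic] at e1 e2
    rw [xiCubic']
    linear_combination (e1 - e2) / 2
  have hp : uMom (q 0) (v 0) ^ 2 = (uCoord (q 0) - a) * (uCoord (q 0) - a - (M - a)) ^ 2 := by
    rw [hg.uMom_sq, hfac]; ring
  have hua : a ≤ uCoord (q 0) := by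
    by_contra! hcon
    have h1 : (uCoord (q 0) - a) * (uCoord (q 0) - a - (M - a)) ^ 2 < 0 :=
      mul_neg_of_neg_of_pos (by linarith) (by
        have : uCoord (q 0) - a - (M - a) ≠ 0 := by linarith
        positivity)
    nlinarith [sq_nonneg (uMom (q 0) (v 0))]
  have hmem : uCoord (q 0) ∈ Ico a (a + (M - a)) := ⟨hua, by linarith⟩
  -- The explicit profile is used twice: with any primitive τ it bounds u; boundedness then makes τ
  -- a bijection of the line, as the limits in t require.
  have hb : IsBoundedOrbit univ q := by
    obtain ⟨τ, hτ⟩ := hg.exists_tau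
    obtain ⟨N, hN, -, -, hNu⟩ := hg.motion_u.exists_homoclinic hg.continuous_rate hτ
      (sub_pos.2 ha) hF hmem hp
    refine hg.bounded_of_u_le hL (B := M) fun t => ?_
    have := hN (τ t)
    rw [← hNu] at this
    linarith
  obtain ⟨τ, hτm, hτ⟩ := hg.exists_tau_homeomorph hb
  obtain ⟨N, hN, hN1, hN2, hNu⟩ := hg.motion_u.exists_homoclinic hg.continuous_rate hτ
    (sub_pos.2 ha) hF hmem hp
  have e : (fun t => uCoord (q t)) = N ∘ τ := funext hNu
  rw [add_sub_cancel] at hN1 hN2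
  have htop : Tendsto (fun t => uCoord (q t)) atTop (𝓝 M) := by
    rw [e]
    exact hN1.comp (hτm.monotone.tendsto_atTop_atTop fun b => ⟨τ.symm b, by simp⟩)
  refine ⟨hb, htop, hr.tendsToOrbit hL hg hb htop, hr.tendsToOrbit hL hg hb ?_⟩
  · rw [e]
    exact hN2.comp (hτm.monotone.tendsto_atBot_atBot fun b => ⟨τ.symm b, by simp⟩)

theorem exists_homoclinic (hr : IsCircRadius L r) (hL : L ≠ 0) (h3 : 1 < 3 * r ^ 2) :
    ∃ q v : ℝ → E3, IsGlobalWith L (circEnergy r) (circSep r) q v ∧ uCoord (q 0) < r + r ^ 3 := by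
  have hh := hr.circEnergy_lt hL h3.ne'
  have hM := hr.uHigh_eq hL h3.le
  have ha := third_lt_uHigh hL hh
  have hM0 := uHigh_pos hL hh.le
  obtain ⟨q, v, hg, hu, -⟩ := exists_globalWith (L := L) (h := circEnergy r) (c := circSep r)
    (u := L ^ 2 / uHigh L (circEnergy r) ^ 2) (v := r - r ^ 3) (p := 0) (w := 0) hL (by positivity)
    hr.v_pos (by rw [xiCubic_eq_high hL hh.le, hr.C2xi_eq hL h3.le]; ring)
    (by rw [hr.etaCubic_circ]; ring)
  exact ⟨q, v, hg, by rw [hu, ← hM]; exact ha⟩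

theorem not_isCircular_of_homoclinic (hr : IsCircRadius L r) (hL : L ≠ 0) (h3 : 1 < 3 * r ^ 2)
    {q v : ℝ → E3} (hg : IsGlobalWith L (circEnergy r) (circSep r) q v)
    (hu : uCoord (q 0) < r + r ^ 3) : ¬ IsCircular univ q := fun hc => by
  have h1 := (hr.homoclinic hL h3 hg hu).2.1
  rw [show (fun t => uCoord (q t)) = fun _ => uCoord (q 0) from
    funext fun t => hg.uCoord_eq_of_norm_eq (hg.norm_eq_of_isCircular hL hc) t 0] at h1
  exact hu.ne (tendsto_nhds_unique tendsto_const_nhds h1)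

/-- At very negative times the homoclinic orbit is arbitrarily close to the circular one, yet at
time 0 it has a fixed positive distance, which is taken as ε. It has the same L. -/
theorem not_isOrbitallyStable (hr : IsCircRadius L r) (hL : L ≠ 0) (h3 : 1 < 3 * r ^ 2) :
    ¬ IsOrbitallyStable {p | angMom p.1 p.2 = L} (circPos L r) (circVel L r) := by
  intro hst
  obtain ⟨q, v, hg, hu⟩ := hr.exists_homoclinic hL h3
  obtain ⟨-, -, -, hbot⟩ := hr.homoclinic hL h3 hg hu
  have hne : (phaseTrace (circPos L r) (circVel L r)).Nonempty := ⟨_, mem_range_self 0⟩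
  have hnm : (q 0, v 0) ∉ phaseTrace (circPos L r) (circVel L r) := fun hmem =>
    hu.ne (hr.uCoord_of_mem (x := (q 0, v 0)) hmem)
  have hcl : IsClosed (phaseTrace (circPos L r) (circVel L r)) := hr.isCompact_phaseTrace.isClosed
  have hε := (hcl.notMem_iff_infDist_pos hne).1 hnm
  obtain ⟨δ, hδ, H⟩ := hst _ hε
  obtain ⟨T, hT, hT0⟩ := ((hbot.eventually (gt_mem_nhds hδ)).and (eventually_le_atBot 0)).exists
  have h0 : angMom (q (0 + T)) (v (0 + T)) = L := hg.angMom_eq (0 + T)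
  have h2 : Metric.infDist (q (0 + T), v (0 + T)) (phaseTrace (circPos L r) (circVel L r)) < δ := by
    rw [zero_add]; exact hT
  have h1 := H univ (fun t => q (t + T)) (fun t => v (t + T)) (hg.sol.comp_add T) (mem_univ 0) h0 h2
    (-T) (mem_univ _) (neg_nonneg.2 hT0)
  rw [neg_add_cancel] at h1
  exact lt_irrefl _ h1

end IsCircRadius

/-! ### Topology of the energy surface of two uncoupled potential wells. -/

/-- `σ` parametrizes the part of `I` below the level `R ^ 2` of the potential well `a`, in such a
way that `a` becomes the square function. -/
structure IsWellParam (I : Set ℝ) (a : ℝ → ℝ) (R : ℝ) (σ : ℝ → ℝ) : Prop where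
  continuous : Continuous σ
  mem : ∀ s ∈ Icc (-R) R, σ s ∈ I
  apply : ∀ s ∈ Icc (-R) R, a (σ s) = s ^ 2
  injOn : InjOn σ (Icc (-R) R)
  surj : ∀ x ∈ I, a x ≤ R ^ 2 → ∃ s ∈ Icc (-R) R, σ s = x
  nonneg : ∀ x ∈ I, 0 ≤ a x

/-- σ is the inverse of the signed root, -√a left of m and √a right of it, which increases strictly
from [α, β] onto [-R, R]. Projection to [-R, R] extends σ continuously to the line. -/
theorem exists_isWellParam {I : Set ℝ} (hI : I.OrdConnected) {a : ℝ → ℝ} {α m β R : ℝ}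
    (hα : α ∈ I) (hβ : β ∈ I) (hαm : α ≤ m) (hmβ : m ≤ β) (hR : 0 ≤ R) (ha : ContinuousOn a I)
    (hanti : StrictAntiOn a (I ∩ Iic m)) (hmono : StrictMonoOn a (I ∩ Ici m)) (ham : a m = 0)
    (haα : a α = R ^ 2) (haβ : a β = R ^ 2) : ∃ σ, IsWellParam I a R σ := by
  have hsub : Icc α β ⊆ I := hI.out hα hβ
  have hm : m ∈ I := hsub ⟨hαm, hmβ⟩
  have hnn : ∀ x ∈ I, 0 ≤ a x := fun x hx => by
    rw [← ham]
    rcases le_total x m with h | h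
    · exact hanti.antitoneOn ⟨hx, h⟩ ⟨hm, le_refl m⟩ h
    · exact hmono.monotoneOn ⟨hm, le_refl m⟩ ⟨hx, h⟩ h
  have hle : ∀ x ∈ Icc α β, a x ≤ R ^ 2 := fun x hx => by
    rcases le_total x m with h | h
    · rw [← haα]
      exact hanti.antitoneOn ⟨hα, hαm⟩ ⟨hsub hx, h⟩ hx.1
    · rw [← haβ]
      exact hmono.monotoneOn ⟨hsub hx, h⟩ ⟨hβ, hmβ⟩ hx.2
  set s : ℝ → ℝ := fun x => if x ≤ m then -√(a x) else √(a x) with hs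
  have hs2 : ∀ x ∈ I, s x ^ 2 = a x := fun x hx => by
    by_cases h : x ≤ m <;> simp [hs, h, Real.sq_sqrt (hnn x hx)]
  have hsR : ∀ x ∈ Icc α β, s x ∈ Icc (-R) R := fun x hx =>
    abs_le.1 (abs_le_of_sq_le_sq (by rw [hs2 x (hsub hx)]; exact hle x hx) hR)
  have hsm : StrictMonoOn s (Icc α β) := by
    intro x hx y hy hxy
    by_cases h1 : x ≤ m <;> by_cases h2 : y ≤ m
    · simp only [hs, h1, h2, if_true]
      exact neg_lt_neg (Real.sqrt_lt_sqrt (hnn y (hsub hy)) (hanti ⟨hsub hx, h1⟩ ⟨hsub hy, h2⟩ hxy))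
    · simp only [hs, h1, h2, if_true, if_false]
      have : 0 < √(a y) := Real.sqrt_pos.2
        (by rw [← ham]; exact hmono ⟨hm, le_refl m⟩ ⟨hsub hy, (not_le.1 h2).le⟩ (not_le.1 h2))
      have := Real.sqrt_nonneg (a x)
      linarith
    · exact absurd (hxy.le.trans h2) h1
    · simp only [hs, h1, h2, if_false]
      exact Real.sqrt_lt_sqrt (hnn x (hsub hx))
        (hmono ⟨hsub hx, (not_le.1 h1).le⟩ ⟨hsub hy, (not_le.1 h2).le⟩ hxy)
  have hss : ∀ t ∈ Icc (-R) R, ∃ x ∈ Icc α β, s x = t := fun t ht => by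
    have ht2 : t ^ 2 ≤ R ^ 2 := sq_le_sq' ht.1 ht.2
    rcases le_or_gt t 0 with h | h
    · obtain ⟨x, hx, hxt⟩ := intermediate_value_Icc' hαm
        (ha.mono ((Icc_subset_Icc_right hmβ).trans hsub)) (show t ^ 2 ∈ Icc (a m) (a α) by
          rw [ham, haα]; exact ⟨sq_nonneg t, ht2⟩)
      refine ⟨x, ⟨hx.1, hx.2.trans hmβ⟩, ?_⟩
      simp only [hs, hx.2, if_true, hxt, Real.sqrt_sq_eq_abs, abs_of_nonpos h, neg_neg]
    · obtain ⟨x, hx, hxt⟩ := intermediate_value_Icc hmβ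
        (ha.mono ((Icc_subset_Icc_left hαm).trans hsub)) (show t ^ 2 ∈ Icc (a m) (a β) by
          rw [ham, haβ]; exact ⟨sq_nonneg t, ht2⟩)
      refine ⟨x, ⟨hαm.trans hx.1, hx.2⟩, ?_⟩
      have hxm : ¬ x ≤ m := fun hxm => by
        have : x = m := le_antisymm hxm hx.1
        rw [this, ham] at hxt
        exact (pow_pos h 2).ne hxt
      simp only [hs, hxm, if_false, hxt, Real.sqrt_sq_eq_abs, abs_of_pos h]
  have hRR : -R ≤ R := by linarith
  set S : Icc α β → Icc (-R) R := fun x => ⟨s x, hsR x x.2⟩ with hS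
  have hSm : StrictMono S := fun x y hxy => hsm x.2 y.2 hxy
  have hSs : Function.Surjective S := fun t => by
    obtain ⟨x, hx, hxt⟩ := hss t t.2
    exact ⟨⟨x, hx⟩, Subtype.ext hxt⟩
  set e := StrictMono.orderIsoOfSurjective S hSm hSs with he
  set σ : ℝ → ℝ := fun t => (e.symm (projIcc (-R) R hRR t) : ℝ) with hσ
  have hσs : ∀ t ∈ Icc (-R) R, σ t ∈ Icc α β ∧ s (σ t) = t := fun t ht => by
    refine ⟨(e.symm _).2, ?_⟩
    have h1 : S (e.symm (projIcc (-R) R hRR t)) = projIcc (-R) R hRR t := e.apply_symm_apply _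
    have h2 := congrArg Subtype.val h1
    rw [projIcc_of_mem hRR ht] at h2
    simpa only [hσ, projIcc_of_mem hRR ht] using h2
  refine ⟨σ, ?_, fun t ht => hsub (hσs t ht).1, fun t ht => ?_, fun t ht t' ht' hh => ?_,
    fun x hx hxR => ?_, hnn⟩
  · exact continuous_subtype_val.comp (e.symm.continuous.comp continuous_projIcc)
  · rw [← hs2 _ (hsub (hσs t ht).1), (hσs t ht).2]
  · rw [← (hσs t ht).2, hh, (hσs t' ht').2]
  · have hx' : x ∈ Icc α β := by
      constructor
      · by_contra! hcon
        have := hanti ⟨hx, (hcon.le.trans hαm : x ≤ m)⟩ ⟨hα, hαm⟩ hcon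
        linarith
      · by_contra! hcon
        have := hmono ⟨hβ, hmβ⟩ ⟨hx, (hmβ.trans hcon.le : m ≤ x)⟩ hcon
        linarith
    exact ⟨s x, hsR x hx', hsm.injOn (hσs _ (hsR x hx')).1 hx' (hσs _ (hsR x hx')).2⟩

/-- A continuous injection of a compact space is a homeomorphism onto its range. -/
theorem nonempty_homeomorph_of_range_eq {X Y : Type*} [TopologicalSpace X] [CompactSpace X]
    [TopologicalSpace Y] [T2Space Y] {f : X → Y} (hf : Continuous f) (hi : Function.Injective f)
    {S : Set Y} (hS : range f = S) : Nonempty (S ≃ₜ X) := by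
  subst hS
  exact ⟨(hf.isClosedEmbedding hi).isEmbedding.toHomeomorph.symm⟩

theorem Circle.ext_re_im {z w : Circle} (h1 : (z : ℂ).re = (w : ℂ).re)
    (h2 : (z : ℂ).im = (w : ℂ).im) : z = w := Circle.ext (Complex.ext h1 h2)

theorem Circle.re_sq_add_im_sq (z : Circle) : (z : ℂ).re ^ 2 + (z : ℂ).im ^ 2 = 1 := by
  have := Circle.normSq_coe z
  rw [Complex.normSq_apply] at this
  linarith

theorem Circle.exists_re_im {X Y : ℝ} (h : X ^ 2 + Y ^ 2 = 1) :
    ∃ z : Circle, (z : ℂ).re = X ∧ (z : ℂ).im = Y := by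
  have hz : (⟨X, Y⟩ : ℂ) ∈ Submonoid.unitSphere ℂ := by
    refine mem_sphere_zero_iff_norm.2 ?_
    rw [← sq_eq_sq₀ (norm_nonneg _) zero_le_one, ← Complex.normSq_eq_norm_sq,
      Complex.normSq_apply]
    simp only; linarith
  exact ⟨⟨⟨X, Y⟩, hz⟩, rfl, rfl⟩

namespace IsWellParam

variable {I J : Set ℝ} {a b : ℝ → ℝ} {R e : ℝ} {σ ρ : ℝ → ℝ}

/-- The closed curve `p ^ 2 / 2 + a x = e` in a potential well. -/
noncomputable def curve (σ : ℝ → ℝ) (e : ℝ) (z : Circle) : ℝ × ℝ :=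
  (σ (√e * (z : ℂ).re), √(2 * e) * (z : ℂ).im)

theorem continuous_curve (hσ : IsWellParam I a R σ) : Continuous (curve σ e) := by
  have h1 : Continuous fun z : Circle => (z : ℂ).re := Complex.continuous_re.comp continuous_subtype_val
  have h2 : Continuous fun z : Circle => (z : ℂ).im := Complex.continuous_im.comp continuous_subtype_val
  exact (hσ.continuous.comp (continuous_const.mul h1)).prodMk (continuous_const.mul h2)

theorem mul_re_mem (hR : 0 ≤ R) (he0 : 0 ≤ e) (he : e ≤ R ^ 2) (z : Circle) :
    √e * (z : ℂ).re ∈ Icc (-R) R := by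
  refine abs_le.1 (abs_le_of_sq_le_sq ?_ hR)
  rw [mul_pow, Real.sq_sqrt he0]
  have := Circle.re_sq_add_im_sq z
  nlinarith [sq_nonneg (z : ℂ).im]

theorem injective_curve (hσ : IsWellParam I a R σ) (hR : 0 ≤ R) (he0 : 0 < e) (he : e ≤ R ^ 2) :
    Function.Injective (curve σ e) := fun z w hzw => by
  have h1 := hσ.injOn (mul_re_mem hR he0.le he z) (mul_re_mem hR he0.le he w) (congrArg Prod.fst hzw)
  have h2 : √(2 * e) * (z : ℂ).im = √(2 * e) * (w : ℂ).im := congrArg Prod.snd hzw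
  exact Circle.ext_re_im (mul_left_cancel₀ (by positivity) h1) (mul_left_cancel₀ (by positivity) h2)

theorem curve_mem (hσ : IsWellParam I a R σ) (hR : 0 ≤ R) (he0 : 0 ≤ e) (he : e ≤ R ^ 2) (z : Circle) :
    (curve σ e z).1 ∈ I ∧ (curve σ e z).2 ^ 2 / 2 + a (curve σ e z).1 = e := by
  have h1 := mul_re_mem hR he0 he z
  refine ⟨hσ.mem _ h1, ?_⟩
  simp only [curve]
  rw [hσ.apply _ h1, mul_pow, mul_pow, Real.sq_sqrt he0, Real.sq_sqrt (by positivity)]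
  linear_combination e * Circle.re_sq_add_im_sq z

theorem exists_curve_eq (hσ : IsWellParam I a R σ) (he : e ≤ R ^ 2) {x p : ℝ} (hx : x ∈ I)
    (hp : p ^ 2 / 2 + a x = e) : ∃ z, curve σ e z = (x, p) := by
  have hax := hσ.nonneg x hx
  obtain ⟨s, hs, rfl⟩ := hσ.surj x hx (by nlinarith [sq_nonneg p])
  rw [hσ.apply s hs] at hp hax
  rcases (by nlinarith [sq_nonneg p] : 0 ≤ e).eq_or_lt with he0 | he0
  · subst he0
    have h1 : s = 0 := by nlinarith [sq_nonneg p, sq_nonneg s]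
    have h2 : p = 0 := by nlinarith [sq_nonneg p, sq_nonneg s]
    exact ⟨1, by simp [curve, h1, h2]⟩
  · obtain ⟨z, h1, h2⟩ := Circle.exists_re_im (X := s / √e) (Y := p / √(2 * e)) (by
      rw [div_pow, div_pow, Real.sq_sqrt he0.le, Real.sq_sqrt (by positivity)]
      field_simp
      linarith)
    refine ⟨z, ?_⟩
    rw [curve, h1, h2, mul_div_cancel₀ _ (by positivity), mul_div_cancel₀ _ (by positivity)]

/-- The energy surface of two uncoupled potential wells. -/
def surface (I J : Set ℝ) (a b : ℝ → ℝ) (E : ℝ) : Set (ℝ × ℝ × ℝ × ℝ) :=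
  {p | p.1 ∈ I ∧ p.2.1 ∈ J ∧ p.2.2.1 ^ 2 / 2 + p.2.2.2 ^ 2 / 2 + a p.1 + b p.2.1 = E}

/-- The part of the energy surface on which the first well has energy `e`. -/
def level (I J : Set ℝ) (a b : ℝ → ℝ) (E e : ℝ) : Set (ℝ × ℝ × ℝ × ℝ) :=
  {p ∈ surface I J a b E | p.2.2.1 ^ 2 / 2 + a p.1 = e}

/-- On this level the wells have the separate energies e and R² - e, so it is a product of two
closed curves. A curve shrinks to a point when its energy is 0, which gives the two circles below.
-/
theorem level_homeomorph_torus (hσ : IsWellParam I a R σ) (hρ : IsWellParam J b R ρ) (hR : 0 ≤ R)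
    (he0 : 0 < e) (he : e < R ^ 2) : Nonempty (level I J a b (R ^ 2) e ≃ₜ Circle × Circle) := by
  have he' : 0 < R ^ 2 - e := sub_pos.2 he
  have he1 : R ^ 2 - e ≤ R ^ 2 := by linarith
  have c1 : Continuous fun z : Circle × Circle => curve σ e z.1 := hσ.continuous_curve.comp continuous_fst
  have c2 : Continuous fun z : Circle × Circle => curve ρ (R ^ 2 - e) z.2 :=
    hρ.continuous_curve.comp continuous_snd
  refine nonempty_homeomorph_of_range_eq (f := fun z : Circle × Circle => ((curve σ e z.1).1,
    (curve ρ (R ^ 2 - e) z.2).1, (curve σ e z.1).2, (curve ρ (R ^ 2 - e) z.2).2))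
    (c1.fst.prodMk (c2.fst.prodMk (c1.snd.prodMk c2.snd))) ?_ ?_
  · intro z w hzw
    simp only [Prod.mk.injEq] at hzw
    exact Prod.ext (hσ.injective_curve hR he0 he.le (Prod.ext hzw.1 hzw.2.2.1))
      (hρ.injective_curve hR he' he1 (Prod.ext hzw.2.1 hzw.2.2.2))
  · ext ⟨x, y, p, w⟩
    constructor
    · rintro ⟨z, hz⟩
      simp only [Prod.mk.injEq] at hz
      obtain ⟨rfl, rfl, rfl, rfl⟩ := hz
      obtain ⟨h1, h2⟩ := hσ.curve_mem hR he0.le he.le z.1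
      obtain ⟨h3, h4⟩ := hρ.curve_mem hR he'.le he1 z.2
      exact ⟨⟨h1, h3, by simp only; linarith⟩, h2⟩
    · rintro ⟨⟨h1, h2, h3⟩, h4⟩
      simp only at h1 h2 h3 h4
      obtain ⟨z, hz⟩ := hσ.exists_curve_eq he.le h1 h4
      obtain ⟨z', hz'⟩ := hρ.exists_curve_eq (p := w) he1 h2 (by linarith)
      exact ⟨(z, z'), by simp only [hz, hz']⟩

theorem level_zero_homeomorph_circle (hσ : IsWellParam I a R σ) (hρ : IsWellParam J b R ρ)
    (hR : 0 < R) : Nonempty (level I J a b (R ^ 2) 0 ≃ₜ Circle) := by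
  have c2 : Continuous (curve ρ (R ^ 2)) := hρ.continuous_curve
  refine nonempty_homeomorph_of_range_eq (f := fun z : Circle => ((curve σ 0 1).1,
    (curve ρ (R ^ 2) z).1, (curve σ 0 1).2, (curve ρ (R ^ 2) z).2))
    (continuous_const.prodMk (c2.fst.prodMk (continuous_const.prodMk c2.snd))) ?_ ?_
  · intro z w hzw
    simp only [Prod.mk.injEq, true_and] at hzw
    exact hρ.injective_curve hR.le (by positivity) le_rfl (Prod.ext hzw.1 hzw.2)
  · ext ⟨x, y, p, w⟩
    constructor
    · rintro ⟨z, hz⟩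
      simp only [Prod.mk.injEq] at hz
      obtain ⟨rfl, rfl, rfl, rfl⟩ := hz
      obtain ⟨h1, h2⟩ := hσ.curve_mem hR.le le_rfl (sq_nonneg R) 1
      obtain ⟨h3, h4⟩ := hρ.curve_mem hR.le (sq_nonneg R) le_rfl z
      exact ⟨⟨h1, h3, by simp only; linarith⟩, h2⟩
    · rintro ⟨⟨h1, h2, h3⟩, h4⟩
      simp only at h1 h2 h3 h4
      obtain ⟨z, hz⟩ := hσ.exists_curve_eq (sq_nonneg R) h1 h4
      have hz1 : curve σ 0 1 = (x, p) := by rw [← hz]; simp [curve]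
      obtain ⟨z', hz'⟩ := hρ.exists_curve_eq (p := w) le_rfl h2 (by linarith)
      exact ⟨z', by simp only [hz1, hz']⟩

theorem level_sq_homeomorph_circle (hσ : IsWellParam I a R σ) (hρ : IsWellParam J b R ρ)
    (hR : 0 < R) : Nonempty (level I J a b (R ^ 2) (R ^ 2) ≃ₜ Circle) := by
  have c2 : Continuous (curve σ (R ^ 2)) := hσ.continuous_curve
  refine nonempty_homeomorph_of_range_eq (f := fun z : Circle => ((curve σ (R ^ 2) z).1,
    (curve ρ 0 1).1, (curve σ (R ^ 2) z).2, (curve ρ 0 1).2))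
    (c2.fst.prodMk (continuous_const.prodMk (c2.snd.prodMk continuous_const))) ?_ ?_
  · intro z w hzw
    simp only [Prod.mk.injEq, true_and, and_true] at hzw
    exact hσ.injective_curve hR.le (by positivity) le_rfl (Prod.ext hzw.1 hzw.2)
  · ext ⟨x, y, p, w⟩
    constructor
    · rintro ⟨z, hz⟩
      simp only [Prod.mk.injEq] at hz
      obtain ⟨rfl, rfl, rfl, rfl⟩ := hz
      obtain ⟨h1, h2⟩ := hρ.curve_mem hR.le le_rfl (sq_nonneg R) 1
      obtain ⟨h3, h4⟩ := hσ.curve_mem hR.le (sq_nonneg R) le_rfl z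
      exact ⟨⟨h3, h1, by simp only; linarith⟩, h4⟩
    · rintro ⟨⟨h1, h2, h3⟩, h4⟩
      simp only at h1 h2 h3 h4
      obtain ⟨z, hz⟩ := hρ.exists_curve_eq (e := 0) (p := w) (sq_nonneg R) h2 (by linarith)
      have hz1 : curve ρ 0 1 = (y, w) := by rw [← hz]; simp [curve]
      obtain ⟨z', hz'⟩ := hσ.exists_curve_eq le_rfl h1 h4
      exact ⟨z', by simp only [hz1, hz']⟩

/-- The energy surface is an image of the three-sphere. -/
theorem surface_eq_image (hσ : IsWellParam I a R σ) (hρ : IsWellParam J b R ρ) (hR : 0 ≤ R) :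
    surface I J a b (R ^ 2) = (fun x : EuclideanSpace ℝ (Fin 4) =>
      (σ (x 0), ρ (x 1), √2 * x 2, √2 * x 3)) '' Metric.sphere 0 R := by
  have hmem : ∀ x : EuclideanSpace ℝ (Fin 4), x ∈ Metric.sphere (0 : EuclideanSpace ℝ (Fin 4)) R ↔
      x 0 ^ 2 + x 1 ^ 2 + x 2 ^ 2 + x 3 ^ 2 = R ^ 2 := fun x => by
    rw [mem_sphere_zero_iff_norm, ← sq_eq_sq₀ (norm_nonneg x) hR, EuclideanSpace.norm_sq_eq]
    simp [Fin.sum_univ_four]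
  have h2 : √2 ^ 2 = (2 : ℝ) := Real.sq_sqrt zero_le_two
  have h20 : √2 ≠ 0 := by positivity
  ext ⟨x, y, p, w⟩
  constructor
  · rintro ⟨h1, h2', h3⟩
    simp only at h1 h2' h3
    have hx := hσ.nonneg x h1
    have hy := hρ.nonneg y h2'
    obtain ⟨s, hs, rfl⟩ := hσ.surj x h1 (by nlinarith [sq_nonneg p, sq_nonneg w])
    obtain ⟨t, ht, rfl⟩ := hρ.surj y h2' (by nlinarith [sq_nonneg p, sq_nonneg w])
    rw [hσ.apply s hs, hρ.apply t ht] at h3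
    -- In the parameters the energy equation reads s² + t² + p²/2 + w²/2 = R², so dividing the
    -- momenta by √2 gives a point of the sphere.
    refine ⟨!₂[s, t, p / √2, w / √2], (hmem _).2 ?_, ?_⟩
    · simp [div_pow, h2]; linarith
    · simp [mul_div_cancel₀ _ h20]
  · rintro ⟨x, hx, he⟩
    rw [hmem] at hx
    simp only [Prod.mk.injEq] at he
    obtain ⟨rfl, rfl, rfl, rfl⟩ := he
    have h0 : x 0 ∈ Icc (-R) R := abs_le.1 (abs_le_of_sq_le_sq (by
      nlinarith [sq_nonneg (x 1), sq_nonneg (x 2), sq_nonneg (x 3)]) hR)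
    have h1 : x 1 ∈ Icc (-R) R := abs_le.1 (abs_le_of_sq_le_sq (by
      nlinarith [sq_nonneg (x 0), sq_nonneg (x 2), sq_nonneg (x 3)]) hR)
    refine ⟨hσ.mem _ h0, hρ.mem _ h1, ?_⟩
    simp only
    rw [hσ.apply _ h0, hρ.apply _ h1, mul_pow, mul_pow, h2]
    linarith

theorem continuous_sphere_map (hσ : IsWellParam I a R σ) (hρ : IsWellParam J b R ρ) :
    Continuous fun x : EuclideanSpace ℝ (Fin 4) => (σ (x 0), ρ (x 1), √2 * x 2, √2 * x 3) := by
  have := hσ.continuous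
  have := hρ.continuous
  fun_prop

theorem isCompact_surface (hσ : IsWellParam I a R σ) (hρ : IsWellParam J b R ρ) (hR : 0 ≤ R) :
    IsCompact (surface I J a b (R ^ 2)) := by
  rw [hσ.surface_eq_image hρ hR]
  exact (isCompact_sphere _ _).image (hσ.continuous_sphere_map hρ)

theorem isConnected_surface (hσ : IsWellParam I a R σ) (hρ : IsWellParam J b R ρ) (hR : 0 ≤ R) :
    IsConnected (surface I J a b (R ^ 2)) := by
  rw [hσ.surface_eq_image hρ hR]
  refine (isConnected_sphere ?_ _ hR).image _ (hσ.continuous_sphere_map hρ).continuousOn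
  rw [← Module.finrank_eq_rank, finrank_euclideanSpace_fin]
  norm_num

end IsWellParam

/-- The energy surface over an unbounded interval, on which the potential decreases to `-∞`, is a
graph over the other three variables. -/
theorem exists_graph {a b : ℝ → ℝ} {J : Set ℝ} {k E : ℝ} (ha : ContinuousOn a (Ici k))
    (hanti : StrictAntiOn a (Ici k)) (hlim : ∀ C, ∃ x ≥ k, a x ≤ C) (hk : E < a k)
    (hb : ContinuousOn b J) (hb0 : ∀ y ∈ J, 0 ≤ b y) :
    ∃ φ : ℝ × ℝ × ℝ → ℝ, ContinuousOn φ (J ×ˢ univ) ∧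
      IsWellParam.surface (Ioi k) J a b E = (fun x => (φ x, x)) '' (J ×ˢ univ) := by
  -- M extends -a from (k, ∞) to a strictly increasing bijection of the whole line, so that its
  -- inverse is continuous everywhere.
  set M : ℝ → ℝ := fun x => -a (max x k) + min (x - k) 0 with hM
  have hMm : StrictMono M := fun x y hxy => by
    have h1 : max x k ≤ max y k := max_le_max hxy.le le_rfl
    have h2 : a (max y k) ≤ a (max x k) := hanti.antitoneOn (le_max_right x k) (le_max_right y k) h1
    have h3 : min (x - k) 0 ≤ min (y - k) 0 := min_le_min (by linarith) le_rfl
    rcases lt_or_ge x k with h | h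
    · have h4 : min (x - k) 0 < min (y - k) 0 := by
        rw [min_eq_left (by linarith : x - k ≤ 0)]
        exact lt_min (by linarith) (by linarith)
      simp only [hM]; linarith
    · have h4 : a (max y k) < a (max x k) := hanti (le_max_right x k) (le_max_right y k) (by
        rw [max_eq_left h, max_eq_left (h.trans hxy.le)]; exact hxy)
      simp only [hM]; linarith
  have hMc : Continuous M :=
    (ha.comp_continuous (continuous_id.max continuous_const) fun x => le_max_right x k).neg.add
      ((continuous_id.sub continuous_const).min continuous_const)
  have hMs : Function.Surjective M := fun C => by
    refine mem_range_of_exists_le_of_exists_ge hMc ⟨min k (k + C + a k), ?_⟩ ?_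
    · have h1 : min k (k + C + a k) ≤ k := min_le_left _ _
      have h2 : min k (k + C + a k) ≤ k + C + a k := min_le_right _ _
      simp only [hM, max_eq_right h1]
      have := min_le_left (min k (k + C + a k) - k) 0
      linarith
    · obtain ⟨x, hx, hxC⟩ := hlim (-C)
      refine ⟨x, ?_⟩
      simp only [hM, max_eq_left hx, min_eq_right (sub_nonneg.2 hx)]
      linarith
  set e := StrictMono.orderIsoOfSurjective M hMm hMs with he
  have heM : ∀ y, M (e.symm y) = y := fun y => e.apply_symm_apply y
  have hMk : M k = -a k := by simp [hM]
  have hMx : ∀ x > k, M x = -a x := fun x hx => by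
    simp only [hM, max_eq_left hx.le, min_eq_right (sub_nonneg.2 hx.le), add_zero]
  set G : ℝ × ℝ × ℝ → ℝ := fun x => x.2.1 ^ 2 / 2 + x.2.2 ^ 2 / 2 + b x.1 - E with hG
  have hGc : ContinuousOn G (J ×ˢ univ) := by
    have h1 : ContinuousOn (fun x : ℝ × ℝ × ℝ => b x.1) (J ×ˢ univ) :=
      hb.comp continuous_fst.continuousOn fun x hx => hx.1
    exact ((by fun_prop : Continuous fun x : ℝ × ℝ × ℝ =>
      x.2.1 ^ 2 / 2 + x.2.2 ^ 2 / 2).continuousOn.add h1).sub continuousOn_const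
  refine ⟨fun x => e.symm (G x), e.symm.continuous.comp_continuousOn hGc, ?_⟩
  ext ⟨x, y, p, w⟩
  constructor
  · rintro ⟨h1, h2, h3⟩
    refine ⟨(y, p, w), ⟨h2, trivial⟩, ?_⟩
    have : e.symm (G (y, p, w)) = x := hMm.injective (by
      rw [heM, hMx x h1]; simp only [hG]; simp only at h3; linarith)
    simp only [this]
  · rintro ⟨⟨y', p', w'⟩, ⟨h1, -⟩, h2⟩
    simp only [Prod.mk.injEq] at h2
    obtain ⟨rfl, rfl, rfl, rfl⟩ := h2
    have hx : k < e.symm (G (y', p', w')) := by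
      rw [← hMm.lt_iff_lt, heM, hMk]
      have := hb0 y' h1
      simp only [hG]
      nlinarith [sq_nonneg p', sq_nonneg w']
    refine ⟨hx, h1, ?_⟩
    have h3 := heM (G (y', p', w'))
    rw [hMx _ hx] at h3
    simp only
    rw [show a (e.symm (G (y', p', w'))) = -G (y', p', w') by linarith]
    simp only [hG]; ring

/-- Connected components of a set that two disjoint open sets cut into connected pieces. -/
theorem componentsOf_eq_pair {X : Type*} [TopologicalSpace X] {E U V : Set X} (hU : IsOpen U)
    (hV : IsOpen V) (hUV : Disjoint U V) (hE : E ⊆ U ∪ V) (hEU : IsConnected (E ∩ U))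
    (hEV : IsConnected (E ∩ V)) : componentsOf E = {E ∩ U, E ∩ V} := by
  have key : ∀ U V : Set X, IsOpen U → IsOpen V → Disjoint U V → E ⊆ U ∪ V → IsConnected (E ∩ U) →
      ∀ p ∈ E ∩ U, connectedComponentIn E p = E ∩ U := fun U V hU hV hUV hE hEU p hp => by
    refine Subset.antisymm (subset_inter (connectedComponentIn_subset E p) ?_)
      (hEU.isPreconnected.subset_connectedComponentIn hp inter_subset_left)
    exact isPreconnected_connectedComponentIn.subset_left_of_subset_union hU hV hUV
      ((connectedComponentIn_subset E p).trans hE) ⟨p, mem_connectedComponentIn hp.1, hp.2⟩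
  have hE' : E ⊆ V ∪ U := by rwa [union_comm]
  ext K
  constructor
  · rintro ⟨p, hp, rfl⟩
    rcases hE hp with h | h
    · exact Or.inl (key U V hU hV hUV hE hEU p ⟨hp, h⟩)
    · exact Or.inr (key V U hV hU hUV.symm hE' hEV p ⟨hp, h⟩)
  · rintro (rfl | rfl)
    · obtain ⟨p, hp⟩ := hEU.nonempty
      exact ⟨p, hp.1, (key U V hU hV hUV hE hEU p hp).symm⟩
    · obtain ⟨p, hp⟩ := hEV.nonempty
      exact ⟨p, hp.1, (key V U hV hU hUV.symm hE' hEV p hp).symm⟩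

/-! ### The wells of ξ and η. -/

/-- The potential of the `ξ`-motion, as a function of `u = ξ ^ 2`. -/
noncomputable def xiWell (L h u : ℝ) : ℝ := L ^ 2 / (2 * u) - h * u - 1 - u ^ 2 / 2

/-- The potential of the `η`-motion, as a function of `v = η ^ 2`. -/
noncomputable def etaWell (L h v : ℝ) : ℝ := 1 + h * v - v ^ 2 / 2 - L ^ 2 / (2 * v)

theorem xiCubic_eq_well (L h c : ℝ) {u : ℝ} (hu : u ≠ 0) :
    xiCubic L h c u = 2 * u * (c - xiWell L h u) := by
  rw [xiCubic, xiWell]; field_simp; ring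

theorem etaCubic_eq_well (L h c : ℝ) {v : ℝ} (hv : v ≠ 0) :
    etaCubic L h c v = 2 * v * (etaWell L h v - c) := by
  rw [etaCubic, etaWell]; field_simp; ring

theorem xiWell_eq_of_root {L h c u : ℝ} (hu : u ≠ 0) (hf : xiCubic L h c u = 0) :
    xiWell L h u = c := by
  rw [xiCubic_eq_well L h c hu] at hf
  have := (mul_eq_zero.1 hf).resolve_left (mul_ne_zero two_ne_zero hu)
  linarith

theorem etaWell_eq_of_root {L h c v : ℝ} (hv : v ≠ 0) (hf : etaCubic L h c v = 0) :
    etaWell L h v = c := by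
  rw [etaCubic_eq_well L h c hv] at hf
  have := (mul_eq_zero.1 hf).resolve_left (mul_ne_zero two_ne_zero hv)
  linarith

theorem hasDerivAt_xiWell (L h : ℝ) {u : ℝ} (hu : 0 < u) :
    HasDerivAt (xiWell L h) (-(2 * u ^ 3 + 2 * h * u ^ 2 + L ^ 2) / (2 * u ^ 2)) u := by
  have h1 := (hasDerivAt_const u (L ^ 2)).div ((hasDerivAt_id u).const_mul 2) (by simpa using hu.ne')
  refine (((h1.sub ((hasDerivAt_id u).const_mul h)).sub_const 1).sub
    (((hasDerivAt_id u).pow 2).div_const 2)).congr_deriv ?_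
  simp; field_simp; ring

theorem hasDerivAt_etaWell (L h : ℝ) {v : ℝ} (hv : 0 < v) :
    HasDerivAt (etaWell L h) (-(2 * v ^ 3 - 2 * h * v ^ 2 - L ^ 2) / (2 * v ^ 2)) v := by
  have h1 := (hasDerivAt_const v (L ^ 2)).div ((hasDerivAt_id v).const_mul 2) (by simpa using hv.ne')
  refine (((((hasDerivAt_id v).const_mul h).const_add 1).sub
    (((hasDerivAt_id v).pow 2).div_const 2)).sub h1).congr_deriv ?_
  simp; field_simp; ring

theorem continuousOn_xiWell (L h : ℝ) : ContinuousOn (xiWell L h) (Ioi 0) := fun _ hu =>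
  (hasDerivAt_xiWell L h hu).continuousAt.continuousWithinAt

theorem continuousOn_etaWell (L h : ℝ) : ContinuousOn (etaWell L h) (Ioi 0) := fun _ hv =>
  (hasDerivAt_etaWell L h hv).continuousAt.continuousWithinAt

/-- Factorization of the numerator of the derivative of `xiWell`. -/
theorem exists_xi_factor {L h : ℝ} (hL : L ≠ 0) (hh : h ≤ hTop L) :
    ∃ k > 0, ∀ u, 2 * u ^ 3 + 2 * h * u ^ 2 + L ^ 2 =
      2 * (u - uLow L h) * (u - uHigh L h) * (u + k) := by
  have hm := (uLow_spec hL hh).1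
  have hM := uHigh_pos hL hh
  have hrel := double_relation hL hh
  have he := (uLow_spec hL hh).2.2
  set m := uLow L h
  set M := uHigh L h
  have hL2 : L ^ 2 = 2 * m ^ 2 * M ^ 2 / (m + M) := by field_simp; linarith
  have hh' : h = -(m ^ 2 + m * M + M ^ 2) / (m + M) := by
    rw [hL2] at he
    field_simp at he ⊢
    have : m ^ 2 * (h * (m + M) + (m ^ 2 + m * M + M ^ 2)) = 0 := by linear_combination he / 2
    have := (mul_eq_zero.1 this).resolve_left (by positivity)
    linarith
  -- The cubic has no linear term, so the third root -k satisfies mM = k(m + M).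
  refine ⟨m * M / (m + M), by positivity, fun u => ?_⟩
  rw [hL2, hh']
  field_simp
  ring

theorem xiWell_strictAntiOn_low {L h : ℝ} (hL : L ≠ 0) (hh : h ≤ hTop L) :
    StrictAntiOn (xiWell L h) (Ioc 0 (uLow L h)) := by
  obtain ⟨k, hk, hf⟩ := exists_xi_factor hL hh
  have hmM := uLow_le_uHigh hL hh
  refine strictAntiOn_of_deriv_neg (convex_Ioc _ _)
    ((continuousOn_xiWell L h).mono fun u hu => hu.1) fun u hu => ?_
  rw [interior_Ioc] at hu
  have hu0 := hu.1
  rw [(hasDerivAt_xiWell L h hu0).deriv, hf]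
  refine div_neg_of_neg_of_pos (neg_neg_of_pos ?_) (by positivity)
  have := mul_pos (sub_pos.2 hu.2) (sub_pos.2 (hu.2.trans_le hmM))
  have : 0 < (u - uLow L h) * (u - uHigh L h) := by nlinarith
  have h3 : 0 < u + k := by linarith
  have := mul_pos this h3
  linarith

theorem xiWell_strictMonoOn {L h : ℝ} (hL : L ≠ 0) (hh : h ≤ hTop L) :
    StrictMonoOn (xiWell L h) (Icc (uLow L h) (uHigh L h)) := by
  obtain ⟨k, hk, hf⟩ := exists_xi_factor hL hh
  have hm := (uLow_spec hL hh).1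
  refine strictMonoOn_of_deriv_pos (convex_Icc _ _)
    ((continuousOn_xiWell L h).mono fun u hu => hm.trans_le hu.1) fun u hu => ?_
  rw [interior_Icc] at hu
  have hu0 := hm.trans hu.1
  rw [(hasDerivAt_xiWell L h hu0).deriv, hf]
  refine div_pos (neg_pos.2 ?_) (by positivity)
  have := mul_pos (sub_pos.2 hu.1) (sub_pos.2 hu.2)
  have := mul_pos this (by linarith : 0 < u + k)
  linarith

theorem xiWell_strictAntiOn_high {L h : ℝ} (hL : L ≠ 0) (hh : h ≤ hTop L) :
    StrictAntiOn (xiWell L h) (Ici (uHigh L h)) := by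
  obtain ⟨k, hk, hf⟩ := exists_xi_factor hL hh
  have hmM := uLow_le_uHigh hL hh
  have hM := uHigh_pos hL hh
  refine strictAntiOn_of_deriv_neg (convex_Ici _)
    ((continuousOn_xiWell L h).mono fun u hu => hM.trans_le hu) fun u hu => ?_
  rw [interior_Ici] at hu
  have hu0 : 0 < u := hM.trans hu
  rw [(hasDerivAt_xiWell L h hu0).deriv, hf]
  refine div_neg_of_neg_of_pos (neg_neg_of_pos ?_) (by positivity)
  have h1 := mul_pos (sub_pos.2 (hmM.trans_lt hu)) (sub_pos.2 hu)
  have := mul_pos h1 (by linarith : 0 < u + k)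
  linarith

/-- Factorization of the numerator of the derivative of `etaWell`. -/
theorem exists_eta_factor {L : ℝ} (hL : L ≠ 0) (h : ℝ) : ∀ v > 0, ∃ k > 0,
    2 * v ^ 3 - 2 * h * v ^ 2 - L ^ 2 = (v - vDouble L h) * k := fun v hv => by
  obtain ⟨hd, he⟩ := vDouble_spec hL h
  set d := vDouble L h
  refine ⟨2 * v ^ 2 + L ^ 2 / d ^ 2 * v + L ^ 2 / d, by positivity, ?_⟩
  have hh' : h = (2 * d ^ 3 - L ^ 2) / (2 * d ^ 2) := by field_simp; linarith
  rw [hh']; field_simp; ring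

theorem etaWell_strictMonoOn {L : ℝ} (hL : L ≠ 0) (h : ℝ) :
    StrictMonoOn (etaWell L h) (Ioc 0 (vDouble L h)) := by
  refine strictMonoOn_of_deriv_pos (convex_Ioc _ _)
    ((continuousOn_etaWell L h).mono fun u hu => hu.1) fun u hu => ?_
  rw [interior_Ioc] at hu
  have hu0 := hu.1
  obtain ⟨k, hk, hf⟩ := exists_eta_factor hL h u hu0
  rw [(hasDerivAt_etaWell L h hu0).deriv, hf]
  refine div_pos ?_ (by positivity)
  have := mul_pos (sub_pos.2 hu.2) hk
  linarith

theorem etaWell_strictAntiOn {L : ℝ} (hL : L ≠ 0) (h : ℝ) :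
    StrictAntiOn (etaWell L h) (Ici (vDouble L h)) := by
  have hd := (vDouble_spec hL h).1
  refine strictAntiOn_of_deriv_neg (convex_Ici _)
    ((continuousOn_etaWell L h).mono fun u hu => hd.trans_le hu) fun u hu => ?_
  rw [interior_Ici] at hu
  have hu0 : 0 < u := hd.trans hu
  obtain ⟨k, hk, hf⟩ := exists_eta_factor hL h u hu0
  rw [(hasDerivAt_etaWell L h hu0).deriv, hf]
  refine div_neg_of_neg_of_pos (neg_neg_of_pos (mul_pos (sub_pos.2 hu) hk)) (by positivity)

theorem xiWell_uLow {L h : ℝ} (hL : L ≠ 0) (hh : h ≤ hTop L) : xiWell L h (uLow L h) = C1xi L h :=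
  xiWell_eq_of_root (uLow_spec hL hh).1.ne' (by rw [xiCubic_low hL hh]; ring)

theorem xiWell_uHigh {L h : ℝ} (hL : L ≠ 0) (hh : h ≤ hTop L) : xiWell L h (uHigh L h) = C2xi L h :=
  xiWell_eq_of_root (uHigh_pos hL hh).ne' (by rw [xiCubic_high hL hh]; ring)

theorem etaWell_vDouble {L : ℝ} (hL : L ≠ 0) (h : ℝ) : etaWell L h (vDouble L h) = Ceta L h :=
  etaWell_eq_of_root (vDouble_spec hL h).1.ne' (by rw [etaCubic_vDouble hL]; ring)

theorem exists_xiWell_le (L h C k : ℝ) : ∃ u ≥ k, xiWell L h u ≤ C := by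
  set B := L ^ 2 / 2 + |C| with hB
  have hB0 : 0 ≤ B := by positivity
  have hk := le_abs_self k
  have hk0 := abs_nonneg k
  have hh0 := abs_nonneg h
  -- From here on u² / 2 absorbs |h|u + Bu, and Bu ≥ B = L² / 2 + |C| pays for the remaining terms;
  -- |k| takes care of u ≥ k.
  refine ⟨2 * (|h| + B) + 1 + |k|, by linarith, ?_⟩
  set u := 2 * (|h| + B) + 1 + |k| with hu
  have hu1 : 1 ≤ u := by linarith
  have h1 : L ^ 2 / (2 * u) ≤ L ^ 2 / 2 :=
    div_le_div_of_nonneg_left (sq_nonneg L) two_pos (by linarith)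
  have h2 : -h * u ≤ |h| * u := mul_le_mul_of_nonneg_right (neg_le_abs h) (by linarith)
  have h3 := neg_abs_le C
  have h4 : (|h| + B) * u ≤ u / 2 * u := mul_le_mul_of_nonneg_right (by linarith) (by linarith)
  have h5 : B ≤ B * u := le_mul_of_one_le_right hB0 hu1
  rw [xiWell]
  linarith

theorem sq_strictMonoOn : StrictMonoOn (fun x : ℝ => x ^ 2) (Ici 0) := fun _ hx _ _ hxy =>
  pow_lt_pow_left₀ hxy hx two_ne_zero

/-- The total energy `Ceta` - `C1xi` lies below the barrier `C2xi` - `C1xi` at `uHigh`, so the well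
closes: its ends are the roots of the smaller two roots u₁, u₂ of f for c = `Ceta`. -/
theorem exists_xi_isWellParam {L h : ℝ} (hL : L ≠ 0) (hh : h < hTop L) (h1 : C1xi L h < Ceta L h)
    (h2 : Ceta L h < C2xi L h) : ∃ σ, IsWellParam (Ioo 0 √(uHigh L h))
      (fun x => xiWell L h (x ^ 2) - C1xi L h) √(Ceta L h - C1xi L h) σ := by
  obtain ⟨u₁, u₂, u₃, h01, h12, h23, h34, h45, hf⟩ := exists_xi_roots hL hh.le h1 h2
  have hm := (uLow_spec hL hh.le).1
  have hM := uHigh_pos hL hh.le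
  have hE := sub_nonneg.2 h1.le
  refine exists_isWellParam (α := √u₁) (m := √(uLow L h)) (β := √u₂) ordConnected_Ioo
    ⟨by positivity, Real.sqrt_lt_sqrt h01.le (h12.trans (h23.trans h34))⟩
    ⟨Real.sqrt_pos.2 (hm.trans h23), Real.sqrt_lt_sqrt (hm.trans h23).le h34⟩
    (Real.sqrt_le_sqrt h12.le) (Real.sqrt_le_sqrt h23.le) (Real.sqrt_nonneg _) ?_ ?_ ?_ ?_ ?_ ?_
  · refine ContinuousOn.sub ((continuousOn_xiWell L h).comp (by fun_prop) fun x hx => ?_)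
      continuousOn_const
    exact pow_pos hx.1 2
  · intro x hx y hy hxy
    refine sub_lt_sub_right (xiWell_strictAntiOn_low hL hh.le ?_ ?_ ?_) _
    · exact ⟨pow_pos hx.1.1 2, (Real.le_sqrt hx.1.1.le hm.le).1 hx.2⟩
    · exact ⟨pow_pos hy.1.1 2, (Real.le_sqrt hy.1.1.le hm.le).1 hy.2⟩
    · exact sq_strictMonoOn hx.1.1.le hy.1.1.le hxy
  · intro x hx y hy hxy
    refine sub_lt_sub_right (xiWell_strictMonoOn hL hh.le ?_ ?_ ?_) _
    · exact ⟨(Real.sqrt_le_left hx.1.1.le).1 hx.2, ((Real.lt_sqrt hx.1.1.le).1 hx.1.2).le⟩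
    · exact ⟨(Real.sqrt_le_left hy.1.1.le).1 hy.2, ((Real.lt_sqrt hy.1.1.le).1 hy.1.2).le⟩
    · exact sq_strictMonoOn hx.1.1.le hy.1.1.le hxy
  · rw [Real.sq_sqrt hm.le, xiWell_uLow hL hh.le, sub_self]
  · rw [Real.sq_sqrt h01.le, Real.sq_sqrt hE, xiWell_eq_of_root h01.ne' (by rw [hf]; ring)]
  · rw [Real.sq_sqrt (hm.trans h23).le, Real.sq_sqrt hE,
      xiWell_eq_of_root (hm.trans h23).ne' (by rw [hf]; ring)]

theorem exists_eta_isWellParam {L h : ℝ} (hL : L ≠ 0) (h1 : C1xi L h < Ceta L h) :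
    ∃ ρ, IsWellParam (Ioi 0) (fun y => Ceta L h - etaWell L h (y ^ 2)) √(Ceta L h - C1xi L h) ρ := by
  obtain ⟨v₁, v₂, v₃, -, h02, h23, h34, hf⟩ := exists_eta_roots hL h h1
  have hd := (vDouble_spec hL h).1
  have hE := sub_nonneg.2 h1.le
  refine exists_isWellParam (α := √v₂) (m := √(vDouble L h)) (β := √v₃) ordConnected_Ioi
    (Real.sqrt_pos.2 h02) (Real.sqrt_pos.2 (hd.trans h34))
    (Real.sqrt_le_sqrt h23.le) (Real.sqrt_le_sqrt h34.le) (Real.sqrt_nonneg _) ?_ ?_ ?_ ?_ ?_ ?_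
  · refine continuousOn_const.sub ((continuousOn_etaWell L h).comp (by fun_prop) fun x hx => ?_)
    exact pow_pos (show (0 : ℝ) < x from hx) 2
  · intro x hx y hy hxy
    have hx0 : (0 : ℝ) < x := hx.1
    have hy0 : (0 : ℝ) < y := hy.1
    refine sub_lt_sub_left (etaWell_strictMonoOn hL h ?_ ?_ ?_) _
    · exact ⟨pow_pos hx0 2, (Real.le_sqrt hx0.le hd.le).1 hx.2⟩
    · exact ⟨pow_pos hy0 2, (Real.le_sqrt hy0.le hd.le).1 hy.2⟩
    · exact sq_strictMonoOn hx0.le hy0.le hxy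
  · intro x hx y hy hxy
    have hx0 : (0 : ℝ) < x := hx.1
    have hy0 : (0 : ℝ) < y := hy.1
    refine sub_lt_sub_left (etaWell_strictAntiOn hL h ?_ ?_ ?_) _
    · exact (Real.sqrt_le_left hx0.le).1 hx.2
    · exact (Real.sqrt_le_left hy0.le).1 hy.2
    · exact sq_strictMonoOn hx0.le hy0.le hxy
  · rw [Real.sq_sqrt hd.le, etaWell_vDouble hL, sub_self]
  · rw [Real.sq_sqrt h02.le, Real.sq_sqrt hE, etaWell_eq_of_root h02.ne' (by rw [hf]; ring)]
  · rw [Real.sq_sqrt (hd.trans h34).le, Real.sq_sqrt hE,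
      etaWell_eq_of_root (hd.trans h34).ne' (by rw [hf]; ring)]

/-- Multiplication by ξ² + η² uncouples the Hamiltonian. -/
theorem redEnergy_eq_iff {L h x y p w : ℝ} (hx : 0 < x) (hy : 0 < y) :
    redEnergy L (x, y, p, w) = h ↔
      p ^ 2 / 2 + w ^ 2 / 2 + xiWell L h (x ^ 2) = etaWell L h (y ^ 2) := by
  have hxy : 0 < x ^ 2 + y ^ 2 := by positivity
  have key : (x ^ 2 + y ^ 2) * (redEnergy L (x, y, p, w) - h) =
      p ^ 2 / 2 + w ^ 2 / 2 + xiWell L h (x ^ 2) - etaWell L h (y ^ 2) := by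
    simp only [redEnergy, xiWell, etaWell]
    field_simp
    ring
  rw [← sub_eq_zero, ← sub_eq_zero (b := etaWell L h (y ^ 2)), ← key, mul_eq_zero]
  exact (or_iff_right hxy.ne').symm

theorem redSep_eq {L h x y p w : ℝ} (hx : 0 < x) (hH : redEnergy L (x, y, p, w) = h) :
    redSep L (x, y, p, w) = p ^ 2 / 2 + xiWell L h (x ^ 2) := by
  simp only [redSep, hH, xiWell]
  field_simp
  ring

/-! ### The energy surface for `C1xi` < `Ceta` < `C2xi`. -/

/-- The part of the energy surface that lies inside the maximum of the potential of `ξ`. -/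
def innerSurface (L h : ℝ) : Set (ℝ × ℝ × ℝ × ℝ) :=
  energySurface L h ∩ {p | p.1 < √(uHigh L h)}

/-- The part of the energy surface that lies outside the maximum of the potential of `ξ`. -/
def outerSurface (L h : ℝ) : Set (ℝ × ℝ × ℝ × ℝ) :=
  energySurface L h ∩ {p | √(uHigh L h) < p.1}

theorem mem_energySurface_iff {L h : ℝ} (p : ℝ × ℝ × ℝ × ℝ) : p ∈ energySurface L h ↔
    0 < p.1 ∧ 0 < p.2.1 ∧ p.2.2.1 ^ 2 / 2 + p.2.2.2 ^ 2 / 2 + (xiWell L h (p.1 ^ 2) - C1xi L h) +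
      (Ceta L h - etaWell L h (p.2.1 ^ 2)) = Ceta L h - C1xi L h := by
  obtain ⟨x, y, p, w⟩ := p
  constructor
  · rintro ⟨hx, hy, hH⟩
    exact ⟨hx, hy, by linarith [(redEnergy_eq_iff hx hy).1 hH]⟩
  · rintro ⟨hx, hy, hH⟩
    exact ⟨hx, hy, (redEnergy_eq_iff hx hy).2 (by simp only at hH; linarith)⟩

theorem innerSurface_eq (L h : ℝ) : innerSurface L h =
    IsWellParam.surface (Ioo 0 √(uHigh L h)) (Ioi 0) (fun x => xiWell L h (x ^ 2) - C1xi L h)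
      (fun y => Ceta L h - etaWell L h (y ^ 2)) (Ceta L h - C1xi L h) := by
  ext p
  rw [innerSurface, mem_inter_iff, mem_energySurface_iff]
  exact ⟨fun ⟨⟨h1, h2, h3⟩, h4⟩ => ⟨⟨h1, h4⟩, h2, h3⟩, fun ⟨⟨h1, h4⟩, h2, h3⟩ => ⟨⟨h1, h2, h3⟩, h4⟩⟩

theorem outerSurface_eq (L h : ℝ) : outerSurface L h =
    IsWellParam.surface (Ioi √(uHigh L h)) (Ioi 0) (fun x => xiWell L h (x ^ 2) - C1xi L h)
      (fun y => Ceta L h - etaWell L h (y ^ 2)) (Ceta L h - C1xi L h) := by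
  ext p
  rw [outerSurface, mem_inter_iff, mem_energySurface_iff]
  exact ⟨fun ⟨⟨_, h2, h3⟩, h4⟩ => ⟨h4, h2, h3⟩,
    fun ⟨h4, h2, h3⟩ => ⟨⟨(Real.sqrt_nonneg _).trans_lt h4, h2, h3⟩, h4⟩⟩

theorem sepLevel_innerSurface (L h c : ℝ) : sepLevel L (innerSurface L h) c =
    IsWellParam.level (Ioo 0 √(uHigh L h)) (Ioi 0) (fun x => xiWell L h (x ^ 2) - C1xi L h)
      (fun y => Ceta L h - etaWell L h (y ^ 2)) (Ceta L h - C1xi L h) (c - C1xi L h) := by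
  ext ⟨x, y, p, w⟩
  rw [sepLevel, IsWellParam.level, ← innerSurface_eq]
  refine and_congr_right fun hp => ?_
  rw [redSep_eq hp.1.1 hp.1.2.2]
  simp only
  constructor <;> intro h <;> linarith

theorem isCompact_innerSurface {L h : ℝ} (hL : L ≠ 0) (hh : h < hTop L) (h1 : C1xi L h < Ceta L h)
    (h2 : Ceta L h < C2xi L h) : IsCompact (innerSurface L h) := by
  obtain ⟨σ, hσ⟩ := exists_xi_isWellParam hL hh h1 h2
  obtain ⟨ρ, hρ⟩ := exists_eta_isWellParam hL h1
  have := hσ.isCompact_surface hρ (Real.sqrt_nonneg _)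
  rwa [Real.sq_sqrt (sub_nonneg.2 h1.le), ← innerSurface_eq] at this

theorem isConnected_innerSurface {L h : ℝ} (hL : L ≠ 0) (hh : h < hTop L)
    (h1 : C1xi L h < Ceta L h) (h2 : Ceta L h < C2xi L h) : IsConnected (innerSurface L h) := by
  obtain ⟨σ, hσ⟩ := exists_xi_isWellParam hL hh h1 h2
  obtain ⟨ρ, hρ⟩ := exists_eta_isWellParam hL h1
  have := hσ.isConnected_surface hρ (Real.sqrt_nonneg _)
  rwa [Real.sq_sqrt (sub_nonneg.2 h1.le), ← innerSurface_eq] at this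

theorem exists_outerSurface_graph {L h : ℝ} (hL : L ≠ 0) (hh : h < hTop L)
    (h1 : C1xi L h < Ceta L h) (h2 : Ceta L h < C2xi L h) :
    ∃ φ : ℝ × ℝ × ℝ → ℝ, ContinuousOn φ (Ioi 0 ×ˢ univ) ∧
      outerSurface L h = (fun x => (φ x, x)) '' (Ioi 0 ×ˢ univ) := by
  obtain ⟨ρ, hρ⟩ := exists_eta_isWellParam hL h1
  have hM := uHigh_pos hL hh.le
  rw [outerSurface_eq]
  refine exists_graph ?_ ?_ (fun C => ?_) ?_ ?_ hρ.nonneg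
  · refine ContinuousOn.sub ((continuousOn_xiWell L h).comp (by fun_prop) fun x hx => ?_)
      continuousOn_const
    exact pow_pos ((Real.sqrt_pos.2 hM).trans_le hx) 2
  · intro x hx y hy hxy
    have hx0 : 0 ≤ x := (Real.sqrt_nonneg _).trans hx
    have hy0 : 0 ≤ y := (Real.sqrt_nonneg _).trans hy
    exact sub_lt_sub_right (xiWell_strictAntiOn_high hL hh.le ((Real.sqrt_le_left hx0).1 hx)
      ((Real.sqrt_le_left hy0).1 hy) (sq_strictMonoOn hx0 hy0 hxy)) _
  · obtain ⟨u, hu, huC⟩ := exists_xiWell_le L h (C + C1xi L h) (uHigh L h)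
    refine ⟨√u, Real.sqrt_le_sqrt hu, ?_⟩
    rw [Real.sq_sqrt (hM.le.trans hu)]
    linarith
  · rw [Real.sq_sqrt hM.le, xiWell_uHigh hL hh.le]
    linarith
  · refine continuousOn_const.sub ((continuousOn_etaWell L h).comp (by fun_prop) fun x hx => ?_)
    exact pow_pos (show (0 : ℝ) < x from hx) 2

theorem isConnected_outerSurface {L h : ℝ} (hL : L ≠ 0) (hh : h < hTop L)
    (h1 : C1xi L h < Ceta L h) (h2 : Ceta L h < C2xi L h) : IsConnected (outerSurface L h) := by
  obtain ⟨φ, hφ, he⟩ := exists_outerSurface_graph hL hh h1 h2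
  rw [he]
  exact (isConnected_Ioi.prod isConnected_univ).image _ (hφ.prodMk continuousOn_id)

/-- The graph projects onto the whole line of values of ξ'. -/
theorem not_isCompact_outerSurface {L h : ℝ} (hL : L ≠ 0) (hh : h < hTop L)
    (h1 : C1xi L h < Ceta L h) (h2 : Ceta L h < C2xi L h) : ¬ IsCompact (outerSurface L h) := fun hc => by
  obtain ⟨φ, -, he⟩ := exists_outerSurface_graph hL hh h1 h2
  refine noncompact_univ ℝ ?_
  convert hc.image (f := fun p : ℝ × ℝ × ℝ × ℝ => p.2.2.1) (by fun_prop)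
  refine (eq_univ_of_forall fun p => ?_).symm
  refine ⟨(φ (1, p, 0), 1, p, 0), ?_, rfl⟩
  rw [he]
  exact ⟨(1, p, 0), ⟨show (0 : ℝ) < 1 from one_pos, trivial⟩, rfl⟩

theorem componentsOf_energySurface {L h : ℝ} (hL : L ≠ 0) (hh : h < hTop L)
    (h1 : C1xi L h < Ceta L h) (h2 : Ceta L h < C2xi L h) :
    componentsOf (energySurface L h) = {innerSurface L h, outerSurface L h} := by
  obtain ⟨ρ, hρ⟩ := exists_eta_isWellParam hL h1
  refine componentsOf_eq_pair (isOpen_lt continuous_fst continuous_const)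
    (isOpen_lt continuous_const continuous_fst) ?_ (fun p hp => ?_)
    (isConnected_innerSurface hL hh h1 h2) (isConnected_outerSurface hL hh h1 h2)
  · exact disjoint_left.2 fun p hp hp' => lt_asymm (show p.1 < √(uHigh L h) from hp) hp'
  · rcases lt_trichotomy p.1 √(uHigh L h) with h3 | h3 | h3
    · exact Or.inl h3
    -- No point lies over ξ² = `uHigh`: the well of ξ alone would contribute `C2xi` - `C1xi`, more
    -- than the total energy.
    · obtain ⟨-, hy, he⟩ := (mem_energySurface_iff p).1 hp
      rw [h3, Real.sq_sqrt (uHigh_pos hL hh.le).le, xiWell_uHigh hL hh.le] at he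
      have := hρ.nonneg _ hy
      nlinarith [sq_nonneg p.2.2.1, sq_nonneg p.2.2.2]
    · exact Or.inr h3

theorem ncard_componentsOf_energySurface {L h : ℝ} (hL : L ≠ 0) (hh : h < hTop L)
    (h1 : C1xi L h < Ceta L h) (h2 : Ceta L h < C2xi L h) :
    (componentsOf (energySurface L h)).ncard = 2 := by
  rw [componentsOf_energySurface hL hh h1 h2, ncard_pair fun he => ?_]
  exact not_isCompact_outerSurface hL hh h1 h2 (he ▸ isCompact_innerSurface hL hh h1 h2)

theorem innerSurface_eq_iUnion {L h : ℝ} (hL : L ≠ 0) (hh : h < hTop L)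
    (h1 : C1xi L h < Ceta L h) (h2 : Ceta L h < C2xi L h) :
    innerSurface L h = ⋃ c ∈ Icc (C1xi L h) (Ceta L h), sepLevel L (innerSurface L h) c := by
  obtain ⟨σ, hσ⟩ := exists_xi_isWellParam hL hh h1 h2
  obtain ⟨ρ, hρ⟩ := exists_eta_isWellParam hL h1
  ext ⟨x, y, p, w⟩
  constructor
  · intro hp
    refine mem_biUnion (x := redSep L (x, y, p, w)) ?_ ⟨hp, rfl⟩
    rw [redSep_eq hp.1.1 hp.1.2.2]
    obtain ⟨hx, hy, he⟩ := (mem_energySurface_iff _).1 hp.1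
    have h3 := hσ.nonneg _ ⟨hx, hp.2⟩
    have h4 := hρ.nonneg _ hy
    simp only at h3 h4 he
    constructor <;> nlinarith [sq_nonneg p, sq_nonneg w]
  · intro hp
    obtain ⟨c, -, hc⟩ := mem_iUnion₂.1 hp
    exact hc.1

theorem sepLevel_homeomorph_torus {L h c : ℝ} (hL : L ≠ 0) (hh : h < hTop L)
    (h2 : Ceta L h < C2xi L h) (hc : c ∈ Ioo (C1xi L h) (Ceta L h)) :
    Nonempty (sepLevel L (innerSurface L h) c ≃ₜ Circle × Circle) := by
  have h1 := hc.1.trans hc.2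
  obtain ⟨σ, hσ⟩ := exists_xi_isWellParam hL hh h1 h2
  obtain ⟨ρ, hρ⟩ := exists_eta_isWellParam hL h1
  have hs := Real.sq_sqrt (sub_nonneg.2 h1.le)
  have := hσ.level_homeomorph_torus hρ (e := c - C1xi L h) (Real.sqrt_nonneg _) (sub_pos.2 hc.1)
    (by rw [hs]; linarith [hc.2])
  rwa [hs, ← sepLevel_innerSurface] at this

theorem sepLevel_C1xi_homeomorph {L h : ℝ} (hL : L ≠ 0) (hh : h < hTop L)
    (h1 : C1xi L h < Ceta L h) (h2 : Ceta L h < C2xi L h) :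
    Nonempty (sepLevel L (innerSurface L h) (C1xi L h) ≃ₜ Circle) := by
  obtain ⟨σ, hσ⟩ := exists_xi_isWellParam hL hh h1 h2
  obtain ⟨ρ, hρ⟩ := exists_eta_isWellParam hL h1
  have := hσ.level_zero_homeomorph_circle hρ (Real.sqrt_pos.2 (sub_pos.2 h1))
  rw [sepLevel_innerSurface, sub_self]
  rwa [Real.sq_sqrt (sub_nonneg.2 h1.le)] at this

theorem sepLevel_Ceta_homeomorph {L h : ℝ} (hL : L ≠ 0) (hh : h < hTop L)
    (h1 : C1xi L h < Ceta L h) (h2 : Ceta L h < C2xi L h) :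
    Nonempty (sepLevel L (innerSurface L h) (Ceta L h) ≃ₜ Circle) := by
  obtain ⟨σ, hσ⟩ := exists_xi_isWellParam hL hh h1 h2
  obtain ⟨ρ, hρ⟩ := exists_eta_isWellParam hL h1
  have := hσ.level_sq_homeomorph_circle hρ (Real.sqrt_pos.2 (sub_pos.2 h1))
  rwa [Real.sq_sqrt (sub_nonneg.2 h1.le), ← sepLevel_innerSurface] at this

/-! ### Orbits on the energy surface. -/

namespace IsGlobalWith

variable {L h c : ℝ} {q v : ℝ → E3}

theorem parabolicState_mem_iff (hL : L ≠ 0) (hg : IsGlobalWith L h c q v) (t : ℝ) :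
    parabolicState (q t) (v t) ∈ innerSurface L h ↔ uCoord (q t) < uHigh L h := by
  have hn := hg.angMom_ne hL t
  have hE := redEnergy_parabolicState hn
  rw [hg.angMom_eq, hg.energy_eq] at hE
  have hmem : parabolicState (q t) (v t) ∈ energySurface L h := ⟨xi_pos hn, eta_pos hn, hE⟩
  exact (and_iff_right hmem).trans (Real.sqrt_lt_sqrt_iff (uCoord_nonneg _))

theorem redSep_parabolicState (hL : L ≠ 0) (hg : IsGlobalWith L h c q v) (t : ℝ) :
    redSep L (parabolicState (q t) (v t)) = c := by
  have := sepConst_eq_lenz (hg.angMom_ne hL t)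
  rwa [sepConst, hg.angMom_eq, hg.lenz_eq] at this

theorem isBounded_iff_mem_innerSurface (hL : L ≠ 0) (hg : IsGlobalWith L h c q v) (hh : h ≤ hTop L)
    (h2 : Ceta L h < C2xi L h) :
    IsBoundedOrbit univ q ↔ ∀ t, parabolicState (q t) (v t) ∈ innerSurface L h := by
  have hc := (hg.le_Ceta hL).trans_lt h2
  constructor
  · intro hb t
    exact (hg.parabolicState_mem_iff hL t).2 (hg.u_lt_uHigh hL hh hc (hg.u_le_uHigh hL hb t) t)
  · intro H
    exact hg.bounded_of_u_le hL fun t => ((hg.parabolicState_mem_iff hL t).1 (H t)).le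

theorem mem_sepLevel_of_mem {c' : ℝ} (hL : L ≠ 0) (hg : IsGlobalWith L h c' q v) (hh : h ≤ hTop L)
    (h2 : Ceta L h < C2xi L h) {t₀ : ℝ}
    (hm : parabolicState (q t₀) (v t₀) ∈ sepLevel L (innerSurface L h) c) (t : ℝ) :
    parabolicState (q t) (v t) ∈ sepLevel L (innerSurface L h) c := by
  have hc := (hg.le_Ceta hL).trans_lt h2
  refine ⟨(hg.parabolicState_mem_iff hL t).2
    (hg.u_lt_uHigh hL hh hc ((hg.parabolicState_mem_iff hL t₀).1 hm.1).le t), ?_⟩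
  rw [hg.redSep_parabolicState hL, ← hm.2, hg.redSep_parabolicState hL]

end IsGlobalWith

/-! ### Assembly of the classification. -/

theorem IsOrbitWith.not_isBounded_of_Ceta_lt {L h c : ℝ} (hL : L ≠ 0) (hC : Ceta L h < C1xi L h)
    {I : Set ℝ} {q v : ℝ → E3} (ho : IsOrbitWith L h c I q v) : ¬ IsBoundedOrbit I q := fun hb => by
  obtain ⟨rfl, hg⟩ := ho.global hL
  have h1 := hg.C1xi_le hL (hg.le_hTop hL hb) (hg.u_le_uHigh hL hb 0)
  have h2 := hg.le_Ceta hL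
  linarith

/-- At a circular orbit with `C_{1,ξ} = C_η`, every bounded orbit is the circular one. -/
theorem IsCircRadius.eq_of_isBounded {L r c : ℝ} (hr : IsCircRadius L r) (hL : L ≠ 0)
    (h3 : 3 * r ^ 2 ≤ 1) {I : Set ℝ} {q v : ℝ → E3} (ho : IsOrbitWith L (circEnergy r) c I q v)
    (hb : IsBoundedOrbit I q) :
    c = circSep r ∧ IsTimeShiftOf I q v (circPos L r) (circVel L r) := by
  obtain ⟨rfl, hg⟩ := ho.global hL
  have hu := hg.u_le_uHigh hL hb 0
  have h1 := hg.C1xi_le hL hr.circEnergy_le hu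
  have h2 := hg.le_Ceta hL
  rw [hr.C1xi_eq h3] at h1
  rw [hr.Ceta_eq] at h2
  obtain rfl := le_antisymm h2 h1
  refine ⟨rfl, hr.isTimeShiftOf_of_uCoord hL hg (t := 0) ?_⟩
  rw [hg.u_eq_of_C1xi hL hr.circEnergy_le (hr.C1xi_eq h3).ge hu, hr.uLow_eq h3]

theorem IsCircRadius.circEnergy_eq {L r : ℝ} (hr : IsCircRadius L r) (hL : L ≠ 0)
    (h3 : 3 * r ^ 2 = 1) : circEnergy r = hTop L :=
  hTop_eq_of_uLow_eq hL hr.circEnergy_le (by rw [hr.uLow_eq h3.le, hr.uHigh_eq hL h3.ge])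

/-- Along bounded orbits with `c < C_η`, `η` is periodic; those with `C_{1,ξ} < c < C_{2,ξ}` oscillate. -/
theorem IsOrbitWith.oscillates {L h c : ℝ} (hL : L ≠ 0) (hc : c < Ceta L h) {I : Set ℝ}
    {q v : ℝ → E3} (ho : IsOrbitWith L h c I q v) (hb : IsBoundedOrbit I q) :
    IsTauPeriodic eta I q ∧ (c ∈ Ioo (C1xi L h) (C2xi L h) → IsOscillatory I q) := by
  obtain ⟨rfl, hg⟩ := ho.global hL
  have h1 := hg.isTauPeriodic_eta hL hb hc
  exact ⟨h1, fun hc' => hg.isOscillatory hL (hg.isTauPeriodic_xi hL hb hc'.1 hc'.2) h1⟩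

theorem theorem5 (L : ℝ) (hL : L ≠ 0) :
    -- angular momentum, energy and separation constant are first integrals
    (∀ (I : Set ℝ) (q v : ℝ → E3), IsStarkSolution I q v →
      (∃ t ∈ I, angMom (q t) (v t) = L) → ∃ h c, HasConstants I q v L h c) ∧
    -- (a)
    (∀ h c : ℝ, critL2 < L ^ 2 ∨ hTop L < h →
      ∀ (I : Set ℝ) (q v : ℝ → E3), IsOrbitWith L h c I q v → ¬ IsBoundedOrbit I q) ∧
    -- (b)
    (L ^ 2 = critL2 →
      (∃ q₀ v₀ : ℝ → E3,
        IsOrbitWith L (hTop L) (-1 / 9) univ q₀ v₀ ∧ IsCircular univ q₀ ∧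
        ∀ (c : ℝ) (I : Set ℝ) (q v : ℝ → E3), IsOrbitWith L (hTop L) c I q v →
          IsBoundedOrbit I q → c = -1 / 9 ∧ IsTimeShiftOf I q v q₀ v₀) ∧
      (∀ h c : ℝ, h < hTop L →
        ∀ (I : Set ℝ) (q v : ℝ → E3), IsOrbitWith L h c I q v → ¬ IsBoundedOrbit I q)) ∧
    -- (c)
    (L ^ 2 < critL2 → ∃ h₁ h₂ : ℝ, h₁ < h₂ ∧ h₂ < hTop L ∧
      (∀ h ≤ hTop L, C1xi L h = Ceta L h ↔ h = h₁) ∧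
      (∀ h ≤ hTop L, C2xi L h = Ceta L h ↔ h = h₂) ∧
      -- below the lower threshold
      (∀ h c : ℝ, h < h₁ →
        ∀ (I : Set ℝ) (q v : ℝ → E3), IsOrbitWith L h c I q v → ¬ IsBoundedOrbit I q) ∧
      -- (c1)
      (∀ h : ℝ, h₂ < h → h ≤ hTop L →
        (∀ c : ℝ, ExistsBoundedOrbit L h c ↔ c ∈ Icc (C1xi L h) (C2xi L h)) ∧
        (∀ (c : ℝ) (I : Set ℝ) (q v : ℝ → E3), IsOrbitWith L h c I q v → IsBoundedOrbit I q →
          IsTauPeriodic eta I q ∧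
            (c ∈ Ioo (C1xi L h) (C2xi L h) → IsOscillatory I q)) ∧
        (∀ (c : ℝ) (I : Set ℝ) (q v : ℝ → E3), IsOrbitWith L h c I q v → ¬ IsCircular I q)) ∧
      -- (c2)
      ((∀ c : ℝ, ExistsBoundedOrbit L h₂ c ↔ c ∈ Icc (C1xi L h₂) (C2xi L h₂)) ∧
        (∀ (c : ℝ) (I : Set ℝ) (q v : ℝ → E3), c < C2xi L h₂ → IsOrbitWith L h₂ c I q v →
          IsBoundedOrbit I q →
          IsTauPeriodic eta I q ∧ (C1xi L h₂ < c → IsOscillatory I q)) ∧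
        ∃ q₀ v₀ : ℝ → E3,
          IsOrbitWith L h₂ (C2xi L h₂) univ q₀ v₀ ∧ IsCircular univ q₀ ∧
          (∀ t, IsXiHyperbolic L h₂ (C2xi L h₂) (xi (q₀ t)) ∧
            IsEtaDouble L h₂ (C2xi L h₂) (eta (q₀ t))) ∧
          ¬ IsOrbitallyStable {p | angMom p.1 p.2 = L} q₀ v₀ ∧
          (∃ q v : ℝ → E3, IsOrbitWith L h₂ (C2xi L h₂) univ q v ∧ ¬ IsCircular univ q ∧
            TendsToOrbit atTop q v q₀ v₀ ∧ TendsToOrbit atBot q v q₀ v₀) ∧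
          (∀ (I : Set ℝ) (q v : ℝ → E3), IsOrbitWith L h₂ (C2xi L h₂) I q v →
            IsBoundedOrbit I q → IsTimeShiftOf I q v q₀ v₀ ∨
              (I = univ ∧ TendsToOrbit atTop q v q₀ v₀ ∧ TendsToOrbit atBot q v q₀ v₀))) ∧
      -- (c3)
      (∀ h ∈ Ioo h₁ h₂,
        (componentsOf (energySurface L h)).ncard = 2 ∧
        (∀ c : ℝ, ExistsBoundedOrbit L h c ↔ c ∈ Icc (C1xi L h) (Ceta L h)) ∧
        ∃ K ∈ componentsOf (energySurface L h), IsCompact K ∧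
          (∀ K' ∈ componentsOf (energySurface L h), IsCompact K' → K' = K) ∧
          (K = ⋃ c ∈ Icc (C1xi L h) (Ceta L h), sepLevel L K c) ∧
          (∀ c ∈ Ioo (C1xi L h) (Ceta L h),
            Nonempty (sepLevel L K c ≃ₜ Circle × Circle)) ∧
          Nonempty (sepLevel L K (C1xi L h) ≃ₜ Circle) ∧
          Nonempty (sepLevel L K (Ceta L h) ≃ₜ Circle) ∧
          (∀ (c c' : ℝ) (I : Set ℝ) (q v : ℝ → E3), IsOrbitWith L h c' I q v →
            (∃ t ∈ I, parabolicState (q t) (v t) ∈ sepLevel L K c) →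
              I = univ ∧ ∀ t, parabolicState (q t) (v t) ∈ sepLevel L K c) ∧
          (∀ (c : ℝ) (I : Set ℝ) (q v : ℝ → E3), IsOrbitWith L h c I q v →
            (IsBoundedOrbit I q ↔ ∀ t ∈ I, parabolicState (q t) (v t) ∈ K))) ∧
      -- (c4)
      (∃ q₀ v₀ : ℝ → E3,
        IsOrbitWith L h₁ (C1xi L h₁) univ q₀ v₀ ∧ IsCircular univ q₀ ∧
        (∀ t, IsXiElliptic L h₁ (C1xi L h₁) (xi (q₀ t)) ∧
          IsEtaDouble L h₁ (C1xi L h₁) (eta (q₀ t))) ∧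
        IsOrbitallyStable univ q₀ v₀ ∧
        (∀ (c : ℝ) (I : Set ℝ) (q v : ℝ → E3), IsOrbitWith L h₁ c I q v →
          IsBoundedOrbit I q → c = C1xi L h₁ ∧ IsTimeShiftOf I q v q₀ v₀))) := by
  refine ⟨?_, ?_, fun hcrit => ⟨?_, ?_⟩, fun hcrit => ?_⟩
  · rintro I q v hs ⟨t, ht, hLt⟩
    refine ⟨energy (q t) (v t), lenz (q t) (v t), ?_⟩
    have := hs.hasConstants ht (by rw [hLt]; exact hL)
    rwa [hLt] at this
  · intro h c hor I q v ho hb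
    obtain ⟨rfl, hg⟩ := ho.global hL
    have hh := hg.le_hTop hL hb
    rcases hor with hc | hc
    · exact ho.not_isBounded_of_Ceta_lt hL (Ceta_lt_C1xi_of_crit_lt hL hc hh) hb
    · exact absurd hh (not_le.2 hc)
  · obtain ⟨r, hr, h3⟩ := exists_circRadius_of_crit hcrit
    have hE := hr.circEnergy_eq hL h3
    have hS : circSep r = -1 / 9 := by
      rw [← hr.C1xi_eq h3.le, hE, (C1xi_eq_Ceta_of_crit hL hcrit).1]
    rw [← hE, ← hS]
    exact ⟨circPos L r, circVel L r, hr.isGlobalWith.isOrbitWith hL, hr.isCircular,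
      fun c I q v ho hb => hr.eq_of_isBounded hL h3.le ho hb⟩
  · intro h c hh I q v ho
    exact ho.not_isBounded_of_Ceta_lt hL (Ceta_lt_C1xi_of_crit hL hcrit hh)
  -- The thresholds h₁ and h₂ are the energies of the two circular orbits; there `C1xi`,
  -- respectively `C2xi`, meets `Ceta`.
  obtain ⟨r₁, hr₁, h31⟩ := exists_circRadius_low hL hcrit
  obtain ⟨r₂, hr₂, h32⟩ := exists_circRadius_high hL hcrit
  have ht₁ := hr₁.circEnergy_lt hL h31.ne
  have ht₂ := hr₂.circEnergy_lt hL h32.ne'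
  have e₁ : C1xi L (circEnergy r₁) = Ceta L (circEnergy r₁) := by
    rw [hr₁.C1xi_eq h31.le, hr₁.Ceta_eq]
  have e₂ : C2xi L (circEnergy r₂) = Ceta L (circEnergy r₂) := by
    rw [hr₂.C2xi_eq hL h32.le, hr₂.Ceta_eq]
  have hS₁ := hr₁.C1xi_eq h31.le
  have hS₂ := hr₂.C2xi_eq hL h32.le
  have lt₁ : ∀ h ≤ hTop L, circEnergy r₁ < h → C1xi L h < Ceta L h := fun h hh hlt => by
    linarith [C1xi_strictAnti hL hlt hh, Ceta_strictMono hL hlt]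
  have gt₁ : ∀ h, h < circEnergy r₁ → Ceta L h < C1xi L h := fun h hlt => by
    linarith [C1xi_strictAnti hL hlt ht₁.le, Ceta_strictMono hL hlt]
  have lt₂ : ∀ h ≤ hTop L, circEnergy r₂ < h → C2xi L h < Ceta L h := fun h hh hlt => by
    linarith [C2xi_strictAnti hL hlt hh, Ceta_strictMono hL hlt]
  have gt₂ : ∀ h, h < circEnergy r₂ → Ceta L h < C2xi L h := fun h hlt => by
    linarith [C2xi_strictAnti hL hlt ht₂.le, Ceta_strictMono hL hlt]
  -- Otherwise `C2xi` ≤ `Ceta` = `C1xi` at the energy of r₁, against `C1xi` < `C2xi`.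
  have h12 : circEnergy r₁ < circEnergy r₂ := by
    by_contra! hcon
    have hC := C1xi_lt_C2xi hL ht₁
    rcases hcon.eq_or_lt with he | hlt
    · rw [he] at e₂; linarith
    · linarith [lt₂ _ ht₁.le hlt]
  refine ⟨circEnergy r₁, circEnergy r₂, h12, ht₂, fun h hh => ⟨fun he => ?_, ?_⟩,
    fun h hh => ⟨fun he => ?_, ?_⟩, fun h c hlt I q v ho => ho.not_isBounded_of_Ceta_lt hL (gt₁ h hlt),
    fun h hlt hh => ⟨fun c => ?_, ?_, ?_⟩, ⟨fun c => ?_, ?_, ?_⟩, fun h hI => ?_, ?_⟩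
  · rcases lt_trichotomy h (circEnergy r₁) with hlt | hlt | hlt
    · exact absurd he (gt₁ h hlt).ne'
    · exact hlt
    · exact absurd he (lt₁ h hh hlt).ne
  · rintro rfl; exact e₁
  · rcases lt_trichotomy h (circEnergy r₂) with hlt | hlt | hlt
    · exact absurd he (gt₂ h hlt).ne'
    · exact hlt
    · exact absurd he (lt₂ h hh hlt).ne
  · rintro rfl; exact e₂
  · rw [existsBoundedOrbit_iff hL hh]
    exact ⟨fun H => ⟨H.1, H.2.1⟩, fun H => ⟨H.1, H.2, H.2.trans (lt₂ h hh hlt).le⟩⟩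
  · intro c I q v ho hb
    obtain ⟨rfl, hg⟩ := ho.global hL
    exact ho.oscillates hL ((hg.le_C2xi hL hb).trans_lt (lt₂ h hh hlt)) hb
  · intro c I q v ho hc
    obtain ⟨rfl, hg⟩ := ho.global hL
    have hb := hc.isBoundedOrbit
    exact hg.not_isCircular_of_eta hL
      (hg.isTauPeriodic_eta hL hb ((hg.le_C2xi hL hb).trans_lt (lt₂ h hh hlt))) hc
  · rw [existsBoundedOrbit_iff hL ht₂.le, ← e₂]
    exact ⟨fun H => ⟨H.1, H.2.1⟩, fun H => ⟨H.1, H.2, H.2⟩⟩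
  · intro c I q v hc ho hb
    obtain ⟨h1, h2⟩ := ho.oscillates hL (hc.trans_eq e₂) hb
    exact ⟨h1, fun h => h2 ⟨h, hc⟩⟩
  · rw [hS₂]
    refine ⟨circPos L r₂, circVel L r₂, hr₂.isGlobalWith.isOrbitWith hL, hr₂.isCircular,
      fun t => ⟨hr₂.isXiHyperbolic hL h32 t, hr₂.isEtaDouble hL t⟩,
      hr₂.not_isOrbitallyStable hL h32, ?_, fun I q v ho hb => ?_⟩
    · obtain ⟨q, v, hg, hu⟩ := hr₂.exists_homoclinic hL h32
      obtain ⟨-, -, htop, hbot⟩ := hr₂.homoclinic hL h32 hg hu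
      exact ⟨q, v, hg.isOrbitWith hL, hr₂.not_isCircular_of_homoclinic hL h32 hg hu, htop, hbot⟩
    · obtain ⟨rfl, hg⟩ := ho.global hL
      have hu := hg.u_le_uHigh hL hb 0
      rw [hr₂.uHigh_eq hL h32.le] at hu
      -- An orbit at the double root is the circular one; an orbit inside it lies on the separatrix
      -- and is homoclinic.
      rcases hu.eq_or_lt with hu | hu
      · exact Or.inl (hr₂.isTimeShiftOf_of_uCoord hL hg hu)
      · exact Or.inr ⟨rfl, (hr₂.homoclinic hL h32 hg hu).2.2⟩
  · have hh : h < hTop L := hI.2.trans ht₂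
    have h1 := lt₁ h hh.le hI.1
    have h2 := gt₂ h hI.2
    have hcomp := componentsOf_energySurface hL hh h1 h2
    refine ⟨ncard_componentsOf_energySurface hL hh h1 h2, fun c => ?_, innerSurface L h,
      by rw [hcomp]; exact Or.inl rfl, isCompact_innerSurface hL hh h1 h2, fun K' hK' hc => ?_,
      innerSurface_eq_iUnion hL hh h1 h2, fun c hc => sepLevel_homeomorph_torus hL hh h2 hc,
      sepLevel_C1xi_homeomorph hL hh h1 h2, sepLevel_Ceta_homeomorph hL hh h1 h2, ?_, ?_⟩
    · rw [existsBoundedOrbit_iff hL hh.le]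
      exact ⟨fun H => ⟨H.1, H.2.2⟩, fun H => ⟨H.1, H.2.trans h2.le, H.2⟩⟩
    · rw [hcomp] at hK'
      rcases hK' with rfl | rfl
      · rfl
      · exact absurd hc (not_isCompact_outerSurface hL hh h1 h2)
    · rintro c c' I q v ho ⟨t, -, ht⟩
      obtain ⟨rfl, hg⟩ := ho.global hL
      exact ⟨rfl, hg.mem_sepLevel_of_mem hL hh.le h2 ht⟩
    · intro c I q v ho
      obtain ⟨rfl, hg⟩ := ho.global hL
      rw [hg.isBounded_iff_mem_innerSurface hL hh.le h2]
      exact ⟨fun H t _ => H t, fun H t => H t trivial⟩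
  · rw [hS₁]
    exact ⟨circPos L r₁, circVel L r₁, hr₁.isGlobalWith.isOrbitWith hL, hr₁.isCircular,
      fun t => ⟨hr₁.isXiElliptic hL h31 t, hr₁.isEtaDouble hL t⟩, hr₁.isOrbitallyStable hL h31,
      fun c I q v ho hb => hr₁.eq_of_isBounded hL h31.le ho hb⟩
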